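/- **Proposition 1.4.** Let $\mathbb K=\mathbb R$ or $\mathbb C$; all objects are of class $C^\infty$ if $\mathbb K=\mathbb R$ and holomorphic if $\mathbb K=\mathbb C$. Let $N$ be an $n$-dimensional (Hausdorff, second countable) manifold over $\mathbb K$, $H$ an invertible $(1,1)$-tensor field on $N$, and $\mathcal G$ a foliation (an involutive distribution) on $N$ of codimension $r$. Assume that 1. for every closed $1$-form $\alpha$, defined on an open subset of $N$, with $\operatorname{Ker}\alpha\supset\mathcal G$, the form $\alpha\circ H$ is closed on $\mathcal G$, i.e. $d(\alpha\circ H)(v,w)=0$ for all $v,w\in\mathcal G$ at the same point; 2. the Nijenhuis torsion $N_H(X,Y)=[HX,HY]-H[HX,Y]-H[X,HY]+H^2[X,Y]$ vanishes for all local sections $X,Y$ of $\mathcal G$. Let $\pi:T^*N\to N$ be the projection, $\rho$ the Liouville $1$-form, $\rho_\mu(v)=\mu(\pi_*v)$, and $\omega=d\rho$. Let $\varphi_H:T^*N\to T^*N$, $\varphi_H(\tau)=\tau\circ H$, and $\omega_1=\varphi_H^*\omega$ (so that $\omega_1=\omega(H^*\cdot,\cdot)$, where $H^*$ is the $(1,1)$-tensor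 field on $T^*N$ defined by this equality, called the prolongation of $H$). Let $\mathcal G_0$ be the $\omega$-orthogonal of $\{w\in T(T^*N) : \pi_*w\in H\mathcal G\}$, let $M$ be the quotient of $T^*N$ by the leaves of $\mathcal G_0$, with the quotient topology, and let $\tilde\pi:T^*N\to M$ be the canonical projection. For a symplectic form $\sigma$ let $\Lambda_\sigma$ be its dual bivector field, $\Lambda_\sigma(\sigma(v,\cdot),\sigma(w,\cdot))=\sigma(v,w)$. Then $M$ is Hausdorff and second countable, and it has a structure of manifold over $\mathbb K$ of dimension $2n-r$ for which $\tilde\pi$ is a submersion. On $M$ with this structure there are bivector fields $\Lambda$ and $\Lambda_1$ to which $\Lambda_\omega$ and $\Lambda_{\omega_1}$, respectively, project under $\tilde\pi$, and $(\Lambda,\Lambda_1)$ is a bihamiltonian structure: $\Lambda$, $\Lambda_1$ and $\Lambda+\Lambda_1$ are Poisson structures. -/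

import Mathlib

open scoped Manifold ContDiff Topology

noncomputable section

section General

/-! Local differential calculus on a manifold `P` over `𝕜 = ℝ` (class `C^∞`) or `𝕜 = ℂ`
(holomorphic, as `C^∞` over `ℂ` means complex differentiable), without boundary. -/

variable {𝕜 : Type*} [RCLike 𝕜] {F : Type*} [NormedAddCommGroup F] [NormedSpace 𝕜 F]
  {K : Type*} [TopologicalSpace K] (I : ModelWithCorners 𝕜 F K)
  {P : Type*} [TopologicalSpace P] [ChartedSpace K P] [IsManifold I ∞ P]

/-- The vector field `X` is smooth on the set `U`. -/
def SmoothVectorFieldOn (X : ∀ p : P, TangentSpace I p) (U : Set P) : Prop :=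
  ContMDiffOn I (I.prod 𝓘(𝕜, F)) ∞
    (fun p ↦ Bundle.TotalSpace.mk' F (E := (TangentSpace I : P → Type _)) p (X p)) U

/-- The field `α` of covectors is a smooth `1`-form on the set `U`: it is smooth as a section of
the bundle of linear maps from the tangent bundle to the trivial line bundle. -/
def SmoothOneFormOn (α : ∀ p : P, TangentSpace I p →L[𝕜] 𝕜) (U : Set P) : Prop :=
  ContMDiffOn I (I.prod 𝓘(𝕜, F →L[𝕜] 𝕜)) ∞
    (fun p ↦ Bundle.TotalSpace.mk' (F →L[𝕜] 𝕜)
      (E := fun p : P ↦ TangentSpace I p →L[𝕜] Bundle.Trivial P 𝕜 p) p (α p)) U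

/-- The field `H` of endomorphisms of the tangent spaces is a smooth `(1,1)`-tensor field. -/
def SmoothTensor11 (H : ∀ p : P, TangentSpace I p →L[𝕜] TangentSpace I p) : Prop :=
  ContMDiff I (I.prod 𝓘(𝕜, F →L[𝕜] F)) ∞
    (fun p ↦ Bundle.TotalSpace.mk' (F →L[𝕜] F)
      (E := fun p : P ↦ TangentSpace I p →L[𝕜] TangentSpace I p) p (H p))

/-- The `1`-form `α` written in the preferred chart at `p`, i.e. its pullback under the inverse of
that chart. -/
def oneFormInChart (α : ∀ p : P, TangentSpace I p →L[𝕜] 𝕜) (p : P) (y : F) : F →L[𝕜] 𝕜 :=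
  (α ((extChartAt I p).symm y)).comp (mfderiv 𝓘(𝕜, F) I (extChartAt I p).symm y)

/-- The pullback of a bilinear form under a linear map. -/
def pullbackBilin {V W : Type*} [NormedAddCommGroup V] [NormedSpace 𝕜 V]
    [NormedAddCommGroup W] [NormedSpace 𝕜 W]
    (B : W →L[𝕜] W →L[𝕜] 𝕜) (A : V →L[𝕜] W) : V →L[𝕜] V →L[𝕜] 𝕜 :=
  B.bilinearComp A A

/-- The exterior derivative `dα` at `p`, `dα(v, w) = (D_v α)(w) - (D_w α)(v)`, computed in the
preferred chart at `p`. -/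
def oneFormExtDeriv (α : ∀ p : P, TangentSpace I p →L[𝕜] 𝕜) (p : P) :
    TangentSpace I p →L[𝕜] TangentSpace I p →L[𝕜] 𝕜 :=
  let L : F →L[𝕜] F →L[𝕜] 𝕜 := fderiv 𝕜 (oneFormInChart I α p) (extChartAt I p p)
  pullbackBilin (V := F) (L - L.flip) (mfderiv I 𝓘(𝕜, F) (extChartAt I p) p)

/-- The Nijenhuis torsion
`N_H(X, Y) = [HX, HY] - H[HX, Y] - H[X, HY] + H²[X, Y]` on vector fields. -/
def nijenhuis (H : ∀ p : P, TangentSpace I p →L[𝕜] TangentSpace I p)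
    (X Y : ∀ p : P, TangentSpace I p) (p : P) : TangentSpace I p :=
  VectorField.mlieBracket I (fun q ↦ H q (X q)) (fun q ↦ H q (Y q)) p
    - H p (VectorField.mlieBracket I (fun q ↦ H q (X q)) Y p)
    - H p (VectorField.mlieBracket I X (fun q ↦ H q (Y q)) p)
    + H p (H p (VectorField.mlieBracket I X Y p))

/-- `D` is a foliation of codimension `r`: a smooth distribution (locally spanned by finitely many
smooth vector fields, of constant corank `r`) that is involutive. -/
structure IsFoliation (r : ℕ) (D : ∀ p : P, Submodule 𝕜 (TangentSpace I p)) : Prop where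
  codim : ∀ p, Module.finrank 𝕜 (TangentSpace I p ⧸ D p) = r
  smooth : ∀ p₀ : P, ∃ U : Set P, IsOpen U ∧ p₀ ∈ U ∧
    ∃ (m : ℕ) (X : Fin m → ∀ p : P, TangentSpace I p),
      (∀ i, SmoothVectorFieldOn I (X i) U) ∧
      ∀ p ∈ U, D p = Submodule.span 𝕜 (Set.range fun i ↦ X i p)
  involutive : ∀ U : Set P, IsOpen U → ∀ X Y : ∀ p : P, TangentSpace I p,
    SmoothVectorFieldOn I X U → SmoothVectorFieldOn I Y U →
    (∀ p ∈ U, X p ∈ D p) → (∀ p ∈ U, Y p ∈ D p) →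
    ∀ p ∈ U, VectorField.mlieBracket I X Y p ∈ D p

/-- `α ∘ H` is closed along `D` for every closed `1`-form `α`, defined on an open set, whose
kernel contains `D`. -/
def ClosedAlong (H : ∀ p : P, TangentSpace I p →L[𝕜] TangentSpace I p)
    (D : ∀ p : P, Submodule 𝕜 (TangentSpace I p)) : Prop :=
  ∀ U : Set P, IsOpen U → ∀ α : ∀ p : P, TangentSpace I p →L[𝕜] 𝕜,
    SmoothOneFormOn I α U →
    (∀ p ∈ U, oneFormExtDeriv I α p = 0) →
    (∀ p ∈ U, ∀ v ∈ D p, α p v = 0) →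
    ∀ p ∈ U, ∀ v ∈ D p, ∀ w ∈ D p, oneFormExtDeriv I (fun q ↦ (α q).comp (H q)) p v w = 0

/-- The restriction of the Nijenhuis torsion of `H` to `D` vanishes. -/
def NijenhuisVanishesOn (H : ∀ p : P, TangentSpace I p →L[𝕜] TangentSpace I p)
    (D : ∀ p : P, Submodule 𝕜 (TangentSpace I p)) : Prop :=
  ∀ U : Set P, IsOpen U → ∀ X Y : ∀ p : P, TangentSpace I p,
    SmoothVectorFieldOn I X U → SmoothVectorFieldOn I Y U →
    (∀ p ∈ U, X p ∈ D p) → (∀ p ∈ U, Y p ∈ D p) →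
    ∀ p ∈ U, nijenhuis I H X Y p = 0

/-- `p` and `q` lie on a connected smooth (holomorphic, if `𝕜 = ℂ`) curve tangent to `D`. -/
def JoinedByTangentCurve (D : ∀ p : P, Submodule 𝕜 (TangentSpace I p)) (p q : P) : Prop :=
  ∃ (U : Set 𝕜) (γ : 𝕜 → P), IsOpen U ∧ IsPreconnected U ∧ ContMDiffOn 𝓘(𝕜, 𝕜) I ∞ γ U ∧
    (∀ t ∈ U, mfderiv 𝓘(𝕜, 𝕜) I γ t (1 : 𝕜) ∈ D (γ t)) ∧
    ∃ a ∈ U, ∃ b ∈ U, γ a = p ∧ γ b = q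

/-- Lying on the same leaf of `D`: being joined by a finite chain of curves tangent to `D`. -/
def leafSetoid (D : ∀ p : P, Submodule 𝕜 (TangentSpace I p)) : Setoid P :=
  Relation.EqvGen.setoid (JoinedByTangentCurve I D)

/-- A field of bivectors on `P`, a bivector at `p` being a bilinear form on the cotangent space. -/
abbrev BivectorField : Type _ := ∀ p : P, LinearMap.BilinForm 𝕜 (TangentSpace I p →L[𝕜] 𝕜)

/-- The bracket of functions `{f, g} = Λ(df, dg)`. -/
def poissonBracket (Λ : BivectorField I (P := P)) (f g : P → 𝕜) (p : P) : 𝕜 :=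
  Λ p (mfderiv I 𝓘(𝕜, 𝕜) f p) (mfderiv I 𝓘(𝕜, 𝕜) g p)

/-- `Λ` is a Poisson structure: a smooth skew-symmetric bivector field whose bracket satisfies the
Jacobi identity on functions defined on open sets. -/
structure IsPoisson (Λ : BivectorField I (P := P)) : Prop where
  alternating : ∀ p, (Λ p).IsAlt
  smooth : ∀ U : Set P, IsOpen U → ∀ f g : P → 𝕜,
    ContMDiffOn I 𝓘(𝕜, 𝕜) ∞ f U → ContMDiffOn I 𝓘(𝕜, 𝕜) ∞ g U →
    ContMDiffOn I 𝓘(𝕜, 𝕜) ∞ (poissonBracket I Λ f g) U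
  jacobi : ∀ U : Set P, IsOpen U → ∀ f g h : P → 𝕜,
    ContMDiffOn I 𝓘(𝕜, 𝕜) ∞ f U → ContMDiffOn I 𝓘(𝕜, 𝕜) ∞ g U →
    ContMDiffOn I 𝓘(𝕜, 𝕜) ∞ h U → ∀ p ∈ U,
      poissonBracket I Λ f (poissonBracket I Λ g h) p
        + poissonBracket I Λ g (poissonBracket I Λ h f) p
        + poissonBracket I Λ h (poissonBracket I Λ f g) p = 0

/-- `(Λ, Λ₁)` is a bihamiltonian structure: `Λ`, `Λ₁` and `Λ + Λ₁` are Poisson structures. -/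
structure IsBihamiltonian (Λ Λ₁ : BivectorField I (P := P)) : Prop where
  left : IsPoisson I Λ
  right : IsPoisson I Λ₁
  add : IsPoisson I (fun p ↦ Λ p + Λ₁ p)

/-- The dual bivector field of a nondegenerate `2`-form `σ`: if `σ(v, ·) = a` and `σ(w, ·) = b`,
its value on `(a, b)` is `σ(v, w)`. -/
def dualBivector (σ : ∀ p : P, TangentSpace I p →L[𝕜] TangentSpace I p →L[𝕜] 𝕜) :
    BivectorField I (P := P) := fun p ↦
  LinearMap.mk₂ 𝕜 (fun a b ↦ σ p ((σ p).inverse a) ((σ p).inverse b))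
    (by simp) (by simp) (by simp) (by simp)

/-- The bivector field `Λ` on `P` projects to the bivector field `Λ'` on `P'` under `f`. -/
def ProjectsTo {F' : Type*} [NormedAddCommGroup F'] [NormedSpace 𝕜 F']
    {K' : Type*} [TopologicalSpace K'] (I' : ModelWithCorners 𝕜 F' K')
    {P' : Type*} [TopologicalSpace P'] [ChartedSpace K' P']
    (f : P → P') (Λ : BivectorField I (P := P)) (Λ' : BivectorField I' (P := P')) : Prop :=
  ∀ (p : P) (a b : TangentSpace I' (f p) →L[𝕜] 𝕜),
    Λ' (f p) a b = Λ p (a.comp (mfderiv I I' f p)) (b.comp (mfderiv I I' f p))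

end General

section Cotangent

variable (𝕜 : Type*) [RCLike 𝕜] (E : Type*) [NormedAddCommGroup E] [NormedSpace 𝕜 E]
  (N : Type*) [TopologicalSpace N] [ChartedSpace E N]

/-- The cotangent bundle `T*N`, with the topology and the vector bundle atlas of Mathlib's bundle
of linear maps from the tangent bundle to the trivial line bundle. -/
abbrev CotangentBundle [IsManifold 𝓘(𝕜, E) ∞ N] : Type _ :=
  Bundle.TotalSpace (E →L[𝕜] 𝕜)
    (fun x : N ↦ TangentSpace 𝓘(𝕜, E) x →L[𝕜] Bundle.Trivial N 𝕜 x)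

/-- The model of `T*N`. -/
abbrev cotangentModel : ModelWithCorners 𝕜 (E × (E →L[𝕜] 𝕜)) (ModelProd E (E →L[𝕜] 𝕜)) :=
  𝓘(𝕜, E).prod 𝓘(𝕜, E →L[𝕜] 𝕜)

variable {𝕜 E N} [IsManifold 𝓘(𝕜, E) ∞ N]

/-- The differential `π_*` of the projection `π : T*N → N`. -/
def cotangentProjDeriv (μ : CotangentBundle 𝕜 E N) :
    TangentSpace (cotangentModel 𝕜 E) μ →L[𝕜] TangentSpace 𝓘(𝕜, E) μ.proj :=
  mfderiv (cotangentModel 𝕜 E) 𝓘(𝕜, E)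
    (Bundle.TotalSpace.proj : CotangentBundle 𝕜 E N → N) μ

/-- The Liouville `1`-form `ρ_μ(v) = μ(π_* v)`. -/
def liouvilleOneForm (μ : CotangentBundle 𝕜 E N) :
    TangentSpace (cotangentModel 𝕜 E) μ →L[𝕜] 𝕜 :=
  (μ.snd : TangentSpace 𝓘(𝕜, E) μ.proj →L[𝕜] 𝕜).comp (cotangentProjDeriv μ)

/-- The Liouville `2`-form `ω = dρ`. -/
def liouvilleForm (μ : CotangentBundle 𝕜 E N) :
    TangentSpace (cotangentModel 𝕜 E) μ →L[𝕜] TangentSpace (cotangentModel 𝕜 E) μ →L[𝕜] 𝕜 :=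
  oneFormExtDeriv (cotangentModel 𝕜 E) liouvilleOneForm μ

variable (H : ∀ x : N, TangentSpace 𝓘(𝕜, E) x →L[𝕜] TangentSpace 𝓘(𝕜, E) x)

/-- The morphism `φ_H : T*N → T*N`, `φ_H(τ) = τ ∘ H`. -/
def cotangentMap (μ : CotangentBundle 𝕜 E N) : CotangentBundle 𝕜 E N :=
  ⟨μ.proj, μ.snd.comp (H μ.proj)⟩

/-- The `2`-form `ω₁ = φ_H^* ω`. -/
def liouvilleForm₁ (μ : CotangentBundle 𝕜 E N) :
    TangentSpace (cotangentModel 𝕜 E) μ →L[𝕜] TangentSpace (cotangentModel 𝕜 E) μ →L[𝕜] 𝕜 :=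
  pullbackBilin (V := E × (E →L[𝕜] 𝕜)) (W := E × (E →L[𝕜] 𝕜))
    (liouvilleForm (cotangentMap H μ))
    (mfderiv (cotangentModel 𝕜 E) (cotangentModel 𝕜 E) (cotangentMap H) μ)

variable (G : ∀ x : N, Submodule 𝕜 (TangentSpace 𝓘(𝕜, E) x))

/-- The distribution `𝒢₀` on `T*N`: the `ω`-orthogonal of `{w | π_* w ∈ H 𝒢}`. -/
def orthogonalFoliation (μ : CotangentBundle 𝕜 E N) :
    Submodule 𝕜 (TangentSpace (cotangentModel 𝕜 E) μ) where
  carrier := {v | ∀ w, cotangentProjDeriv μ w ∈ (G μ.proj).map (H μ.proj).toLinearMap →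
    liouvilleForm μ v w = 0}
  add_mem' {v v'} hv hv' w hw := by
    simp only [Set.mem_ofPred_eq] at hv hv'
    simp [hv w hw, hv' w hw]
  zero_mem' w _ := by simp
  smul_mem' c v hv w hw := by
    simp only [Set.mem_ofPred_eq] at hv
    simp [hv w hw]

/-- The quotient `M` of `T*N` by (the leaves of) `𝒢₀`, with the quotient topology. -/
abbrev CotangentQuotient : Type _ :=
  Quotient (leafSetoid (cotangentModel 𝕜 E) (orthogonalFoliation H G))

/-- The canonical projection `T*N → M`. -/
def toCotangentQuotient : CotangentBundle 𝕜 E N → CotangentQuotient H G :=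
  Quotient.mk _

end Cotangent

end

/-!
The two bivector fields on the quotient are, locally, the linear Poisson structures on the dual of
two Lie algebroids which share the underlying vector bundle `G`. One has the anchor `G ⊆ TN` and the
bracket of vector fields; the other has the anchor `H : G → TN`, whose image is `H G`.

That `H G` is involutive, so that the second one exists, is where the hypotheses enter. By the
Frobenius theorem, every covector that annihilates `G` at a point is the differential of a first
integral `f` of `G`. Closedness of `df ∘ H` along `G` therefore says that
`[HX, Y] + [X, HY] - H[X, Y]` is a section of `G` when `X` and `Y` are (`ClosedAlong.bracket_mem`),
and then the vanishing of the Nijenhuis torsion says that `[HX, HY]` is `H` of this section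
(`IsFrameInChart.exists_bracket_imageFrame_eq`). The same two facts make the algebroids compatible:
for every constant `t` the anchor `H + t` and the combined bracket satisfy the anchor identity. The
Jacobiator of this pencil is quadratic in `t`, the quadratic coefficient being the Jacobiator of one
of the two algebroids; it vanishes whenever the anchor is injective, which is so for the two given
algebroids and for `t` larger than the norm of `H`, hence it vanishes for all `t`
(`IsLieAlgebroid.add`).

A vector is in `𝒢₀` exactly when it is vertical and, as a covector, annihilates `H G`. Thus the
leaves are the sets of covectors at one point with a given restriction to `H G` (`leafSetoid_iff`):
tangent curves do not leave these sets since base point and restriction have vanishing derivative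
along them, and two covectors with the same restriction are joined by a line. A local frame
of `H G` gives the base point and the values of a covector on the frame as coordinates on the
quotient (`IsFrameInChart.isQuotientCoordinates`), and these coordinates define the manifold
structure (`exists_chartedSpace_quotient`). The differentials of these coordinates are spanned by
pullbacks of covectors on `N` and by differentials of the momentum functions `μ ↦ μ (H X)`, with `X`
in `G`. On them `Λ_ω` is given by the brackets `[HX, HY]`; since `φ_H` pulls the momentum of `X` back
to the momentum of `HX`, `Λ_{ω₁}` is given by the brackets `[X, Y]`. These are the two linear Poisson
structures (`IsFrameInChart.dualBivector_coordDeriv`, `IsFrameInChart.dualBivector_coordDeriv₁`), and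
they depend on the quotient coordinates only, so that the bivector fields project.

The Frobenius theorem is proved over `ℝ` and `ℂ` at once (`exists_firstIntegral`). A foliation has
frames of commuting fields; the time-one flow along such fields, which straightens the foliation, is
obtained from the inverse function theorem in the Banach space of continuous curves, where the
integral equation of the flow is a smooth equation. For `𝕜 = ℂ` the curves have a real parameter but
the equation is holomorphic in the initial value, so no separate argument is needed.
-/

open scoped Manifold ContDiff Topology

noncomputable section

set_option linter.unusedSectionVars false
set_option maxSynthPendingDepth 3

/-! ### Superposition operators on spaces of continuous maps -/

section Superposition

universe u

variable {𝕜 : Type*} [RCLike 𝕜] {α : Type*} [TopologicalSpace α] [CompactSpace α]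

/-- The superposition operator `y ↦ g ∘ y` on continuous maps. Where `g ∘ y` is not continuous it
takes the value `0`; it is only used on the open set of those `y` whose image lies in a set on
which `g` is continuous. -/
def superposition {E F : Type*} [NormedAddCommGroup E] [NormedAddCommGroup F] (g : E → F)
    (y : C(α, E)) : C(α, F) :=
  open Classical in if h : Continuous (g ∘ y) then ⟨g ∘ y, h⟩ else 0

/-- A continuous family of linear maps acts pointwise on continuous maps. -/
def pointwiseApply (𝕜 : Type*) [RCLike 𝕜] (α : Type*) [TopologicalSpace α] [CompactSpace α]
    (E F : Type*) [NormedAddCommGroup E] [NormedSpace 𝕜 E] [NormedAddCommGroup F]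
    [NormedSpace 𝕜 F] : C(α, E →L[𝕜] F) →L[𝕜] C(α, E) →L[𝕜] C(α, F) :=
  LinearMap.mkContinuous₂
    (LinearMap.mk₂ 𝕜 (fun (A : C(α, E →L[𝕜] F)) (h : C(α, E)) ↦
        (⟨fun s ↦ A s (h s), by fun_prop⟩ : C(α, F)))
      (fun _ _ _ ↦ by ext; simp) (fun _ _ _ ↦ by ext; simp)
      (fun _ _ _ ↦ by ext; simp) (fun _ _ _ ↦ by ext; simp)) 1
    (fun A h ↦ by
      rw [ContinuousMap.norm_le _ (by positivity)]
      intro s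
      simpa using (A s).le_of_opNorm_le_of_le (A.norm_coe_le_norm s) (h.norm_coe_le_norm s))

@[simp]
lemma pointwiseApply_apply {E F : Type*} [NormedAddCommGroup E] [NormedSpace 𝕜 E]
    [NormedAddCommGroup F] [NormedSpace 𝕜 F] (A : C(α, E →L[𝕜] F)) (h : C(α, E)) (s : α) :
    pointwiseApply 𝕜 α E F A h s = A s (h s) := rfl

omit [CompactSpace α] in
lemma superposition_apply {E F : Type*} [NormedAddCommGroup E] [NormedAddCommGroup F] {g : E → F}
    {O : Set E} (hg : ContinuousOn g O) {y : C(α, E)} (hy : ∀ s, y s ∈ O) (s : α) :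
    superposition g y s = g (y s) := by
  have h : Continuous (g ∘ y) := hg.comp_continuous y.continuous hy
  simp [superposition, h]

lemma isOpen_setOf_forall_mem {E : Type*} [NormedAddCommGroup E] {O : Set E} (hO : IsOpen O) :
    IsOpen {y : C(α, E) | ∀ s, y s ∈ O} := by
  simpa [Set.MapsTo] using
    ContinuousMap.isOpen_setOfPred_mapsTo (X := α) (isCompact_univ (X := α)) hO

/-- The derivative of the superposition operator of `g` is pointwise application of `dg`. -/
lemma hasFDerivAt_superposition {E F : Type*} [NormedAddCommGroup E] [NormedSpace 𝕜 E]
    [NormedAddCommGroup F] [NormedSpace 𝕜 F] {g : E → F} {O : Set E} (hO : IsOpen O)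
    (hg : ContDiffOn 𝕜 ∞ g O) {y : C(α, E)} (hy : ∀ s, y s ∈ O) :
    HasFDerivAt (superposition g)
      (pointwiseApply 𝕜 α E F (superposition (fderiv 𝕜 g) y)) y := by
  have hg' : ContinuousOn (fderiv 𝕜 g) O := hg.continuousOn_fderiv_of_isOpen hO (by simp)
  apply HasFDerivAt.of_isLittleO
  rw [Asymptotics.isLittleO_iff]
  intro c hc
  -- the first order expansion of `g` is uniform along the compact image of `y`
  have key : ∀ᶠ h in 𝓝 (0 : E), ∀ e ∈ Set.range y,
      ‖g (e + h) - g e - fderiv 𝕜 g e h‖ ≤ c * ‖h‖ := by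
    refine (isCompact_range y.continuous).eventually_forall_of_forall_eventually ?_
    rintro e ⟨s, rfl⟩
    have hs := hO.mem_nhds (hy s)
    have h1 := ((hg.contDiffAt hs).hasStrictFDerivAt (by simp)).isLittleO
    rw [Asymptotics.isLittleO_iff] at h1
    have h2 := h1 (half_pos hc)
    have h3 : ContinuousAt (fderiv 𝕜 g) (y s) := hg'.continuousAt hs
    have t1 : Filter.Tendsto (fun z : E × E ↦ (z.2 + z.1, z.2)) (𝓝 (0, y s)) (𝓝 (y s, y s)) := by
      have : Continuous (fun z : E × E ↦ (z.2 + z.1, z.2)) := by fun_prop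
      simpa using this.tendsto (0, y s)
    have t2 : Filter.Tendsto (fun z : E × E ↦ fderiv 𝕜 g z.2) (𝓝 (0, y s))
        (𝓝 (fderiv 𝕜 g (y s))) := by
      refine h3.tendsto.comp ?_
      simpa using (continuous_snd (X := E) (Y := E)).tendsto (0, y s)
    filter_upwards [t1.eventually h2, t2.eventually (Metric.ball_mem_nhds _ (half_pos hc))]
      with z hz1 hz2
    simp only [add_sub_cancel_left] at hz1
    have hz3 : ‖fderiv 𝕜 g (y s) z.1 - fderiv 𝕜 g z.2 z.1‖ ≤ c / 2 * ‖z.1‖ := by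
      rw [← sub_apply]
      refine ContinuousLinearMap.le_of_opNorm_le _ ?_ _
      have : dist (fderiv 𝕜 g z.2) (fderiv 𝕜 g (y s)) < c / 2 := hz2
      rw [dist_comm, dist_eq_norm] at this
      exact this.le
    calc ‖g (z.2 + z.1) - g z.2 - fderiv 𝕜 g z.2 z.1‖
        = ‖(g (z.2 + z.1) - g z.2 - fderiv 𝕜 g (y s) z.1)
            + (fderiv 𝕜 g (y s) z.1 - fderiv 𝕜 g z.2 z.1)‖ := by congr 1; abel
      _ ≤ c / 2 * ‖z.1‖ + c / 2 * ‖z.1‖ := norm_add_le_of_le hz1 hz3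
      _ = c * ‖z.1‖ := by ring
  have t : Filter.Tendsto (fun x' : C(α, E) ↦ ‖x' - y‖) (𝓝 y) (𝓝 0) := by
    have : Continuous (fun x' : C(α, E) ↦ ‖x' - y‖) := by fun_prop
    simpa using this.tendsto y
  obtain ⟨δ, hδ, hball⟩ := Metric.eventually_nhds_iff.1 key
  filter_upwards [(isOpen_setOf_forall_mem hO).mem_nhds hy, t.eventually (gt_mem_nhds hδ)]
    with x' hx' hd
  rw [ContinuousMap.norm_le _ (by positivity)]
  intro s
  have hs : ‖x' s - y s‖ ≤ ‖x' - y‖ := (x' - y).norm_coe_le_norm s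
  have := hball (y := x' s - y s) (by simpa using hs.trans_lt hd) (y s) ⟨s, rfl⟩
  simp only [ContinuousMap.sub_apply, pointwiseApply_apply,
    superposition_apply hg.continuousOn hx', superposition_apply hg.continuousOn hy,
    superposition_apply hg' hy]
  calc _ ≤ c * ‖x' s - y s‖ := by simpa using this
    _ ≤ _ := by gcongr

/-- The superposition operator is smooth because its derivative is built from the superposition
operator of `dg`. The target space changes in the induction, which forces `E` and `F` to lie in the
same universe. -/
lemma contDiffOn_superposition {E F : Type u} [NormedAddCommGroup E] [NormedSpace 𝕜 E]
    [NormedAddCommGroup F] [NormedSpace 𝕜 F] {g : E → F} {O : Set E} (hO : IsOpen O)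
    (hg : ContDiffOn 𝕜 ∞ g O) :
    ContDiffOn 𝕜 ∞ (superposition g) {y : C(α, E) | ∀ s, y s ∈ O} := by
  rw [contDiffOn_infty]
  intro n
  induction n generalizing F with
  | zero =>
    exact contDiffOn_zero.2 fun y hy ↦
      (hasFDerivAt_superposition hO hg hy).continuousAt.continuousWithinAt
  | succ n ih =>
    push_cast
    rw [contDiffOn_succ_iff_fderiv_of_isOpen (isOpen_setOf_forall_mem hO)]
    refine ⟨fun y hy ↦
      (hasFDerivAt_superposition hO hg hy).differentiableAt.differentiableWithinAt, by simp, ?_⟩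
    have h := ih ((contDiffOn_infty_iff_fderiv_of_isOpen hO).1 hg).2
    have h4 := h.continuousLinearMap_comp (pointwiseApply 𝕜 α E F)
    refine ContDiffOn.congr (f := fun y ↦ pointwiseApply 𝕜 α E F (superposition (fderiv 𝕜 g) y))
      h4 fun y hy ↦
        (hasFDerivAt_superposition hO hg hy).fderiv

end Superposition

/-! ### First integrals of commuting vector fields -/

section Frobenius

universe u

variable {𝕜 : Type*} [RCLike 𝕜]

/-- The constant functions, as a continuous linear map into the space of continuous maps. -/
def constCLM (𝕜 : Type*) [RCLike 𝕜] (α : Type*) [TopologicalSpace α] [CompactSpace α]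
    (E : Type*) [NormedAddCommGroup E] [NormedSpace 𝕜 E] : E →L[𝕜] C(α, E) :=
  LinearMap.mkContinuous
    { toFun := ContinuousMap.const α
      map_add' := fun _ _ ↦ rfl
      map_smul' := fun _ _ ↦ rfl } 1
    (fun x ↦ by
      rw [ContinuousMap.norm_le _ (by positivity)]
      exact fun s ↦ (one_mul ‖x‖).ge)

@[simp]
lemma constCLM_apply {α : Type*} [TopologicalSpace α] [CompactSpace α]
    {E : Type*} [NormedAddCommGroup E] [NormedSpace 𝕜 E] (x : E) (s : α) :
    constCLM 𝕜 α E x s = x := rfl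

variable {E : Type*} [NormedAddCommGroup E] [NormedSpace 𝕜 E] [NormedSpace ℝ E]
  [IsScalarTower ℝ 𝕜 E] [CompleteSpace E]

/-- The primitive of a continuous function on the unit interval that vanishes at `0`, as a
continuous linear map over the field `𝕜`. -/
def primitive (𝕜 : Type*) [RCLike 𝕜] (E : Type*) [NormedAddCommGroup E] [NormedSpace 𝕜 E]
    [NormedSpace ℝ E] [IsScalarTower ℝ 𝕜 E] [CompleteSpace E] :
    C(unitInterval, E) →L[𝕜] C(unitInterval, E) :=
  LinearMap.mkContinuous
    { toFun := fun y ↦ ⟨fun s ↦ ∫ t in (0 : ℝ)..s, Set.IccExtend zero_le_one y t, by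
        have h : Continuous (Set.IccExtend (zero_le_one (α := ℝ)) y) := y.continuous.Icc_extend'
        exact (intervalIntegral.continuous_primitive
          (fun a b ↦ h.intervalIntegrable a b) 0).comp continuous_subtype_val⟩
      map_add' := fun y z ↦ by
        have h (y : C(unitInterval, E)) : Continuous (Set.IccExtend (zero_le_one (α := ℝ)) y) :=
          y.continuous.Icc_extend'
        ext s
        exact intervalIntegral.integral_add ((h y).intervalIntegrable _ _)
          ((h z).intervalIntegrable _ _)
      map_smul' := fun c y ↦ by
        ext s
        exact intervalIntegral.integral_smul c _ } 1
    (fun y ↦ by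
      rw [ContinuousMap.norm_le _ (by positivity)]
      intro s
      have := intervalIntegral.norm_integral_le_of_norm_le_const (a := (0 : ℝ)) (b := s)
        (f := Set.IccExtend (zero_le_one (α := ℝ)) y) (C := ‖y‖)
        (fun t _ ↦ y.norm_coe_le_norm _)
      refine this.trans ?_
      rw [sub_zero, abs_of_nonneg s.2.1, one_mul]
      exact mul_le_of_le_one_right (norm_nonneg _) s.2.2)

lemma primitive_apply (y : C(unitInterval, E)) (s : unitInterval) :
    primitive 𝕜 E y s = ∫ t in (0 : ℝ)..s, Set.IccExtend zero_le_one y t := rfl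

lemma hasDerivAt_integral_IccExtend (y : C(unitInterval, E)) (s : ℝ) :
    HasDerivAt (fun s : ℝ ↦ ∫ t in (0 : ℝ)..s, Set.IccExtend zero_le_one y t)
      (Set.IccExtend zero_le_one y s) s := by
  have h : Continuous (Set.IccExtend (zero_le_one (α := ℝ)) y) := y.continuous.Icc_extend'
  exact intervalIntegral.integral_hasDerivAt_right (h.intervalIntegrable _ _)
    (h.stronglyMeasurableAtFilter _ _) h.continuousAt

lemma primitive_eq_sub {f : ℝ → E} {a : C(unitInterval, E)}
    (h : ∀ s : unitInterval, HasDerivAt f (a s) s) (s : unitInterval) :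
    primitive 𝕜 E a s = f s - f 0 := by
  have hc : Continuous (Set.IccExtend (zero_le_one (α := ℝ)) a) := a.continuous.Icc_extend'
  rw [primitive_apply]
  refine intervalIntegral.integral_eq_sub_of_hasDerivAt (fun t ht ↦ ?_)
    (hc.intervalIntegrable _ _)
  rw [Set.uIcc_of_le s.2.1] at ht
  have ht' : t ∈ unitInterval := ⟨ht.1, ht.2.trans s.2.2⟩
  rw [Set.IccExtend_of_mem _ _ ht']
  exact h ⟨t, ht'⟩

/-- The variation of an integral curve of `X v` when the starting point moves along `X u` and `v`
moves along `-u`: as the fields commute it is `(1 - s) X u`, which vanishes at time `1`. -/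
lemma variation_eq {E W : Type u} [NormedAddCommGroup E] [NormedSpace 𝕜 E] [NormedSpace ℝ E]
    [IsScalarTower ℝ 𝕜 E] [CompleteSpace E] [NormedAddCommGroup W] [NormedSpace 𝕜 W]
    {X : E → W →L[𝕜] E} {O : Set E} (hO : IsOpen O) (hX : ContDiffOn 𝕜 ∞ X O)
    (hcomm : ∀ z ∈ O, ∀ u v, fderiv 𝕜 X z (X z u) v = fderiv 𝕜 X z (X z v) u)
    {y : C(unitInterval, E)} (hy : ∀ s, y s ∈ O) {v : W} {q : E}
    (hyv : y = constCLM 𝕜 _ E q + primitive 𝕜 E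
      (pointwiseApply 𝕜 _ W E (superposition X y) (constCLM 𝕜 _ W v)))
    (u : W) {w : C(unitInterval, E)} (hw : ∀ s, w s = (1 - (s : ℝ)) • X (y s) u) :
    w = constCLM 𝕜 _ E (X q u) + primitive 𝕜 E
      (pointwiseApply 𝕜 _ W E (pointwiseApply 𝕜 _ E (W →L[𝕜] E)
          (superposition (fderiv 𝕜 X) y) w) (constCLM 𝕜 _ W v)
        - pointwiseApply 𝕜 _ W E (superposition X y) (constCLM 𝕜 _ W u)) := by
  set a := pointwiseApply 𝕜 _ W E (superposition X y) (constCLM 𝕜 _ W v) with ha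
  let Y : ℝ → E := fun s ↦ q + ∫ t in (0 : ℝ)..s, Set.IccExtend zero_le_one a t
  have hX' : ContinuousOn (fderiv 𝕜 X) O := hX.continuousOn_fderiv_of_isOpen hO (by simp)
  have hYy (s : unitInterval) : Y s = y s := by
    conv_rhs => rw [hyv]
    simp [Y, primitive_apply]
  have hY0 : Y 0 = q := by simp [Y]
  have hY (s : unitInterval) : HasDerivAt Y (X (y s) v) s := by
    have := (hasDerivAt_integral_IccExtend a s).const_add q
    rw [Set.IccExtend_of_mem _ _ s.2] at this
    have ha' : a s = X (y s) v := by simp [ha, superposition_apply hX.continuousOn hy]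
    exact ha' ▸ this
  have hXu (s : unitInterval) : HasDerivAt (fun t : ℝ ↦ X (Y t) u)
      (fderiv 𝕜 X (y s) (X (y s) v) u) s := by
    have h1 : HasFDerivAt X (fderiv 𝕜 X (y s)) (y s) :=
      ((hX.contDiffAt (hO.mem_nhds (hy s))).differentiableAt (by simp)).hasFDerivAt
    have h2 : HasFDerivAt (fun z ↦ X z u) ((fderiv 𝕜 X (y s)).flip u) (y s) := by
      simpa using! h1.clm_apply (hasFDerivAt_const u (y s))
    have h3 := h2.restrictScalars ℝ
    rw [← hYy s] at h3
    simpa [hYy s] using! h3.comp_hasDerivAt (s : ℝ) (hY s)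
  have hF (s : unitInterval) : HasDerivAt (fun t : ℝ ↦ (1 - t) • X (Y t) u)
      ((pointwiseApply 𝕜 _ W E (pointwiseApply 𝕜 _ E (W →L[𝕜] E)
          (superposition (fderiv 𝕜 X) y) w) (constCLM 𝕜 _ W v)
        - pointwiseApply 𝕜 _ W E (superposition X y) (constCLM 𝕜 _ W u)) s) s := by
    have h1 : HasDerivAt (fun t : ℝ ↦ 1 - t) (-1) (s : ℝ) := by
      simpa using (hasDerivAt_id (s : ℝ)).const_sub 1
    have h2 := h1.smul (hXu s)
    have h3 : superposition (fderiv 𝕜 X) y s = fderiv 𝕜 X (y s) := superposition_apply hX' hy s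
    convert! h2 using 1
    simp only [ContinuousMap.sub_apply, pointwiseApply_apply, constCLM_apply,
      superposition_apply hX.continuousOn hy, h3, hw, hYy]
    rw [ContinuousLinearMap.map_smul_of_tower, hcomm _ (hy s) v u]
    simp [sub_eq_add_neg]
  ext s
  have := primitive_eq_sub (𝕜 := 𝕜) hF s
  rw [ContinuousMap.add_apply, this, hw, hYy, hY0]
  simp

end Frobenius

/-! ### Flows depending on parameters, and the Frobenius theorem -/

section Frobenius

universe u

variable {𝕜 : Type*} [RCLike 𝕜] {E W : Type u} [NormedAddCommGroup E] [NormedSpace 𝕜 E]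
  [NormedSpace ℝ E] [IsScalarTower ℝ 𝕜 E] [CompleteSpace E] [NormedAddCommGroup W]
  [NormedSpace 𝕜 W]

/-- The map `(v, q, y) ↦ (v, q, y - q - ∫ X(y) v)`; the curve `y` is the integral curve of the
field `X v` that starts at `q` exactly when the last component vanishes. -/
def integralCurveMap (𝕜 : Type*) [RCLike 𝕜] {E W : Type*} [NormedAddCommGroup E] [NormedSpace 𝕜 E]
    [NormedSpace ℝ E] [IsScalarTower ℝ 𝕜 E] [CompleteSpace E] [NormedAddCommGroup W]
    [NormedSpace 𝕜 W] (X : E → W →L[𝕜] E) (p : W × E × C(unitInterval, E)) :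
    W × E × C(unitInterval, E) :=
  (p.1, p.2.1, p.2.2 - constCLM 𝕜 _ E p.2.1 - primitive 𝕜 E
    (pointwiseApply 𝕜 _ W E (superposition X p.2.2) (constCLM 𝕜 _ W p.1)))

lemma contDiffAt_integralCurveMap {X : E → W →L[𝕜] E} {O : Set E}
    (hO : IsOpen O) (hX : ContDiffOn 𝕜 ∞ X O) {p : W × E × C(unitInterval, E)}
    (hp : ∀ s, p.2.2 s ∈ O) : ContDiffAt 𝕜 ∞ (integralCurveMap 𝕜 X) p := by
  have h1 : ContDiffAt 𝕜 ∞ (superposition X : C(unitInterval, E) → _) p.2.2 :=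
    (contDiffOn_superposition hO hX).contDiffAt ((isOpen_setOf_forall_mem hO).mem_nhds hp)
  have h2 : ContDiffAt 𝕜 ∞ (fun p : W × E × C(unitInterval, E) ↦ superposition X p.2.2) p :=
    h1.comp p contDiffAt_snd.snd
  have h3 := (h2.continuousLinearMap_comp (pointwiseApply 𝕜 _ W E)).clm_apply
    ((contDiffAt_fst (p := p)).continuousLinearMap_comp (constCLM 𝕜 unitInterval W))
  have h4 := h3.continuousLinearMap_comp (primitive 𝕜 E)
  have h5 := (contDiffAt_snd (p := p) (n := ∞) (𝕜 := 𝕜)).fst.continuousLinearMap_comp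
    (constCLM 𝕜 unitInterval E)
  exact contDiffAt_fst.prodMk (contDiffAt_snd.fst.prodMk ((contDiffAt_snd.snd.sub h5).sub h4))

lemma fderiv_integralCurveMap {X : E → W →L[𝕜] E} {O : Set E}
    (hO : IsOpen O) (hX : ContDiffOn 𝕜 ∞ X O) {p : W × E × C(unitInterval, E)}
    (hp : ∀ s, p.2.2 s ∈ O) (d : W × E × C(unitInterval, E)) :
    fderiv 𝕜 (integralCurveMap 𝕜 X) p d = (d.1, d.2.1,
      d.2.2 - constCLM 𝕜 _ E d.2.1 - primitive 𝕜 E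
        (pointwiseApply 𝕜 _ W E (pointwiseApply 𝕜 _ E (W →L[𝕜] E)
            (superposition (fderiv 𝕜 X) p.2.2) d.2.2) (constCLM 𝕜 _ W p.1)
          + pointwiseApply 𝕜 _ W E (superposition X p.2.2) (constCLM 𝕜 _ W d.1))) := by
  have h1 := hasFDerivAt_superposition hO hX hp
  have hs : HasFDerivAt (fun p : W × E × C(unitInterval, E) ↦ p.2.2) _ p :=
    (hasFDerivAt_snd (𝕜 := 𝕜) (p := p)).snd
  have hf : HasFDerivAt (fun p : W × E × C(unitInterval, E) ↦ p.2.1) _ p :=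
    (hasFDerivAt_snd (𝕜 := 𝕜) (p := p)).fst
  have h2 := h1.comp p hs
  have h3 := (pointwiseApply 𝕜 unitInterval W E).hasFDerivAt_of_bilinear h2
    ((constCLM 𝕜 unitInterval W).hasFDerivAt.comp p (hasFDerivAt_fst (𝕜 := 𝕜) (p := p)))
  have h4 := (primitive 𝕜 E).hasFDerivAt.comp p h3
  have h5 := (constCLM 𝕜 unitInterval E).hasFDerivAt.comp p hf
  have h6 := (hasFDerivAt_fst (𝕜 := 𝕜) (p := p)).prodMk (hf.prodMk ((hs.sub h5).sub h4))
  refine (congrArg (fun A ↦ A d) h6.fderiv).trans ?_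
  rw [add_comm (pointwiseApply 𝕜 _ W E (pointwiseApply 𝕜 _ E (W →L[𝕜] E) _ _) _)]
  rfl

/-- **Frobenius theorem** for commuting fields: every covector that annihilates the fields `X u`
at a point is the differential there of a function that is constant along the fields. The function
moves a point `z` by the flow of `-X (L (z - q₀))` to the slice `L z = L q₀`, and then applies the
covector. -/
theorem exists_firstIntegral {X : E → W →L[𝕜] E} [CompleteSpace W] {O : Set E}
    (hO : IsOpen O) (hX : ContDiffOn 𝕜 ∞ X O) {L : E →L[𝕜] W}
    (hL : ∀ z ∈ O, ∀ u, L (X z u) = u)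
    (hcomm : ∀ z ∈ O, ∀ u v, fderiv 𝕜 X z (X z u) v = fderiv 𝕜 X z (X z v) u)
    {q₀ : E} (hq₀ : q₀ ∈ O) {ξ : E →L[𝕜] 𝕜} (hξ : ∀ u, ξ (X q₀ u) = 0) :
    ∃ (O' : Set E) (f : E → 𝕜), IsOpen O' ∧ q₀ ∈ O' ∧ O' ⊆ O ∧ ContDiffOn 𝕜 ∞ f O' ∧
      (∀ z ∈ O', ∀ u, fderiv 𝕜 f z (X z u) = 0) ∧ fderiv 𝕜 f q₀ = ξ := by
  set S : Set (W × E × C(unitInterval, E)) := {p | ∀ s, p.2.2 s ∈ O} with hS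
  have hSo : IsOpen S := (isOpen_setOf_forall_mem hO).preimage (continuous_snd.comp continuous_snd)
  let p₀ : W × E × C(unitInterval, E) := (0, q₀, constCLM 𝕜 _ E q₀)
  have hp₀ : p₀ ∈ S := fun s ↦ hq₀
  have hGS (p) (hp : p ∈ S) : ContDiffAt 𝕜 ∞ (integralCurveMap 𝕜 X) p :=
    contDiffAt_integralCurveMap hO hX hp
  -- the derivative at the base point is unipotent, hence invertible
  let A : W →L[𝕜] C(unitInterval, E) := (primitive 𝕜 E).comp
    (((pointwiseApply 𝕜 _ W E (superposition X p₀.2.2))).comp (constCLM 𝕜 _ W))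
  let D : W × E × C(unitInterval, E) →L[𝕜] C(unitInterval, E) :=
    (constCLM 𝕜 _ E).comp ((ContinuousLinearMap.fst 𝕜 E C(unitInterval, E)).comp
      (ContinuousLinearMap.snd 𝕜 W (E × C(unitInterval, E))))
    + A.comp (ContinuousLinearMap.fst 𝕜 W (E × C(unitInterval, E)))
  let J : C(unitInterval, E) →L[𝕜] W × E × C(unitInterval, E) :=
    (ContinuousLinearMap.inr 𝕜 W (E × C(unitInterval, E))).comp
      (ContinuousLinearMap.inr 𝕜 E C(unitInterval, E))
  have hDJ (d) : D (J d) = 0 := by simp [D, J]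
  let Φ : (W × E × C(unitInterval, E)) ≃L[𝕜] (W × E × C(unitInterval, E)) :=
    ContinuousLinearEquiv.equivOfInverse (ContinuousLinearMap.id 𝕜 _ - J.comp D)
      (ContinuousLinearMap.id 𝕜 _ + J.comp D)
      (fun d ↦ by simp [hDJ]) (fun d ↦ by simp [hDJ])
  have hΦ (d) : Φ d = d - J (D d) := rfl
  have hD₀ : fderiv 𝕜 (integralCurveMap 𝕜 X) p₀ = (Φ : _ →L[𝕜] _) := by
    refine ContinuousLinearMap.ext fun d ↦ ?_
    rw [fderiv_integralCurveMap hO hX hp₀, ContinuousLinearEquiv.coe_coe, hΦ]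
    have : constCLM 𝕜 unitInterval W p₀.1 = 0 := by simp [p₀]
    rw [this]
    simp [J, D, A, Prod.ext_iff]
    abel
  have hG₀ : HasFDerivAt (integralCurveMap 𝕜 X) (Φ : _ →L[𝕜] _) p₀ :=
    hD₀ ▸ ((hGS p₀ hp₀).differentiableAt (by simp)).hasFDerivAt
  let e := (hGS p₀ hp₀).toOpenPartialHomeomorph _ hG₀ (by simp)
  have he : (e : _ → _) = integralCurveMap 𝕜 X := rfl
  have hp₀e : p₀ ∈ e.source := (hGS p₀ hp₀).mem_toOpenPartialHomeomorph_source hG₀ (by simp)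
  have hGp₀ : integralCurveMap 𝕜 X p₀ = (0, q₀, 0) := by
    simp [integralCurveMap, p₀]
  -- invertibility of the derivative persists near the base point
  have hinv : ∀ᶠ p in 𝓝 p₀, p ∈ S ∧ fderiv 𝕜 (integralCurveMap 𝕜 X) p ∈
      Set.range ((↑) : ((W × E × C(unitInterval, E)) ≃L[𝕜] (W × E × C(unitInterval, E))) →
        (W × E × C(unitInterval, E)) →L[𝕜] (W × E × C(unitInterval, E))) := by
    have hc : ContinuousAt (fderiv 𝕜 (integralCurveMap 𝕜 X)) p₀ :=
      ((hGS p₀ hp₀).fderiv_right (m := 0) (by simp)).continuousAt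
    refine (hSo.eventually_mem hp₀).and (hc.tendsto.eventually ?_)
    rw [hD₀]
    exact ContinuousLinearEquiv.nhds Φ
  obtain ⟨V, hV, hVo, hp₀V⟩ := eventually_nhds_iff.1 hinv
  let g : E → W × E × C(unitInterval, E) := fun z ↦ (-L (z - q₀), z, 0)
  have hg (z : E) : HasFDerivAt g ((-L).prod ((ContinuousLinearMap.id 𝕜 E).prod 0)) z := by
    have h1 : HasFDerivAt (fun z ↦ -L (z - q₀)) (-L) z := by
      have h2 := (L.hasFDerivAt.comp z ((hasFDerivAt_id z).sub_const q₀)).neg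
      rwa [ContinuousLinearMap.comp_id] at h2
    exact h1.prodMk ((hasFDerivAt_id z).prodMk (hasFDerivAt_const _ _))
  have hgc : ContDiff 𝕜 ∞ g :=
    (L.contDiff.comp (contDiff_id.sub contDiff_const)).neg.prodMk
      (contDiff_id.prodMk contDiff_const)
  have hgq₀ : g q₀ = (0, q₀, 0) := by simp [g]
  let ev : W × E × C(unitInterval, E) →L[𝕜] 𝕜 := ξ.comp ((ContinuousMap.evalCLM 𝕜 1).comp
    ((ContinuousLinearMap.snd 𝕜 E C(unitInterval, E)).comp
      (ContinuousLinearMap.snd 𝕜 W (E × C(unitInterval, E)))))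
  have hev (d) : ev d = ξ (d.2.2 1) := rfl
  set T := (e.symm.source ∩ e.symm ⁻¹' V) with hT
  have hTo : IsOpen T := e.symm.isOpen_inter_preimage hVo
  have hTS (t) (ht : t ∈ T) : e.symm t ∈ S := (hV _ ht.2).1
  -- the local inverse is differentiable, with the inverse of the derivative
  have hsymm (t) (ht : t ∈ T) : ∃ B : (W × E × C(unitInterval, E)) ≃L[𝕜] _,
      (∀ d, B d = fderiv 𝕜 (integralCurveMap 𝕜 X) (e.symm t) d) ∧
      HasFDerivAt e.symm (B.symm : _ →L[𝕜] _) t ∧ ContDiffAt 𝕜 ∞ e.symm t := by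
    obtain ⟨B, hB⟩ := (hV _ ht.2).2
    have h1 : HasFDerivAt e (B : _ →L[𝕜] _) (e.symm t) :=
      hB ▸ ((hGS _ (hTS t ht)).differentiableAt (by simp)).hasFDerivAt
    exact ⟨B, fun d ↦ by rw [← hB]; rfl, e.hasFDerivAt_symm ht.1 h1,
      e.contDiffAt_symm ht.1 h1 (hGS _ (hTS t ht))⟩
  have hsymm₀ : e.symm (g q₀) = p₀ := by
    rw [hgq₀, ← hGp₀]
    exact e.left_inv hp₀e
  have hq₀T : g q₀ ∈ T := by
    refine ⟨?_, ?_⟩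
    · rw [hgq₀, ← hGp₀]
      exact e.map_source hp₀e
    · rw [Set.mem_preimage, hsymm₀]
      exact hp₀V
  have hderiv (z) (hz : g z ∈ T) (δ : E) (w : C(unitInterval, E))
      (hw : fderiv 𝕜 (integralCurveMap 𝕜 X) (e.symm (g z)) (-L δ, δ, w) = (-L δ, δ, 0)) :
      fderiv 𝕜 (fun z ↦ ev (e.symm (g z))) z δ = ξ (w 1) := by
    obtain ⟨B, hB, hB', -⟩ := hsymm _ hz
    have h1 := (ev.hasFDerivAt.comp z (hB'.comp z (hg z)))
    have h2 : HasFDerivAt (fun z ↦ ev (e.symm (g z))) _ z := h1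
    rw [h2.fderiv]
    have h3 : B.symm (-L δ, δ, 0) = (-L δ, δ, w) := by
      rw [ContinuousLinearEquiv.symm_apply_eq, hB, hw]
    have h4 : ((-L).prod ((ContinuousLinearMap.id 𝕜 E).prod
      (0 : E →L[𝕜] C(unitInterval, E)))) δ = (-L δ, δ, 0) := rfl
    simp [h4, h3, hev]
  refine ⟨g ⁻¹' T ∩ O, fun z ↦ ev (e.symm (g z)), (hTo.preimage hgc.continuous).inter hO,
    ⟨hq₀T, hq₀⟩, Set.inter_subset_right, ?_, ?_, ?_⟩
  · intro z hz
    obtain ⟨B, -, -, hB⟩ := hsymm _ hz.1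
    exact (ev.contDiff.contDiffAt.comp z (hB.comp z hgc.contDiffAt)).contDiffWithinAt
  · intro z hz u
    have hy := hTS _ hz.1
    have hright : integralCurveMap 𝕜 X (e.symm (g z)) = g z := e.right_inv hz.1.1
    set p := e.symm (g z) with hp
    have hp1 : p.1 = -L (z - q₀) := congrArg Prod.fst hright
    have hp2 : p.2.1 = z := congrArg (fun p ↦ p.2.1) hright
    have hp3 : p.2.2 - constCLM 𝕜 _ E p.2.1 - primitive 𝕜 E
      (pointwiseApply 𝕜 _ W E (superposition X p.2.2) (constCLM 𝕜 _ W p.1)) = 0 :=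
      congrArg (fun p ↦ p.2.2) hright
    rw [hp2, sub_sub, sub_eq_zero] at hp3
    let w : C(unitInterval, E) := ⟨fun s ↦ (1 - (s : ℝ)) • X (p.2.2 s) u, by
      have : Continuous fun s ↦ X (p.2.2 s) :=
        hX.continuousOn.comp_continuous p.2.2.continuous hy
      have h1 : Continuous fun s : unitInterval ↦ (1 - (s : ℝ)) := by fun_prop
      exact h1.smul (this.clm_apply continuous_const)⟩
    have hw := variation_eq hO hX hcomm hy hp3 u (w := w) (fun s ↦ rfl)
    rw [hderiv z hz.1 (X z u) w]
    · simp [w]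
    · rw [fderiv_integralCurveMap hO hX hy, hL z hz.2]
      simp only [map_neg, ← sub_eq_add_neg, Prod.mk.injEq, true_and]
      rw [sub_sub, sub_eq_zero]
      exact hw
  · ext δ
    let w : C(unitInterval, E) := constCLM 𝕜 _ E δ + A (-L δ)
    rw [hderiv q₀ hq₀T δ w]
    · have h1 : A (-L δ) 1 = -X q₀ (L δ) := by
        have hF (s : unitInterval) : HasDerivAt (fun t : ℝ ↦ t • X q₀ (-L δ))
            ((pointwiseApply 𝕜 _ W E (superposition X p₀.2.2)) (constCLM 𝕜 _ W (-L δ)) s) s := by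
          have := (hasDerivAt_id (s : ℝ)).smul_const (X q₀ (-L δ))
          rw [one_smul] at this
          rw [pointwiseApply_apply, superposition_apply hX.continuousOn hp₀]
          exact this
        refine (primitive_eq_sub (𝕜 := 𝕜) hF 1).trans ?_
        simp
      have h2 : w 1 = δ + A (-L δ) 1 := rfl
      rw [h2, h1, map_add, map_neg, hξ, neg_zero, add_zero]
    · rw [hsymm₀, hD₀, ContinuousLinearEquiv.coe_coe, hΦ]
      simp [J, D, w]

end Frobenius

/-! ### Vector fields, tensor fields and forms in a chart -/

section Charts

variable {𝕜 : Type*} [RCLike 𝕜] {E : Type*} [NormedAddCommGroup E] [NormedSpace 𝕜 E]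
  {N : Type*} [TopologicalSpace N] [ChartedSpace E N] [IsManifold 𝓘(𝕜, E) ∞ N]

/-- The differential at `x` of the preferred chart at `x₀`. -/
def chartDeriv (𝕜 : Type*) [RCLike 𝕜] {E : Type*} [NormedAddCommGroup E] [NormedSpace 𝕜 E]
    {N : Type*} [TopologicalSpace N] [ChartedSpace E N] (x₀ x : N) :
    TangentSpace 𝓘(𝕜, E) x →L[𝕜] E :=
  mfderiv 𝓘(𝕜, E) 𝓘(𝕜, E) (extChartAt 𝓘(𝕜, E) x₀) x

/-- The inverse of `chartDeriv`, i.e. the differential at the image of `x` of the inverse of the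
preferred chart at `x₀`. -/
def chartDerivSymm (𝕜 : Type*) [RCLike 𝕜] {E : Type*} [NormedAddCommGroup E] [NormedSpace 𝕜 E]
    {N : Type*} [TopologicalSpace N] [ChartedSpace E N] (x₀ x : N) :
    E →L[𝕜] TangentSpace 𝓘(𝕜, E) x :=
  mfderiv 𝓘(𝕜, E) 𝓘(𝕜, E) (extChartAt 𝓘(𝕜, E) x₀).symm (extChartAt 𝓘(𝕜, E) x₀ x)

lemma chartDeriv_symm {x₀ x : N} (hx : x ∈ (chartAt E x₀).source) (v : E) :
    chartDeriv 𝕜 x₀ x (chartDerivSymm 𝕜 x₀ x v) = v := by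
  have h := mfderiv_extChartAt_comp_mfderivWithin_extChartAt_symm' (I := 𝓘(𝕜, E))
    (x := x₀) (y := x) (by simpa using hx)
  rw [ModelWithCorners.range_eq_univ, mfderivWithin_univ] at h
  exact congrArg (fun A ↦ A v) h

lemma chartDerivSymm_apply {x₀ x : N} (hx : x ∈ (chartAt E x₀).source)
    (v : TangentSpace 𝓘(𝕜, E) x) :
    chartDerivSymm 𝕜 x₀ x (chartDeriv 𝕜 x₀ x v) = v := by
  have h := mfderivWithin_extChartAt_symm_comp_mfderiv_extChartAt' (I := 𝓘(𝕜, E))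
    (x := x₀) (y := x) (by simpa using hx)
  rw [ModelWithCorners.range_eq_univ, mfderivWithin_univ] at h
  exact congrArg (fun A ↦ A v) h

lemma contMDiffAt_vectorField_iff {x₀ x : N} (hx : x ∈ (chartAt E x₀).source)
    {X : ∀ p : N, TangentSpace 𝓘(𝕜, E) p} :
    ContMDiffAt 𝓘(𝕜, E) (𝓘(𝕜, E).prod 𝓘(𝕜, E)) ∞
      (fun p ↦ Bundle.TotalSpace.mk' E (E := (TangentSpace 𝓘(𝕜, E) : N → Type _)) p (X p)) x ↔
    ContMDiffAt 𝓘(𝕜, E) 𝓘(𝕜, E) ∞ (fun p ↦ chartDeriv 𝕜 x₀ p (X p)) x := by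
  rw [Bundle.Trivialization.contMDiffAt_section_iff (trivializationAt E (TangentSpace 𝓘(𝕜, E)) x₀)]
  · refine Filter.EventuallyEq.contMDiffAt_iff ?_
    filter_upwards [(chartAt E x₀).open_source.mem_nhds hx] with p hp
    have := TangentBundle.continuousLinearMapAt_trivializationAt (I := 𝓘(𝕜, E)) hp
    rw [chartDeriv, ← this, Bundle.Trivialization.continuousLinearMapAt_apply,
      Bundle.Trivialization.coe_linearMapAt_of_mem _ (by simpa using hp)]
  · simpa using hx

lemma contMDiffAt_tensor11_iff {x₀ x : N} (hx : x ∈ (chartAt E x₀).source)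
    {H : ∀ p : N, TangentSpace 𝓘(𝕜, E) p →L[𝕜] TangentSpace 𝓘(𝕜, E) p} :
    ContMDiffAt 𝓘(𝕜, E) (𝓘(𝕜, E).prod 𝓘(𝕜, E →L[𝕜] E)) ∞
      (fun p ↦ Bundle.TotalSpace.mk' (E →L[𝕜] E)
        (E := fun p : N ↦ TangentSpace 𝓘(𝕜, E) p →L[𝕜] TangentSpace 𝓘(𝕜, E) p) p (H p)) x ↔
    ContMDiffAt 𝓘(𝕜, E) 𝓘(𝕜, E →L[𝕜] E) ∞
      (fun p ↦ (chartDeriv 𝕜 x₀ p).comp ((H p).comp (chartDerivSymm 𝕜 x₀ p))) x := by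
  rw [Bundle.Trivialization.contMDiffAt_section_iff (trivializationAt (E →L[𝕜] E)
    (fun p : N ↦ TangentSpace 𝓘(𝕜, E) p →L[𝕜] TangentSpace 𝓘(𝕜, E) p) x₀)]
  · refine Filter.EventuallyEq.contMDiffAt_iff ?_
    filter_upwards [(chartAt E x₀).open_source.mem_nhds hx] with p hp
    rw [hom_trivializationAt_apply]
    simp only [ContinuousLinearMap.inCoordinates]
    rw [TangentBundle.continuousLinearMapAt_trivializationAt hp,
      TangentBundle.symmL_trivializationAt hp, ModelWithCorners.range_eq_univ, mfderivWithin_univ]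
    rfl
  · simpa [hom_trivializationAt_baseSet] using hx

lemma cotangent_inCoordinates {x₀ p : N} (hp : p ∈ (chartAt E x₀).source)
    (a : TangentSpace 𝓘(𝕜, E) p →L[𝕜] 𝕜) :
    ContinuousLinearMap.inCoordinates E (TangentSpace 𝓘(𝕜, E) : N → Type _) 𝕜
      (Bundle.Trivial N 𝕜) x₀ p x₀ p a = a.comp (chartDerivSymm 𝕜 x₀ p) := by
  simp only [ContinuousLinearMap.inCoordinates]
  rw [TangentBundle.symmL_trivializationAt hp, ModelWithCorners.range_eq_univ, mfderivWithin_univ]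
  ext v
  rw [ContinuousLinearMap.comp_apply, Bundle.Trivialization.continuousLinearMapAt_apply,
      Bundle.Trivialization.coe_linearMapAt_of_mem _ (by simp)]
  rfl

lemma contMDiffAt_oneForm_iff {x₀ x : N} (hx : x ∈ (chartAt E x₀).source)
    {α : ∀ p : N, TangentSpace 𝓘(𝕜, E) p →L[𝕜] 𝕜} :
    ContMDiffAt 𝓘(𝕜, E) (𝓘(𝕜, E).prod 𝓘(𝕜, E →L[𝕜] 𝕜)) ∞
      (fun p ↦ Bundle.TotalSpace.mk' (E →L[𝕜] 𝕜)
        (E := fun p : N ↦ TangentSpace 𝓘(𝕜, E) p →L[𝕜] Bundle.Trivial N 𝕜 p) p (α p)) x ↔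
    ContMDiffAt 𝓘(𝕜, E) 𝓘(𝕜, E →L[𝕜] 𝕜) ∞ (fun p ↦ (α p).comp (chartDerivSymm 𝕜 x₀ p)) x := by
  rw [Bundle.Trivialization.contMDiffAt_section_iff (trivializationAt (E →L[𝕜] 𝕜)
    (fun p : N ↦ TangentSpace 𝓘(𝕜, E) p →L[𝕜] Bundle.Trivial N 𝕜 p) x₀)]
  · refine Filter.EventuallyEq.contMDiffAt_iff ?_
    filter_upwards [(chartAt E x₀).open_source.mem_nhds hx] with p hp
    rw [hom_trivializationAt_apply]
    exact cotangent_inCoordinates hp _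
  · simpa [hom_trivializationAt_baseSet] using hx

/-- The expression in the preferred chart at `x₀` of a vector field. -/
def chartField (x₀ : N) (X : ∀ p : N, TangentSpace 𝓘(𝕜, E) p) (q : E) : E :=
  chartDeriv 𝕜 x₀ ((extChartAt 𝓘(𝕜, E) x₀).symm q) (X ((extChartAt 𝓘(𝕜, E) x₀).symm q))

/-- The expression in the preferred chart at `x₀` of a `(1,1)`-tensor field. -/
def chartTensor (x₀ : N) (H : ∀ p : N, TangentSpace 𝓘(𝕜, E) p →L[𝕜] TangentSpace 𝓘(𝕜, E) p)
    (q : E) : E →L[𝕜] E :=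
  (chartDeriv 𝕜 x₀ ((extChartAt 𝓘(𝕜, E) x₀).symm q)).comp
    ((H ((extChartAt 𝓘(𝕜, E) x₀).symm q)).comp
      (chartDerivSymm 𝕜 x₀ ((extChartAt 𝓘(𝕜, E) x₀).symm q)))

omit [IsManifold 𝓘(𝕜, E) ∞ N] in
lemma symm_mem_source {x₀ : N} {q : E} (hq : q ∈ (extChartAt 𝓘(𝕜, E) x₀).target) :
    (extChartAt 𝓘(𝕜, E) x₀).symm q ∈ (chartAt E x₀).source := by
  simpa using (extChartAt 𝓘(𝕜, E) x₀).map_target hq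

omit [IsManifold 𝓘(𝕜, E) ∞ N] in
lemma chartField_extChartAt {x₀ x : N} (hx : x ∈ (chartAt E x₀).source)
    (X : ∀ p : N, TangentSpace 𝓘(𝕜, E) p) :
    chartField x₀ X (extChartAt 𝓘(𝕜, E) x₀ x) = chartDeriv 𝕜 x₀ x (X x) := by
  rw [chartField, (extChartAt 𝓘(𝕜, E) x₀).left_inv (by simpa using hx)]

/-- A map on `N` is smooth at a point of a chart if its expression in that chart is. -/
lemma contMDiffAt_iff_contDiffAt_symm {F : Type*} [NormedAddCommGroup F] [NormedSpace 𝕜 F]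
    {f : N → F} {x₀ x : N} (hx : x ∈ (chartAt E x₀).source) :
    ContMDiffAt 𝓘(𝕜, E) 𝓘(𝕜, F) ∞ f x ↔
      ContDiffAt 𝕜 ∞ (f ∘ (extChartAt 𝓘(𝕜, E) x₀).symm) (extChartAt 𝓘(𝕜, E) x₀ x) := by
  rw [contMDiffAt_iff_source_of_mem_source (x := x₀) hx, ModelWithCorners.range_eq_univ,
    contMDiffWithinAt_univ, contMDiffAt_iff_contDiffAt]

lemma contDiffAt_chartField {x₀ x : N} (hx : x ∈ (chartAt E x₀).source)
    {X : ∀ p : N, TangentSpace 𝓘(𝕜, E) p} {U : Set N} (hU : IsOpen U) (hxU : x ∈ U)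
    (hX : SmoothVectorFieldOn 𝓘(𝕜, E) X U) :
    ContDiffAt 𝕜 ∞ (chartField x₀ X) (extChartAt 𝓘(𝕜, E) x₀ x) :=
  (contMDiffAt_iff_contDiffAt_symm hx).1
    ((contMDiffAt_vectorField_iff hx).1 (hX.contMDiffAt (hU.mem_nhds hxU)))

lemma contDiffAt_chartTensor {x₀ x : N} (hx : x ∈ (chartAt E x₀).source)
    {H : ∀ p : N, TangentSpace 𝓘(𝕜, E) p →L[𝕜] TangentSpace 𝓘(𝕜, E) p}
    (hH : SmoothTensor11 𝓘(𝕜, E) H) :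
    ContDiffAt 𝕜 ∞ (chartTensor x₀ H) (extChartAt 𝓘(𝕜, E) x₀ x) :=
  (contMDiffAt_iff_contDiffAt_symm hx).1 ((contMDiffAt_tensor11_iff hx).1 hH.contMDiffAt)

lemma contDiffOn_chartTensor (x₀ : N)
    {H : ∀ p : N, TangentSpace 𝓘(𝕜, E) p →L[𝕜] TangentSpace 𝓘(𝕜, E) p}
    (hH : SmoothTensor11 𝓘(𝕜, E) H) :
    ContDiffOn 𝕜 ∞ (chartTensor x₀ H) (extChartAt 𝓘(𝕜, E) x₀).target := by
  intro q hq
  have := contDiffAt_chartTensor (symm_mem_source hq) hH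
  rw [(extChartAt 𝓘(𝕜, E) x₀).right_inv hq] at this
  exact this.contDiffWithinAt

lemma chartTensor_chartField {x₀ : N} {q : E} (hq : q ∈ (extChartAt 𝓘(𝕜, E) x₀).target)
    (H : ∀ p : N, TangentSpace 𝓘(𝕜, E) p →L[𝕜] TangentSpace 𝓘(𝕜, E) p)
    (X : ∀ p : N, TangentSpace 𝓘(𝕜, E) p) :
    chartField x₀ (fun p ↦ H p (X p)) q = chartTensor x₀ H q (chartField x₀ X q) := by
  simp only [chartField, chartTensor, ContinuousLinearMap.comp_apply]
  rw [chartDerivSymm_apply (symm_mem_source hq)]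

lemma two_le_infty : (2 : WithTop ℕ∞) ≤ ∞ :=
  WithTop.coe_le_coe.2 (le_top : (2 : ℕ∞) ≤ ⊤)

lemma mlieBracket_eq_lieBracket (V W : ∀ q : E, TangentSpace 𝓘(𝕜, E) q) :
    VectorField.mlieBracket 𝓘(𝕜, E) V W = VectorField.lieBracket 𝕜 V W := by
  rw [← VectorField.mlieBracketWithin_univ, VectorField.mlieBracketWithin_eq_lieBracketWithin]
  exact VectorField.lieBracketWithin_univ

/-- The Lie bracket may be computed in any chart. -/
lemma chartDeriv_mlieBracket [CompleteSpace E] {x₀ x : N} (hx : x ∈ (chartAt E x₀).source)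
    {X Y : ∀ p : N, TangentSpace 𝓘(𝕜, E) p} {U : Set N} (hU : IsOpen U) (hxU : x ∈ U)
    (hX : SmoothVectorFieldOn 𝓘(𝕜, E) X U) (hY : SmoothVectorFieldOn 𝓘(𝕜, E) Y U) :
    chartDeriv 𝕜 x₀ x (VectorField.mlieBracket 𝓘(𝕜, E) X Y x) =
      VectorField.lieBracket 𝕜 (chartField x₀ X) (chartField x₀ Y) (extChartAt 𝓘(𝕜, E) x₀ x) := by
  set q := extChartAt 𝓘(𝕜, E) x₀ x with hq
  have hxs : x ∈ (extChartAt 𝓘(𝕜, E) x₀).source := by simpa using hx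
  have hqx : (extChartAt 𝓘(𝕜, E) x₀).symm q = x := (extChartAt 𝓘(𝕜, E) x₀).left_inv hxs
  have hqt : q ∈ (extChartAt 𝓘(𝕜, E) x₀).target := (extChartAt 𝓘(𝕜, E) x₀).map_source hxs
  have hpull (q' : E) (hq' : q' ∈ (extChartAt 𝓘(𝕜, E) x₀).target)
      (Z : ∀ p : N, TangentSpace 𝓘(𝕜, E) p) :
      VectorField.mpullback 𝓘(𝕜, E) 𝓘(𝕜, E) (extChartAt 𝓘(𝕜, E) x₀).symm Z q' =
        chartField x₀ Z q' := by
    rw [VectorField.mpullback_apply]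
    have h1 := mfderiv_extChartAt_comp_mfderivWithin_extChartAt_symm (I := 𝓘(𝕜, E)) hq'
    have h2 := mfderivWithin_extChartAt_symm_comp_mfderiv_extChartAt (I := 𝓘(𝕜, E)) hq'
    rw [ModelWithCorners.range_eq_univ, mfderivWithin_univ] at h1 h2
    rw [ContinuousLinearMap.inverse_eq h2 h1]
    rfl
  have hev (Z : ∀ p : N, TangentSpace 𝓘(𝕜, E) p) :
      VectorField.mpullback 𝓘(𝕜, E) 𝓘(𝕜, E) (extChartAt 𝓘(𝕜, E) x₀).symm Z =ᶠ[𝓝 q]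
        chartField x₀ Z := by
    filter_upwards [(isOpen_extChartAt_target x₀).mem_nhds hqt] with q' hq'
    exact hpull q' hq' Z
  have hs : ContMDiffAt 𝓘(𝕜, E) 𝓘(𝕜, E) ∞ (extChartAt 𝓘(𝕜, E) x₀).symm q :=
    (contMDiffOn_extChartAt_symm x₀).contMDiffAt ((isOpen_extChartAt_target x₀).mem_nhds hqt)
  have hmd (Z : ∀ p : N, TangentSpace 𝓘(𝕜, E) p) (hZ : SmoothVectorFieldOn 𝓘(𝕜, E) Z U) :
      MDifferentiableAt 𝓘(𝕜, E) (𝓘(𝕜, E).prod 𝓘(𝕜, E)) (fun p ↦ Bundle.TotalSpace.mk' E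
        (E := (TangentSpace 𝓘(𝕜, E) : N → Type _)) p (Z p)) ((extChartAt 𝓘(𝕜, E) x₀).symm q) := by
    rw [hqx]
    exact (ContMDiffOn.contMDiffAt hZ (hU.mem_nhds hxU)).mdifferentiableAt (by simp)
  have h2 : minSmoothness 𝕜 2 = 2 := minSmoothness_of_isRCLikeNormedField
  have h2' : minSmoothness 𝕜 2 ≤ ∞ := by rw [h2]; exact two_le_infty
  have : IsManifold 𝓘(𝕜, E) (minSmoothness 𝕜 2) N := IsManifold.of_le h2'
  have h3 := VectorField.mpullback_mlieBracket (hmd X hX) (hmd Y hY) hs h2'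
  rw [hpull q hqt, (hev X).mlieBracket_vectorField_eq (hev Y)] at h3
  refine Eq.trans ?_ (h3.trans (congrFun (mlieBracket_eq_lieBracket _ _) q))
  rw [chartField, hqx]

end Charts

/-! ### Local frames of a foliation -/

section LocalFrame

variable {𝕜 : Type*} [RCLike 𝕜] {E : Type*} [NormedAddCommGroup E] [NormedSpace 𝕜 E]
  {N : Type*} [TopologicalSpace N] [ChartedSpace E N]

/-- `X`, a family of linear maps `𝕜ᵐ → E` depending smoothly on a point of the open set `T`, is a
frame of the distribution `G` in the preferred chart at `x₀`, normalized by `L ∘ K ∘ X = id`. -/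
structure IsFrameInChart (x₀ : N) (G : ∀ x : N, Submodule 𝕜 (TangentSpace 𝓘(𝕜, E) x)) {m : ℕ}
    (T : Set E) (K : E → E →L[𝕜] E) (L : E →L[𝕜] (Fin m → 𝕜)) (X : E → (Fin m → 𝕜) →L[𝕜] E) :
    Prop where
  isOpen : IsOpen T
  mem : extChartAt 𝓘(𝕜, E) x₀ x₀ ∈ T
  subset : T ⊆ (extChartAt 𝓘(𝕜, E) x₀).target
  contDiffOn : ContDiffOn 𝕜 ∞ X T
  mem_iff : ∀ q ∈ T, ∀ v, v ∈ G ((extChartAt 𝓘(𝕜, E) x₀).symm q) ↔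
    ∃ u, v = chartDerivSymm 𝕜 x₀ ((extChartAt 𝓘(𝕜, E) x₀).symm q) (X q u)
  left_inv : ∀ q ∈ T, ∀ u, L (K q (X q u)) = u

lemma contDiffAt_inverse_comp {W V : Type*} [NormedAddCommGroup W] [NormedSpace 𝕜 W]
    [CompleteSpace W] [NormedAddCommGroup V] [NormedSpace 𝕜 V] {A : V → W →L[𝕜] W} {q : V}
    {n : WithTop ℕ∞} (hA : ContDiffAt 𝕜 n A q)
    (hq : A q ∈ Set.range ((↑) : (W ≃L[𝕜] W) → W →L[𝕜] W)) :
    ContDiffAt 𝕜 n (fun q ↦ (A q).inverse) q := by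
  obtain ⟨e, he⟩ := hq
  have := contDiffAt_map_inverse (𝕜 := 𝕜) (n := n) e
  rw [he] at this
  exact this.comp q hA

variable [IsManifold 𝓘(𝕜, E) ∞ N]

/-- A foliation has local frames, normalized with respect to any smooth family `K` of linear maps
that is injective at the centre of the chart: `L` is a left inverse there of `K` composed with a
family of sections, and the frame is obtained by dividing by the invertible `L ∘ K ∘ X₀`. -/
theorem exists_isFrameInChart [FiniteDimensional 𝕜 E] {r m : ℕ}
    {G : ∀ x : N, Submodule 𝕜 (TangentSpace 𝓘(𝕜, E) x)} (hG : IsFoliation 𝓘(𝕜, E) r G)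
    (hm : m + r = Module.finrank 𝕜 E) (x₀ : N) {K : E → E →L[𝕜] E}
    (hK : ContDiffOn 𝕜 ∞ K (extChartAt 𝓘(𝕜, E) x₀).target)
    (hKinj : Function.Injective (K (extChartAt 𝓘(𝕜, E) x₀ x₀))) :
    ∃ (T : Set E) (L : E →L[𝕜] (Fin m → 𝕜)) (X : E → (Fin m → 𝕜) →L[𝕜] E),
      IsFrameInChart x₀ G T K L X := by
  obtain ⟨U, hU, hx₀U, k, Z, hZ, hspan⟩ := hG.smooth x₀
  have hcomplete := FiniteDimensional.complete 𝕜 E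
  have hfin (p : N) : FiniteDimensional 𝕜 (TangentSpace 𝓘(𝕜, E) p) :=
    inferInstanceAs (FiniteDimensional 𝕜 E)
  have hfinrank (p : N) : Module.finrank 𝕜 (G p) = m := by
    have h1 := (G p).finrank_quotient_add_finrank
    have h2 : Module.finrank 𝕜 (TangentSpace 𝓘(𝕜, E) p) = Module.finrank 𝕜 E := rfl
    have h3 := hG.codim p
    omega
  set φ := extChartAt 𝓘(𝕜, E) x₀ with hφ
  set q₀ := φ x₀ with hq₀
  have hφx₀ : φ.symm q₀ = x₀ := extChartAt_to_inv x₀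
  set T₀ := φ.target ∩ φ.symm ⁻¹' U with hT₀
  have hT₀o : IsOpen T₀ :=
    (continuousOn_extChartAt_symm x₀).isOpen_inter_preimage (isOpen_extChartAt_target x₀) hU
  have hq₀T₀ : q₀ ∈ T₀ := ⟨mem_extChartAt_target x₀, by
    rw [Set.mem_preimage, hφx₀]
    exact hx₀U⟩
  have hZs (i) : ContDiffOn 𝕜 ∞ (chartField x₀ (Z i)) T₀ := fun q hq ↦ by
    have := contDiffAt_chartField (symm_mem_source hq.1) hU hq.2 (hZ i)
    rw [φ.right_inv hq.1] at this
    exact this.contDiffWithinAt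
  -- a subfamily that is a basis at the centre of the chart
  obtain ⟨κ, a, ha, hspan', hli⟩ := exists_linearIndependent' 𝕜 (fun i ↦ Z i x₀)
  have : Finite κ := Finite.of_injective a ha
  have : Fintype κ := Fintype.ofFinite κ
  have hκ : Fintype.card κ = m := by
    rw [← finrank_span_eq_card hli, hspan', ← hspan x₀ hx₀U, hfinrank]
  let b : Fin m → Fin k := fun i ↦ a ((Fintype.equivFinOfCardEq hκ).symm i)
  have hbli : LinearIndependent 𝕜 (fun i ↦ Z (b i) x₀) :=
    hli.comp _ (Fintype.equivFinOfCardEq hκ).symm.injective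
  let X₀ : E → (Fin m → 𝕜) →L[𝕜] E := fun q ↦
    ∑ i, (ContinuousLinearMap.proj i).smulRight (chartField x₀ (Z (b i)) q)
  have hX₀ (q u) : X₀ q u = ∑ i, u i • chartField x₀ (Z (b i)) q := by
    simp [X₀]
  have hX₀s : ContDiffOn 𝕜 ∞ X₀ T₀ := by
    refine ContDiffOn.sum fun i _ ↦ ?_
    exact contDiffOn_const.smulRight (hZs (b i))
  have hX₀inj : Function.Injective (X₀ q₀) := by
    rw [injective_iff_map_eq_zero]
    intro u hu
    rw [hX₀] at hu
    have h1 : ∑ i, u i • Z (b i) x₀ = 0 := by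
      have h2 := congrArg (chartDerivSymm 𝕜 x₀ x₀) hu
      simpa only [map_sum, map_smul, map_zero, hq₀, hφ, chartField_extChartAt
        (mem_chart_source E x₀), chartDerivSymm_apply (mem_chart_source E x₀)] using h2
    exact funext (Fintype.linearIndependent_iff.1 hbli u h1)
  have hKX₀ : Function.Injective ((K q₀).comp (X₀ q₀)) := hKinj.comp hX₀inj
  obtain ⟨L', hL'⟩ := LinearMap.exists_leftInverse_of_injective
    ((K q₀).comp (X₀ q₀)).toLinearMap (LinearMap.ker_eq_bot.2 hKX₀)
  let L : E →L[𝕜] (Fin m → 𝕜) := LinearMap.toContinuousLinearMap L'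
  let A : E → (Fin m → 𝕜) →L[𝕜] (Fin m → 𝕜) := fun q ↦ L.comp ((K q).comp (X₀ q))
  have hAs : ContDiffOn 𝕜 ∞ A T₀ :=
    contDiffOn_const.clm_comp ((hK.mono Set.inter_subset_left).clm_comp hX₀s)
  have hAq₀ : A q₀ = ContinuousLinearMap.id 𝕜 _ := by
    ext1 u
    exact congrArg (fun B ↦ B u) hL'
  set R := Set.range ((↑) : ((Fin m → 𝕜) ≃L[𝕜] (Fin m → 𝕜)) → (Fin m → 𝕜) →L[𝕜] (Fin m → 𝕜))
  have hT : IsOpen (T₀ ∩ A ⁻¹' R) :=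
    hAs.continuousOn.isOpen_inter_preimage hT₀o ContinuousLinearEquiv.isOpen
  have hleft (q) (hq : q ∈ T₀ ∩ A ⁻¹' R) (u) : L (K q (X₀ q ((A q).inverse u))) = u := by
    obtain ⟨e, he⟩ := hq.2
    have : (A q).comp (A q).inverse = ContinuousLinearMap.id 𝕜 _ := by
      rw [← he]
      simp
    exact congrArg (fun B ↦ B u) this
  refine ⟨T₀ ∩ A ⁻¹' R, L, fun q ↦ (X₀ q).comp (A q).inverse, hT,
    ⟨hq₀T₀, ContinuousLinearEquiv.refl 𝕜 _, hAq₀.symm⟩, fun q hq ↦ hq.1.1, ?_, ?_, hleft⟩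
  · refine (hX₀s.mono Set.inter_subset_left).clm_comp fun q hq ↦ ?_
    exact (contDiffAt_inverse_comp (hAs.contDiffAt (hT₀o.mem_nhds hq.1)) hq.2).contDiffWithinAt
  · intro q hq
    set p := φ.symm q with hp
    have hps : p ∈ (chartAt E x₀).source := symm_mem_source hq.1.1
    -- the fields of the frame lie in `G`, and they are linearly independent
    let B : (Fin m → 𝕜) →ₗ[𝕜] TangentSpace 𝓘(𝕜, E) p :=
      ((chartDerivSymm 𝕜 x₀ p).comp ((X₀ q).comp (A q).inverse)).toLinearMap
    have hBinj : Function.Injective B := by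
      intro u v huv
      have h1 := congrArg (chartDeriv 𝕜 x₀ p) huv
      have h2 : X₀ q ((A q).inverse u) = X₀ q ((A q).inverse v) := by
        simpa only [B, ContinuousLinearMap.coe_coe, ContinuousLinearMap.comp_apply,
          chartDeriv_symm hps] using h1
      rw [← hleft q hq u, h2, hleft q hq v]
    have hBle : LinearMap.range B ≤ G p := by
      rintro _ ⟨u, rfl⟩
      have h1 : B u = ∑ i, (A q).inverse u i • Z (b i) p := by
        simp only [B, ContinuousLinearMap.coe_coe, ContinuousLinearMap.comp_apply, hX₀, map_sum,
          map_smul, chartField]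
        refine Finset.sum_congr rfl fun i _ ↦ ?_
        rw [← hφ, ← hp, chartDerivSymm_apply hps]
      rw [h1, hspan p hq.1.2]
      exact Submodule.sum_mem _ fun i _ ↦
        Submodule.smul_mem _ _ (Submodule.subset_span ⟨b i, rfl⟩)
    have hrange : LinearMap.range B = G p := by
      refine Submodule.eq_of_le_of_finrank_eq hBle ?_
      rw [LinearMap.finrank_range_of_inj hBinj, hfinrank]
      simp
    intro v
    rw [← hrange]
    exact ⟨fun ⟨u, hu⟩ ↦ ⟨u, hu.symm⟩, fun ⟨u, hu⟩ ↦ ⟨u, hu.symm⟩⟩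

end LocalFrame

/-! ### The vector fields of a local frame, and differentials of functions -/

section FrameField

variable {𝕜 : Type*} [RCLike 𝕜] {E : Type*} [NormedAddCommGroup E] [NormedSpace 𝕜 E]
  {N : Type*} [TopologicalSpace N] [ChartedSpace E N]

lemma lieBracket_apply (V W : E → E) (q : E) :
    VectorField.lieBracket 𝕜 V W q = fderiv 𝕜 W q (V q) - fderiv 𝕜 V q (W q) := rfl

/-- The vector fields on `N` that a frame in the preferred chart at `x₀` consists of. -/
def frameField (x₀ : N) {W : Type*} [NormedAddCommGroup W] [NormedSpace 𝕜 W]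
    (X : E → W →L[𝕜] E) (u : W) (p : N) : TangentSpace 𝓘(𝕜, E) p :=
  chartDerivSymm 𝕜 x₀ p (X (extChartAt 𝓘(𝕜, E) x₀ p) u)

/-- The open subset of `N` that corresponds to the subset `T` of the preferred chart at `x₀`. -/
def chartDomain (𝕜 : Type*) [RCLike 𝕜] {E : Type*} [NormedAddCommGroup E] [NormedSpace 𝕜 E]
    {N : Type*} [TopologicalSpace N] [ChartedSpace E N] (x₀ : N) (T : Set E) : Set N :=
  (extChartAt 𝓘(𝕜, E) x₀).source ∩ extChartAt 𝓘(𝕜, E) x₀ ⁻¹' T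

lemma isOpen_chartDomain (x₀ : N) {T : Set E} (hT : IsOpen T) :
    IsOpen (chartDomain 𝕜 x₀ T) :=
  isOpen_extChartAt_preimage' x₀ hT

lemma chartDomain_subset {x₀ x : N} {T : Set E} (hx : x ∈ chartDomain 𝕜 x₀ T) :
    x ∈ (chartAt E x₀).source := by
  simpa using hx.1

lemma symm_mem_chartDomain {x₀ : N} {T : Set E} (hT : T ⊆ (extChartAt 𝓘(𝕜, E) x₀).target) {q : E}
    (hq : q ∈ T) : (extChartAt 𝓘(𝕜, E) x₀).symm q ∈ chartDomain 𝕜 x₀ T :=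
  ⟨(extChartAt 𝓘(𝕜, E) x₀).map_target (hT hq), by
    rwa [Set.mem_preimage, (extChartAt 𝓘(𝕜, E) x₀).right_inv (hT hq)]⟩

variable [IsManifold 𝓘(𝕜, E) ∞ N]

lemma chartDeriv_frameField {x₀ x : N} (hx : x ∈ (chartAt E x₀).source) {W : Type*}
    [NormedAddCommGroup W] [NormedSpace 𝕜 W] (X : E → W →L[𝕜] E) (u : W) :
    chartDeriv 𝕜 x₀ x (frameField x₀ X u x) = X (extChartAt 𝓘(𝕜, E) x₀ x) u :=
  chartDeriv_symm hx _

lemma chartField_frameField {x₀ : N} {q : E} (hq : q ∈ (extChartAt 𝓘(𝕜, E) x₀).target) {W : Type*}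
    [NormedAddCommGroup W] [NormedSpace 𝕜 W] (X : E → W →L[𝕜] E) (u : W) :
    chartField x₀ (frameField x₀ X u) q = X q u := by
  have := chartDeriv_frameField (symm_mem_source hq) X u
  rwa [(extChartAt 𝓘(𝕜, E) x₀).right_inv hq] at this

lemma smooth_frameField {x₀ : N} {T : Set E} (hT : IsOpen T) {W : Type*}
    [NormedAddCommGroup W] [NormedSpace 𝕜 W] {X : E → W →L[𝕜] E} (hX : ContDiffOn 𝕜 ∞ X T) (u : W) :
    SmoothVectorFieldOn 𝓘(𝕜, E) (frameField x₀ X u) (chartDomain 𝕜 x₀ T) := by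
  intro x hx
  refine ContMDiffAt.contMDiffWithinAt ?_
  rw [contMDiffAt_vectorField_iff (chartDomain_subset hx)]
  have h1 : ContMDiffAt 𝓘(𝕜, E) 𝓘(𝕜, E) ∞ (fun p ↦ X (extChartAt 𝓘(𝕜, E) x₀ p) u) x := by
    have h2 : ContDiffAt 𝕜 ∞ (fun q ↦ X q u) (extChartAt 𝓘(𝕜, E) x₀ x) :=
      (hX.contDiffAt (hT.mem_nhds hx.2)).clm_apply contDiffAt_const
    exact h2.contMDiffAt.comp x (contMDiffAt_extChartAt' (chartDomain_subset hx))
  refine h1.congr_of_eventuallyEq ?_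
  filter_upwards [(chartAt E x₀).open_source.mem_nhds (chartDomain_subset hx)] with p hp
  exact chartDeriv_frameField hp X u

variable {x₀ : N} {G : ∀ x : N, Submodule 𝕜 (TangentSpace 𝓘(𝕜, E) x)} {m : ℕ}
    {T : Set E} {K : E → E →L[𝕜] E} {L : E →L[𝕜] (Fin m → 𝕜)} {X : E → (Fin m → 𝕜) →L[𝕜] E}

namespace IsFrameInChart

lemma mem_chartDomain (h : IsFrameInChart x₀ G T K L X) : x₀ ∈ chartDomain 𝕜 x₀ T :=
  ⟨mem_extChartAt_source x₀, h.mem⟩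

lemma mem_iff_of_mem_chartDomain (h : IsFrameInChart x₀ G T K L X) {x : N}
    (hx : x ∈ chartDomain 𝕜 x₀ T) (v : TangentSpace 𝓘(𝕜, E) x) :
    v ∈ G x ↔ ∃ u, v = frameField x₀ X u x := by
  have h1 := h.mem_iff _ hx.2
  have hxx := (extChartAt 𝓘(𝕜, E) x₀).left_inv hx.1
  rw [hxx] at h1
  exact h1 v

lemma frameField_mem (h : IsFrameInChart x₀ G T K L X) (u) :
    ∀ x ∈ chartDomain 𝕜 x₀ T, frameField x₀ X u x ∈ G x := fun _ hx ↦
  (h.mem_iff_of_mem_chartDomain hx _).2 ⟨u, rfl⟩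

lemma mem_iff_chartDeriv (h : IsFrameInChart x₀ G T K L X) {x : N}
    (hx : x ∈ chartDomain 𝕜 x₀ T) (v : TangentSpace 𝓘(𝕜, E) x) :
    v ∈ G x ↔ ∃ u, chartDeriv 𝕜 x₀ x v = X (extChartAt 𝓘(𝕜, E) x₀ x) u := by
  rw [h.mem_iff_of_mem_chartDomain hx]
  refine exists_congr fun u ↦ ⟨fun huv ↦ ?_, fun huv ↦ ?_⟩
  · rw [huv, chartDeriv_frameField (chartDomain_subset hx)]
  · rw [frameField, ← huv, chartDerivSymm_apply (chartDomain_subset hx)]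

/-- Brackets of fields of the frame, in the chart, when they are tangent to `G`. -/
lemma exists_lieBracket_eq [CompleteSpace E] (h : IsFrameInChart x₀ G T K L X) {r : ℕ}
    (hG : IsFoliation 𝓘(𝕜, E) r G) {q : E} (hq : q ∈ T) (u v : Fin m → 𝕜) :
    ∃ w, VectorField.lieBracket 𝕜 (fun q ↦ X q u) (fun q ↦ X q v) q = X q w := by
  have hx := symm_mem_chartDomain h.subset hq
  have hsm (u) := smooth_frameField (x₀ := x₀) h.isOpen h.contDiffOn u
  have h1 := hG.involutive _ (isOpen_chartDomain x₀ h.isOpen) _ _ (hsm u) (hsm v)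
    (h.frameField_mem u) (h.frameField_mem v) _ hx
  rw [h.mem_iff_chartDeriv hx, chartDeriv_mlieBracket (chartDomain_subset hx)
    (isOpen_chartDomain x₀ h.isOpen) hx (hsm u) (hsm v),
    (extChartAt 𝓘(𝕜, E) x₀).right_inv (h.subset hq)] at h1
  obtain ⟨w, hw⟩ := h1
  refine ⟨w, hw ▸ Filter.EventuallyEq.lieBracket_vectorField_eq ?_ ?_⟩
  all_goals
    filter_upwards [h.isOpen.mem_nhds hq] with q' hq'
    exact (chartField_frameField (h.subset hq') X _).symm

lemma fderiv_apply_const [CompleteSpace E] (h : IsFrameInChart x₀ G T K L X) {q : E} (hq : q ∈ T)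
    (u : Fin m → 𝕜) (v : E) : fderiv 𝕜 (fun q ↦ X q u) q v = fderiv 𝕜 X q v u := by
  have h1 := (h.contDiffOn.contDiffAt (h.isOpen.mem_nhds hq)).differentiableAt (by simp)
  have h2 := (h1.hasFDerivAt.clm_apply (hasFDerivAt_const u q)).fderiv
  rw [h2]
  simp

/-- If the frame is normalized by `L ∘ X = id`, its fields commute: their brackets are tangent to
`G` and are annihilated by `L`, which is injective on `G`. -/
lemma commute [CompleteSpace E]
    (h : IsFrameInChart x₀ G T (fun _ ↦ ContinuousLinearMap.id 𝕜 E) L X) {r : ℕ}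
    (hG : IsFoliation 𝓘(𝕜, E) r G) {q : E} (hq : q ∈ T) (u v : Fin m → 𝕜) :
    fderiv 𝕜 X q (X q u) v = fderiv 𝕜 X q (X q v) u := by
  obtain ⟨w, hw⟩ := h.exists_lieBracket_eq hG hq u v
  have hL (u : Fin m → 𝕜) (z : E) : L (fderiv 𝕜 X q z u) = 0 := by
    have h1 : (fun q ↦ L (X q u)) =ᶠ[𝓝 q] fun _ ↦ u := by
      filter_upwards [h.isOpen.mem_nhds hq] with q' hq'
      exact h.left_inv q' hq' u
    have h2 : HasFDerivAt X (fderiv 𝕜 X q) q :=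
      ((h.contDiffOn.contDiffAt (h.isOpen.mem_nhds hq)).differentiableAt (by simp)).hasFDerivAt
    have h3 := L.hasFDerivAt.comp q (h2.clm_apply (hasFDerivAt_const u q))
    have h4 := h3.unique ((hasFDerivAt_const u q).congr_of_eventuallyEq h1)
    simpa using congrArg (fun A ↦ A z) h4
  have hw0 : w = 0 := by
    have h1 := congrArg L hw
    have h2 := h.left_inv q hq w
    simp only [ContinuousLinearMap.id_apply] at h2
    rw [h2, lieBracket_apply, h.fderiv_apply_const hq,
      h.fderiv_apply_const hq, map_sub, hL, hL, sub_zero] at h1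
    exact h1.symm
  rw [hw0, map_zero, lieBracket_apply] at hw
  simpa only [h.fderiv_apply_const hq, sub_eq_zero] using hw

end IsFrameInChart
end FrameField

section Closed

variable {𝕜 : Type*} [RCLike 𝕜] {E : Type*} [NormedAddCommGroup E] [NormedSpace 𝕜 E]
  {N : Type*} [TopologicalSpace N] [ChartedSpace E N] [IsManifold 𝓘(𝕜, E) ∞ N]

/-- The differential of a scalar function, as a covector. -/
def differential (f : N → 𝕜) (x : N) : TangentSpace 𝓘(𝕜, E) x →L[𝕜] 𝕜 :=
  mfderiv 𝓘(𝕜, E) 𝓘(𝕜, 𝕜) f x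

lemma differential_chartDerivSymm {f : N → 𝕜} {x₀ x : N} (hx : x ∈ (chartAt E x₀).source)
    (hf : MDifferentiableAt 𝓘(𝕜, E) 𝓘(𝕜, 𝕜) f x) (v : E) :
    differential f x (chartDerivSymm 𝕜 x₀ x v) =
      fderiv 𝕜 (f ∘ (extChartAt 𝓘(𝕜, E) x₀).symm) (extChartAt 𝓘(𝕜, E) x₀ x) v := by
  have hxs : x ∈ (extChartAt 𝓘(𝕜, E) x₀).source := by simpa using hx
  have h1 := (extChartAt 𝓘(𝕜, E) x₀).left_inv hxs
  have hs : MDifferentiableAt 𝓘(𝕜, E) 𝓘(𝕜, E) (extChartAt 𝓘(𝕜, E) x₀).symm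
      (extChartAt 𝓘(𝕜, E) x₀ x) :=
    ((contMDiffOn_extChartAt_symm (n := ∞) x₀).contMDiffAt ((isOpen_extChartAt_target x₀).mem_nhds
      ((extChartAt 𝓘(𝕜, E) x₀).map_source hxs))).mdifferentiableAt (by simp)
  have h2 := mfderiv_comp_apply_of_eq (x := extChartAt 𝓘(𝕜, E) x₀ x) hf hs h1 v
  rw [← mfderiv_eq_fderiv]
  refine Eq.trans ?_ h2.symm
  rw [h1]
  rfl

lemma oneFormExtDeriv_apply {p : N} (α : ∀ p : N, TangentSpace 𝓘(𝕜, E) p →L[𝕜] 𝕜)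
    (v w : TangentSpace 𝓘(𝕜, E) p) : oneFormExtDeriv 𝓘(𝕜, E) α p v w =
      fderiv 𝕜 (oneFormInChart 𝓘(𝕜, E) α p) (extChartAt 𝓘(𝕜, E) p p)
        (chartDeriv 𝕜 p p v) (chartDeriv 𝕜 p p w) -
      fderiv 𝕜 (oneFormInChart 𝓘(𝕜, E) α p) (extChartAt 𝓘(𝕜, E) p p)
        (chartDeriv 𝕜 p p w) (chartDeriv 𝕜 p p v) := rfl

lemma oneFormInChart_apply {p : N} {α : ∀ p : N, TangentSpace 𝓘(𝕜, E) p →L[𝕜] 𝕜} {q : E}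
    (hq : q ∈ (extChartAt 𝓘(𝕜, E) p).target) (v : E) :
    oneFormInChart 𝓘(𝕜, E) α p q v = α ((extChartAt 𝓘(𝕜, E) p).symm q)
      (chartDerivSymm 𝕜 p ((extChartAt 𝓘(𝕜, E) p).symm q) v) := by
  rw [chartDerivSymm, (extChartAt 𝓘(𝕜, E) p).right_inv hq]
  rfl

end Closed

/-! ### The derived distribution `H G` is involutive -/

section Involutive

universe u

variable {𝕜 : Type u} [RCLike 𝕜] {E : Type u} [NormedAddCommGroup E] [NormedSpace 𝕜 E]
  {N : Type*} [TopologicalSpace N] [ChartedSpace E N] [IsManifold 𝓘(𝕜, E) ∞ N]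

/-- Frobenius theorem on the manifold: every covector that annihilates a foliation at `p` is the
differential at `p` of a function that is constant along the foliation near `p`. -/
lemma IsFoliation.exists_firstIntegral [FiniteDimensional 𝕜 E] {r m : ℕ}
    {G : ∀ x : N, Submodule 𝕜 (TangentSpace 𝓘(𝕜, E) x)} (hG : IsFoliation 𝓘(𝕜, E) r G)
    (hm : m + r = Module.finrank 𝕜 E) (p : N) (ξ : E →L[𝕜] 𝕜)
    (hξ : ∀ v ∈ G p, ξ (chartDeriv 𝕜 p p v) = 0) :
    ∃ (U : Set N) (f : N → 𝕜), IsOpen U ∧ p ∈ U ∧ U ⊆ (chartAt E p).source ∧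
      ContMDiffOn 𝓘(𝕜, E) 𝓘(𝕜, 𝕜) ∞ f U ∧
      (∀ x ∈ U, ∀ v ∈ G x, differential f x v = 0) ∧
      fderiv 𝕜 (f ∘ (extChartAt 𝓘(𝕜, E) p).symm) (extChartAt 𝓘(𝕜, E) p p) = ξ := by
  have hcomplete := FiniteDimensional.complete 𝕜 E
  obtain ⟨T, L, X, h⟩ := exists_isFrameInChart hG hm p
    (K := fun _ ↦ ContinuousLinearMap.id 𝕜 E) contDiffOn_const Function.injective_id
  let : NormedSpace ℝ E := NormedSpace.restrictScalars ℝ 𝕜 E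
  have : IsScalarTower ℝ 𝕜 E := IsScalarTower.of_algebraMap_smul fun _ _ ↦ rfl
  set φ := extChartAt 𝓘(𝕜, E) p with hφ
  obtain ⟨O, f, hO, hpO, hOT, hf, hfX, hfξ⟩ := _root_.exists_firstIntegral (L := L) h.isOpen
    h.contDiffOn h.left_inv (fun q hq u v ↦ h.commute hG hq u v) h.mem (ξ := ξ) (fun u ↦ by
      rw [← hφ, ← chartDeriv_frameField (mem_chart_source E p) X u]
      exact hξ _ (h.frameField_mem u p h.mem_chartDomain))
  have hsub : chartDomain 𝕜 p O ⊆ chartDomain 𝕜 p T := fun x hx ↦ ⟨hx.1, hOT hx.2⟩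
  have hev (x) (hx : x ∈ chartDomain 𝕜 p O) : (f ∘ φ) ∘ φ.symm =ᶠ[𝓝 (φ x)] f := by
    filter_upwards [hO.mem_nhds hx.2] with q hq
    simp [φ.right_inv (h.subset (hOT hq))]
  have hsm (x) (hx : x ∈ chartDomain 𝕜 p O) : ContMDiffAt 𝓘(𝕜, E) 𝓘(𝕜, 𝕜) ∞ (f ∘ φ) x := by
    rw [contMDiffAt_iff_contDiffAt_symm (chartDomain_subset hx)]
    exact (hf.contDiffAt (hO.mem_nhds hx.2)).congr_of_eventuallyEq (hev x hx)
  refine ⟨chartDomain 𝕜 p O, f ∘ φ, isOpen_chartDomain p hO, ⟨mem_extChartAt_source p, hpO⟩,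
    fun x hx ↦ chartDomain_subset hx, fun x hx ↦ (hsm x hx).contMDiffWithinAt,
    fun x hx v hv ↦ ?_, ?_⟩
  · obtain ⟨u, rfl⟩ := (h.mem_iff_of_mem_chartDomain (hsub hx) v).1 hv
    rw [frameField, differential_chartDerivSymm (chartDomain_subset hx)
      ((hsm x hx).mdifferentiableAt (by simp)), (hev x hx).fderiv_eq]
    exact hfX _ hx.2 u
  · rw [(hev p ⟨mem_extChartAt_source p, hpO⟩).fderiv_eq, hfξ]

/-- The differential of a smooth function is a closed smooth `1`-form. -/
lemma smoothOneFormOn_differential {f : N → 𝕜} {U : Set N} (hU : IsOpen U)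
    (hf : ContMDiffOn 𝓘(𝕜, E) 𝓘(𝕜, 𝕜) ∞ f U) :
    SmoothOneFormOn 𝓘(𝕜, E) (differential f) U ∧
    ∀ x ∈ U, oneFormExtDeriv 𝓘(𝕜, E) (differential f) x = 0 := by
  have hfx (x) (hx : x ∈ U) := hf.contMDiffAt (hU.mem_nhds hx)
  have hg (x) (hx : x ∈ U) := (contMDiffAt_iff_contDiffAt_symm (mem_chart_source E x)).1 (hfx x hx)
  constructor
  · intro x hx
    refine ContMDiffAt.contMDiffWithinAt ?_
    rw [contMDiffAt_oneForm_iff (mem_chart_source E x),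
      contMDiffAt_iff_contDiffAt_symm (mem_chart_source E x)]
    have h1 : ContDiffAt 𝕜 ∞ (fderiv 𝕜 (f ∘ (extChartAt 𝓘(𝕜, E) x).symm))
      (extChartAt 𝓘(𝕜, E) x x) := (hg x hx).fderiv_right (by simp)
    refine h1.congr_of_eventuallyEq ?_
    filter_upwards [((continuousOn_extChartAt_symm x).isOpen_inter_preimage
      (isOpen_extChartAt_target x) hU).mem_nhds
      ⟨mem_extChartAt_target (I := 𝓘(𝕜, E)) x, by simpa using hx⟩] with q hq
    ext v
    have := differential_chartDerivSymm (symm_mem_source hq.1)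
      ((hfx _ hq.2).mdifferentiableAt (by simp)) v
    rw [(extChartAt 𝓘(𝕜, E) x).right_inv hq.1] at this
    exact this
  · intro x hx
    have h1 : oneFormInChart 𝓘(𝕜, E) (differential f) x =ᶠ[𝓝 (extChartAt 𝓘(𝕜, E) x x)]
        fderiv 𝕜 (f ∘ (extChartAt 𝓘(𝕜, E) x).symm) := by
      filter_upwards [((continuousOn_extChartAt_symm x).isOpen_inter_preimage
        (isOpen_extChartAt_target x) hU).mem_nhds
        ⟨mem_extChartAt_target (I := 𝓘(𝕜, E)) x, by simpa using hx⟩] with q hq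
      ext v
      rw [oneFormInChart_apply hq.1]
      have := differential_chartDerivSymm (symm_mem_source hq.1)
        ((hfx _ hq.2).mdifferentiableAt (by simp)) v
      rwa [(extChartAt 𝓘(𝕜, E) x).right_inv hq.1] at this
    have h2 : IsSymmSndFDerivAt 𝕜 (f ∘ (extChartAt 𝓘(𝕜, E) x).symm) (extChartAt 𝓘(𝕜, E) x x) :=
      (hg x hx).isSymmSndFDerivAt (by
        rw [minSmoothness_of_isRCLikeNormedField]
        exact two_le_infty)
    ext v w
    rw [oneFormExtDeriv_apply, h1.fderiv_eq, h2.eq, sub_self]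
    rfl

/-- In a vector space: if `g` is constant along the fields `X` and `Y`, then `d(dg ∘ H)(X, Y)` is
the derivative of `g` along `[HX, Y] + [X, HY] - H[X, Y]`. -/
lemma fderiv_bracket_eq {g : E → 𝕜} {H : E → E →L[𝕜] E} {X Y : E → E} {q : E}
    (hg : ContDiffAt 𝕜 ∞ g q) (hH : ContDiffAt 𝕜 ∞ H q) (hX : ContDiffAt 𝕜 ∞ X q)
    (hY : ContDiffAt 𝕜 ∞ Y q) (hgX : (fun q ↦ fderiv 𝕜 g q (X q)) =ᶠ[𝓝 q] 0)
    (hgY : (fun q ↦ fderiv 𝕜 g q (Y q)) =ᶠ[𝓝 q] 0) :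
    fderiv 𝕜 (fun q ↦ (fderiv 𝕜 g q).comp (H q)) q (X q) (Y q)
        - fderiv 𝕜 (fun q ↦ (fderiv 𝕜 g q).comp (H q)) q (Y q) (X q) =
      fderiv 𝕜 g q (VectorField.lieBracket 𝕜 (fun q ↦ H q (X q)) Y q
        + VectorField.lieBracket 𝕜 X (fun q ↦ H q (Y q)) q
        - H q (VectorField.lieBracket 𝕜 X Y q)) := by
  have hdg : HasFDerivAt (fderiv 𝕜 g) (fderiv 𝕜 (fderiv 𝕜 g) q) q :=
    ((hg.fderiv_right (m := ∞) (by simp)).differentiableAt (by simp)).hasFDerivAt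
  have hdH := (hH.differentiableAt (by simp)).hasFDerivAt
  have hdX := (hX.differentiableAt (by simp)).hasFDerivAt
  have hdY := (hY.differentiableAt (by simp)).hasFDerivAt
  have hsymm : IsSymmSndFDerivAt 𝕜 g q := hg.isSymmSndFDerivAt (by
    rw [minSmoothness_of_isRCLikeNormedField]
    exact two_le_infty)
  have h1 (v w : E) : fderiv 𝕜 (fun q ↦ (fderiv 𝕜 g q).comp (H q)) q v w =
      fderiv 𝕜 (fderiv 𝕜 g) q v (H q w) + fderiv 𝕜 g q (fderiv 𝕜 H q v w) := by
    rw [(hdg.clm_comp hdH).fderiv]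
    simp [add_comm]
  have h2 (Z : E → E) (hZ : HasFDerivAt Z (fderiv 𝕜 Z q) q)
      (hgZ : (fun q ↦ fderiv 𝕜 g q (Z q)) =ᶠ[𝓝 q] 0) (v : E) :
      fderiv 𝕜 (fderiv 𝕜 g) q v (Z q) = - fderiv 𝕜 g q (fderiv 𝕜 Z q v) := by
    have h3 := (hdg.clm_apply hZ).unique ((hasFDerivAt_const 0 q).congr_of_eventuallyEq hgZ)
    have h4 := congrArg (fun A ↦ A v) h3
    rw [eq_neg_iff_add_eq_zero, add_comm]
    simpa using h4
  have h5 (Z : E → E) (hZ : HasFDerivAt Z (fderiv 𝕜 Z q) q) (v : E) :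
      fderiv 𝕜 (fun q ↦ H q (Z q)) q v = fderiv 𝕜 H q v (Z q) + H q (fderiv 𝕜 Z q v) := by
    rw [(hdH.clm_apply hZ).fderiv]
    simp [add_comm]
  simp only [lieBracket_apply, h1, h5 X hdX, h5 Y hdY]
  rw [hsymm.eq (X q) (H q (Y q)), h2 X hdX hgX, hsymm.eq (Y q) (H q (X q)), h2 Y hdY hgY]
  simp only [map_add, map_sub]
  ring

/-- The closedness of `α ∘ H` along `G`, for closed `α` that annihilate `G`, means that
`[HX, Y] + [X, HY] - H[X, Y]` is tangent to `G` for sections `X`, `Y` of `G`. -/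
theorem ClosedAlong.bracket_mem [FiniteDimensional 𝕜 E] {r m : ℕ}
    {G : ∀ x : N, Submodule 𝕜 (TangentSpace 𝓘(𝕜, E) x)} (hG : IsFoliation 𝓘(𝕜, E) r G)
    (hm : m + r = Module.finrank 𝕜 E)
    {H : ∀ x : N, TangentSpace 𝓘(𝕜, E) x →L[𝕜] TangentSpace 𝓘(𝕜, E) x}
    (hH : SmoothTensor11 𝓘(𝕜, E) H) (hclosed : ClosedAlong 𝓘(𝕜, E) H G)
    {U : Set N} (hU : IsOpen U) {X Y : ∀ p : N, TangentSpace 𝓘(𝕜, E) p}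
    (hX : SmoothVectorFieldOn 𝓘(𝕜, E) X U) (hY : SmoothVectorFieldOn 𝓘(𝕜, E) Y U)
    (hXG : ∀ p ∈ U, X p ∈ G p) (hYG : ∀ p ∈ U, Y p ∈ G p) {p : N} (hp : p ∈ U) :
    VectorField.mlieBracket 𝓘(𝕜, E) (fun q ↦ H q (X q)) Y p
      + VectorField.mlieBracket 𝓘(𝕜, E) X (fun q ↦ H q (Y q)) p
      - H p (VectorField.mlieBracket 𝓘(𝕜, E) X Y p) ∈ G p := by
  have hcomplete := FiniteDimensional.complete 𝕜 E
  have hps := mem_chart_source E p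
  have hHs (Z : ∀ p : N, TangentSpace 𝓘(𝕜, E) p) (hZ : SmoothVectorFieldOn 𝓘(𝕜, E) Z U) :
      SmoothVectorFieldOn 𝓘(𝕜, E) (fun q ↦ H q (Z q)) U :=
    ContMDiffOn.clm_bundle_apply hH.contMDiffOn hZ
  set Z := VectorField.mlieBracket 𝓘(𝕜, E) (fun q ↦ H q (X q)) Y p
      + VectorField.mlieBracket 𝓘(𝕜, E) X (fun q ↦ H q (Y q)) p
      - H p (VectorField.mlieBracket 𝓘(𝕜, E) X Y p) with hZ
  set q := extChartAt 𝓘(𝕜, E) p p with hq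
  have hqt : q ∈ (extChartAt 𝓘(𝕜, E) p).target := mem_extChartAt_target p
  have hHev (Y : ∀ p : N, TangentSpace 𝓘(𝕜, E) p) : chartField p (fun x ↦ H x (Y x)) =ᶠ[𝓝 q]
      fun q ↦ chartTensor p H q (chartField p Y q) := by
    filter_upwards [(isOpen_extChartAt_target p).mem_nhds hqt] with q' hq'
    exact chartTensor_chartField hq' H Y
  have hHp (v : TangentSpace 𝓘(𝕜, E) p) :
      chartDeriv 𝕜 p p (H p v) = chartTensor p H q (chartDeriv 𝕜 p p v) := by
    rw [chartTensor, hq, extChartAt_to_inv]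
    simp [chartDerivSymm_apply hps]
  have hZc : chartDeriv 𝕜 p p Z =
      VectorField.lieBracket 𝕜 (fun q ↦ chartTensor p H q (chartField p X q)) (chartField p Y) q
      + VectorField.lieBracket 𝕜 (chartField p X) (fun q ↦ chartTensor p H q (chartField p Y q)) q
      - chartTensor p H q (VectorField.lieBracket 𝕜 (chartField p X) (chartField p Y) q) := by
    rw [hZ, map_sub, map_add, hHp, chartDeriv_mlieBracket hps hU hp (hHs X hX) hY,
      chartDeriv_mlieBracket hps hU hp hX (hHs Y hY), chartDeriv_mlieBracket hps hU hp hX hY,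
      (hHev X).lieBracket_vectorField_eq Filter.EventuallyEq.rfl,
      Filter.EventuallyEq.rfl.lieBracket_vectorField_eq (hHev Y)]
  by_contra hnot
  -- a covector that separates the vector from `G p`
  obtain ⟨l, hl, hlG⟩ := Submodule.exists_le_ker_of_notMem hnot
  have : FiniteDimensional 𝕜 (TangentSpace 𝓘(𝕜, E) p) := inferInstanceAs (FiniteDimensional 𝕜 E)
  let ξ : E →L[𝕜] 𝕜 := LinearMap.toContinuousLinearMap
    (l.comp (chartDerivSymm 𝕜 p p).toLinearMap)
  have hξ (v : TangentSpace 𝓘(𝕜, E) p) : ξ (chartDeriv 𝕜 p p v) = l v := by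
    change l (chartDerivSymm 𝕜 p p (chartDeriv 𝕜 p p v)) = l v
    rw [chartDerivSymm_apply hps]
  obtain ⟨V, f, hV, hpV, hVs, hf, hfG, hfξ⟩ := hG.exists_firstIntegral hm p ξ
    (fun v hv ↦ (hξ v).trans (hlG hv))
  obtain ⟨hα, hdα⟩ := smoothOneFormOn_differential hV hf
  have hmain := hclosed V hV _ hα hdα hfG p hpV _ (hXG p hp) _ (hYG p hp)
  have hfx (x) (hx : x ∈ V) := (hf.contMDiffAt (hV.mem_nhds hx)).mdifferentiableAt (by simp)
  have hVq : ∀ᶠ q' in 𝓝 q, q' ∈ (extChartAt 𝓘(𝕜, E) p).target ∧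
      (extChartAt 𝓘(𝕜, E) p).symm q' ∈ V ∩ U :=
    ((continuousOn_extChartAt_symm p).isOpen_inter_preimage
      (isOpen_extChartAt_target p) (hV.inter hU)).mem_nhds ⟨hqt, by
        rw [Set.mem_preimage, hq, extChartAt_to_inv]
        exact ⟨hpV, hp⟩⟩
  set g := f ∘ (extChartAt 𝓘(𝕜, E) p).symm with hg
  have hform : oneFormInChart 𝓘(𝕜, E) (fun x ↦ (differential f x).comp (H x)) p =ᶠ[𝓝 q]
      fun q ↦ (fderiv 𝕜 g q).comp (chartTensor p H q) := by
    filter_upwards [hVq] with q' hq'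
    ext v
    rw [oneFormInChart_apply hq'.1]
    have h1 := differential_chartDerivSymm (symm_mem_source hq'.1) (hfx _ hq'.2.1)
      (chartTensor p H q' v)
    rw [(extChartAt 𝓘(𝕜, E) p).right_inv hq'.1, chartTensor] at h1
    simp only [ContinuousLinearMap.comp_apply, chartDerivSymm_apply (symm_mem_source hq'.1)] at h1
    exact h1
  have hgX (X : ∀ p : N, TangentSpace 𝓘(𝕜, E) p) (hXG : ∀ p ∈ U, X p ∈ G p) :
      (fun q ↦ fderiv 𝕜 g q (chartField p X q)) =ᶠ[𝓝 q] 0 := by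
    filter_upwards [hVq] with q' hq'
    have h1 := differential_chartDerivSymm (symm_mem_source hq'.1) (hfx _ hq'.2.1)
      (chartField p X q')
    rw [(extChartAt 𝓘(𝕜, E) p).right_inv hq'.1, chartField,
      chartDerivSymm_apply (symm_mem_source hq'.1), hfG _ hq'.2.1 _ (hXG _ hq'.2.2)] at h1
    exact h1.symm
  have hgs : ContDiffAt 𝕜 ∞ g q :=
    (contMDiffAt_iff_contDiffAt_symm hps).1 (hf.contMDiffAt (hV.mem_nhds hpV))
  have hfin := fderiv_bracket_eq hgs (contDiffAt_chartTensor hps hH)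
    (contDiffAt_chartField hps hU hp hX) (contDiffAt_chartField hps hU hp hY)
    (hgX X hXG) (hgX Y hYG)
  rw [← hZc, hfξ, hξ] at hfin
  rw [oneFormExtDeriv_apply, hform.fderiv_eq, ← chartField_extChartAt hps,
    ← chartField_extChartAt hps, hfin] at hmain
  exact hl hmain

end Involutive

/-! ### Lie algebroids in coordinates -/

section Algebroid

variable {𝕜 : Type*} [RCLike 𝕜] {E : Type*} [NormedAddCommGroup E] [NormedSpace 𝕜 E]
  [CompleteSpace E] {W : Type*} [NormedAddCommGroup W] [NormedSpace 𝕜 W]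

/-- The Jacobiator of the bracket with structure functions `C` and anchor `ρ`, on constant
sections. -/
def jacobiator (ρ : E → W →L[𝕜] E) (C : E → W →L[𝕜] W →L[𝕜] W) (q : E) (a b c : W) : W :=
  (fderiv 𝕜 C q (ρ q a) b c + C q a (C q b c)) + (fderiv 𝕜 C q (ρ q b) c a + C q b (C q c a))
    + (fderiv 𝕜 C q (ρ q c) a b + C q c (C q a b))

/-- A skew bracket on sections of the trivial bundle `W` over the open set `T`, with structure
functions `C`, which the anchor `ρ` carries to the bracket of vector fields. This is a Lie
algebroid except for the Jacobi identity. -/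
structure IsPreAlgebroid (T : Set E) (ρ : E → W →L[𝕜] E) (C : E → W →L[𝕜] W →L[𝕜] W) :
    Prop where
  isOpen : IsOpen T
  contDiffOn_anchor : ContDiffOn 𝕜 ∞ ρ T
  contDiffOn_bracket : ContDiffOn 𝕜 ∞ C T
  skew : ∀ q ∈ T, ∀ u v, C q u v = - C q v u
  anchor : ∀ q ∈ T, ∀ u v, fderiv 𝕜 ρ q (ρ q u) v - fderiv 𝕜 ρ q (ρ q v) u = ρ q (C q u v)

/-- A Lie algebroid structure on the trivial bundle `W` over the open set `T`. -/
structure IsLieAlgebroid (T : Set E) (ρ : E → W →L[𝕜] E) (C : E → W →L[𝕜] W →L[𝕜] W) : Prop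
    extends IsPreAlgebroid T ρ C where
  jacobi : ∀ q ∈ T, ∀ a b c, jacobiator ρ C q a b c = 0

lemma fderiv_clm_apply_const {V : Type*} [NormedAddCommGroup V] [NormedSpace 𝕜 V]
    {ρ : E → W →L[𝕜] V} {q : E} (h : DifferentiableAt 𝕜 ρ q)
    (u : W) (v : E) : fderiv 𝕜 (fun q ↦ ρ q u) q v = fderiv 𝕜 ρ q v u := by
  rw [(h.hasFDerivAt.clm_apply (hasFDerivAt_const u q)).fderiv]
  simp

lemma fderiv_add_smul {V : Type*} [NormedAddCommGroup V] [NormedSpace 𝕜 V] {f g : E → V} {q : E}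
    (hf : DifferentiableAt 𝕜 f q) (hg : DifferentiableAt 𝕜 g q) (t : 𝕜) :
    fderiv 𝕜 (fun q ↦ f q + t • g q) q = fderiv 𝕜 f q + t • fderiv 𝕜 g q :=
  (hf.hasFDerivAt.fun_add (hg.hasFDerivAt.fun_const_smul t)).fderiv

namespace IsPreAlgebroid

variable {T : Set E} {ρ : E → W →L[𝕜] E} {C : E → W →L[𝕜] W →L[𝕜] W}

lemma differentiableAt_anchor (h : IsPreAlgebroid T ρ C) {q : E} (hq : q ∈ T) :
    DifferentiableAt 𝕜 ρ q :=
  (h.contDiffOn_anchor.contDiffAt (h.isOpen.mem_nhds hq)).differentiableAt (by simp)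

lemma differentiableAt_bracket (h : IsPreAlgebroid T ρ C) {q : E} (hq : q ∈ T) :
    DifferentiableAt 𝕜 C q :=
  (h.contDiffOn_bracket.contDiffAt (h.isOpen.mem_nhds hq)).differentiableAt (by simp)

lemma lieBracket_anchor (h : IsPreAlgebroid T ρ C) {q : E} (hq : q ∈ T) (u v : W) :
    VectorField.lieBracket 𝕜 (fun q ↦ ρ q u) (fun q ↦ ρ q v) q = ρ q (C q u v) := by
  rw [lieBracket_apply, fderiv_clm_apply_const (h.differentiableAt_anchor hq),
    fderiv_clm_apply_const (h.differentiableAt_anchor hq), h.anchor q hq]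

lemma lieBracket_lieBracket_anchor (h : IsPreAlgebroid T ρ C) {q : E} (hq : q ∈ T) (a b c : W) :
    VectorField.lieBracket 𝕜 (fun q ↦ ρ q a)
      (VectorField.lieBracket 𝕜 (fun q ↦ ρ q b) (fun q ↦ ρ q c)) q =
    ρ q (fderiv 𝕜 C q (ρ q a) b c + C q a (C q b c)) := by
  have hev : VectorField.lieBracket 𝕜 (fun q ↦ ρ q b) (fun q ↦ ρ q c) =ᶠ[𝓝 q]
      fun q ↦ ρ q (C q b c) := by
    filter_upwards [h.isOpen.mem_nhds hq] with q' hq'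
    exact h.lieBracket_anchor hq' b c
  have hρ := h.differentiableAt_anchor hq
  have hC := h.differentiableAt_bracket hq
  have hC' : HasFDerivAt (fun q ↦ C q b c) _ q :=
    (hC.hasFDerivAt.clm_apply (hasFDerivAt_const b q)).clm_apply (hasFDerivAt_const c q)
  rw [Filter.EventuallyEq.rfl.lieBracket_vectorField_eq hev, lieBracket_apply,
    (hρ.hasFDerivAt.clm_apply hC').fderiv, fderiv_clm_apply_const hρ]
  have h1 := h.anchor q hq a (C q b c)
  rw [map_add, ← h1]
  simp
  abel

/-- The anchor maps the Jacobiator to that of the bracket of vector fields, which vanishes. -/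
lemma jacobiator_eq_zero (h : IsPreAlgebroid T ρ C) {q : E} (hq : q ∈ T)
    (hinj : Function.Injective (ρ q)) (a b c : W) : jacobiator ρ C q a b c = 0 := by
  apply hinj
  have hs (u : W) : ContDiffAt 𝕜 (minSmoothness 𝕜 2) (fun q ↦ ρ q u) q := by
    rw [minSmoothness_of_isRCLikeNormedField]
    exact (((h.contDiffOn_anchor.contDiffAt (h.isOpen.mem_nhds hq)).clm_apply
      contDiffAt_const)).of_le two_le_infty
  have h1 := VectorField.leibniz_identity_lieBracket le_rfl (hs a) (hs b) (hs c)
  rw [VectorField.lieBracket_swap (V := VectorField.lieBracket 𝕜 _ _)] at h1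
  simp only [h.lieBracket_lieBracket_anchor hq] at h1
  have h2 : fderiv 𝕜 C q (ρ q b) c a = - fderiv 𝕜 C q (ρ q b) a c := by
    have h3 : (fun q ↦ C q c a) =ᶠ[𝓝 q] fun q ↦ - C q a c := by
      filter_upwards [h.isOpen.mem_nhds hq] with q' hq'
      exact h.skew q' hq' c a
    have hC := (h.differentiableAt_bracket hq).hasFDerivAt
    have hC' (b c) : HasFDerivAt (fun q ↦ C q b c) _ q :=
      (hC.clm_apply (hasFDerivAt_const b q)).clm_apply (hasFDerivAt_const c q)
    have h4 := (hC' c a).unique ((hC' a c).neg.congr_of_eventuallyEq h3)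
    simpa using congrArg (fun A ↦ A (ρ q b)) h4
  simp only [jacobiator, h2, h.skew q hq c a, map_neg, map_add, map_zero] at h1 ⊢
  rw [h1]
  abel

end IsPreAlgebroid

/-- A pencil of Lie algebroids: two Lie algebroids with injective anchors `ρ₀ = K ∘ ρ₁` and `ρ₁`
which are compatible at the level of the anchors are compatible: their sum is a Lie algebroid. -/
theorem IsLieAlgebroid.add {T : Set E} {ρ₀ ρ₁ : E → W →L[𝕜] E} {C₀ C₁ : E → W →L[𝕜] W →L[𝕜] W}
    {K : E → E →L[𝕜] E} (h₀ : IsPreAlgebroid T ρ₀ C₀) (h₁ : IsPreAlgebroid T ρ₁ C₁)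
    (hK : ∀ q ∈ T, ∀ u, ρ₀ q u = K q (ρ₁ q u))
    (hinj₀ : ∀ q ∈ T, Function.Injective (ρ₀ q)) (hinj₁ : ∀ q ∈ T, Function.Injective (ρ₁ q))
    (hcompat : ∀ q ∈ T, ∀ u v,
      (fderiv 𝕜 ρ₀ q (ρ₁ q u) v - fderiv 𝕜 ρ₀ q (ρ₁ q v) u)
        + (fderiv 𝕜 ρ₁ q (ρ₀ q u) v - fderiv 𝕜 ρ₁ q (ρ₀ q v) u) =
      ρ₀ q (C₁ q u v) + ρ₁ q (C₀ q u v)) :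
    IsLieAlgebroid T (fun q ↦ ρ₀ q + ρ₁ q) (fun q ↦ C₀ q + C₁ q) := by
  have hpencil (t : 𝕜) : IsPreAlgebroid T (fun q ↦ ρ₀ q + t • ρ₁ q) (fun q ↦ C₀ q + t • C₁ q) := by
    refine ⟨h₀.isOpen, h₀.contDiffOn_anchor.add (h₁.contDiffOn_anchor.const_smul t),
      h₀.contDiffOn_bracket.add (h₁.contDiffOn_bracket.const_smul t), fun q hq u v ↦ ?_,
      fun q hq u v ↦ ?_⟩
    · simp only [add_apply, smul_apply, h₀.skew q hq u v, h₁.skew q hq u v]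
      module
    · have hd : fderiv 𝕜 (fun q ↦ ρ₀ q + t • ρ₁ q) q = fderiv 𝕜 ρ₀ q + t • fderiv 𝕜 ρ₁ q :=
        fderiv_add_smul (h₀.differentiableAt_anchor hq) (h₁.differentiableAt_anchor hq) t
      have e0 := h₀.anchor q hq u v
      have e1 := h₁.anchor q hq u v
      have e2 := hcompat q hq u v
      simp only [hd, add_apply, smul_apply, map_add, map_smul] at *
      rw [← e0]
      linear_combination (norm := module) (t ^ 2) • e1 + t • e2
  have hJ (t : 𝕜) (q) (hq : q ∈ T) (a b c) : jacobiator (fun q ↦ ρ₀ q + t • ρ₁ q)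
      (fun q ↦ C₀ q + t • C₁ q) q a b c = jacobiator ρ₀ C₀ q a b c
        + t • (jacobiator (fun q ↦ ρ₀ q + ρ₁ q) (fun q ↦ C₀ q + C₁ q) q a b c
          - jacobiator ρ₀ C₀ q a b c - jacobiator ρ₁ C₁ q a b c)
        + t ^ 2 • jacobiator ρ₁ C₁ q a b c := by
    have hd (t : 𝕜) : fderiv 𝕜 (fun q ↦ C₀ q + t • C₁ q) q = fderiv 𝕜 C₀ q + t • fderiv 𝕜 C₁ q := by
      exact fderiv_add_smul (V := W →L[𝕜] W →L[𝕜] W) (h₀.differentiableAt_bracket hq)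
        (h₁.differentiableAt_bracket hq) t
    have hd1 := hd 1
    simp only [one_smul] at hd1
    simp only [jacobiator, hd, hd1, add_apply, smul_apply, map_add,
      map_smul]
    module
  have hone := hpencil 1
  simp only [one_smul] at hone
  refine ⟨hone, fun q hq a b c ↦ ?_⟩
  -- the Jacobiator of the pencil is quadratic in the parameter; it vanishes at `0`, at infinity,
  -- and at a parameter larger than the norm of `K q`
  set t : 𝕜 := ((‖K q‖ + 1 : ℝ) : 𝕜) with ht
  have htn : ‖t‖ = ‖K q‖ + 1 := by
    rw [ht, RCLike.norm_ofReal, abs_of_pos (by positivity)]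
  have ht0 : t ≠ 0 := by
    rw [← norm_pos_iff, htn]
    positivity
  have htinj : Function.Injective (ρ₀ q + t • ρ₁ q) := by
    rw [injective_iff_map_eq_zero]
    intro u hu
    have h1 : K q (ρ₁ q u) = - (t • ρ₁ q u) := by
      rw [← hK q hq, eq_neg_iff_add_eq_zero]
      exact hu
    have h2 := (K q).le_opNorm (ρ₁ q u)
    rw [h1, norm_neg, norm_smul, htn] at h2
    have h3 : ‖ρ₁ q u‖ = 0 := by nlinarith [norm_nonneg (ρ₁ q u)]
    exact hinj₁ q hq ((norm_eq_zero.1 h3).trans (map_zero _).symm)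
  have h1 := (hpencil t).jacobiator_eq_zero hq htinj a b c
  rw [hJ t q hq, h₀.jacobiator_eq_zero hq (hinj₀ q hq) a b c,
    h₁.jacobiator_eq_zero hq (hinj₁ q hq) a b c] at h1
  simpa [ht0] using h1

end Algebroid

/-! ### The pencil of Lie algebroids of the pair `(G, H)` -/

section StructureMap

variable {𝕜 : Type*} [RCLike 𝕜] {E : Type*} [NormedAddCommGroup E] [NormedSpace 𝕜 E]
  [CompleteSpace E] {W : Type*} [NormedAddCommGroup W] [NormedSpace 𝕜 W]

/-- The structure functions of the frame `ρ` with respect to a left inverse `R` of it: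
`(u, v) ↦ R [ρ u, ρ v]`. -/
def structureMap (R : E → E →L[𝕜] W) (ρ : E → W →L[𝕜] E) (q : E) : W →L[𝕜] W →L[𝕜] W :=
  (ContinuousLinearMap.compL 𝕜 W E W (R q)).comp
    ((fderiv 𝕜 ρ q).comp (ρ q) - ((fderiv 𝕜 ρ q).comp (ρ q)).flip)

lemma structureMap_apply (R : E → E →L[𝕜] W) (ρ : E → W →L[𝕜] E) (q : E) (u v : W) :
    structureMap R ρ q u v = R q (fderiv 𝕜 ρ q (ρ q u) v - fderiv 𝕜 ρ q (ρ q v) u) := rfl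

lemma contDiffOn_structureMap [FiniteDimensional 𝕜 W] {R : E → E →L[𝕜] W} {ρ : E → W →L[𝕜] E}
    {T : Set E} (hT : IsOpen T) (hR : ContDiffOn 𝕜 ∞ R T) (hρ : ContDiffOn 𝕜 ∞ ρ T) :
    ContDiffOn 𝕜 ∞ (structureMap R ρ) T := by
  have h1 (u v : W) : ContDiffOn 𝕜 ∞ (fun q ↦ fderiv 𝕜 ρ q (ρ q u) v) T :=
    ((hρ.fderiv_of_isOpen hT (by simp)).clm_apply
      (hρ.clm_apply contDiffOn_const)).clm_apply contDiffOn_const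
  refine contDiffOn_clm_apply.2 fun u ↦ contDiffOn_clm_apply.2 fun v ↦ ?_
  exact hR.clm_apply ((h1 u v).sub (h1 v u))

lemma isPreAlgebroid_structureMap [FiniteDimensional 𝕜 W] {R : E → E →L[𝕜] W}
    {ρ : E → W →L[𝕜] E} {T : Set E} (hT : IsOpen T) (hR : ContDiffOn 𝕜 ∞ R T) (hρ : ContDiffOn 𝕜 ∞ ρ T)
    (hleft : ∀ q ∈ T, ∀ u, R q (ρ q u) = u)
    (hinv : ∀ q ∈ T, ∀ u v, ∃ w, fderiv 𝕜 ρ q (ρ q u) v - fderiv 𝕜 ρ q (ρ q v) u = ρ q w) :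
    IsPreAlgebroid T ρ (structureMap R ρ) := by
  refine ⟨hT, hρ, contDiffOn_structureMap hT hR hρ, fun q _ u v ↦ ?_, fun q hq u v ↦ ?_⟩
  · rw [structureMap_apply, structureMap_apply, ← map_neg, neg_sub]
  · obtain ⟨w, hw⟩ := hinv q hq u v
    rw [structureMap_apply, hw, hleft q hq]

end StructureMap

section Tensor

variable {𝕜 : Type*} [RCLike 𝕜] {E : Type*} [NormedAddCommGroup E] [NormedSpace 𝕜 E]
  {N : Type*} [TopologicalSpace N] [ChartedSpace E N] [IsManifold 𝓘(𝕜, E) ∞ N]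
  {x₀ : N} {H : ∀ x : N, TangentSpace 𝓘(𝕜, E) x →L[𝕜] TangentSpace 𝓘(𝕜, E) x}

lemma chartDeriv_apply_tensor {x : N} (hx : x ∈ (chartAt E x₀).source)
    (v : TangentSpace 𝓘(𝕜, E) x) : chartDeriv 𝕜 x₀ x (H x v) =
      chartTensor x₀ H (extChartAt 𝓘(𝕜, E) x₀ x) (chartDeriv 𝕜 x₀ x v) := by
  rw [chartTensor, (extChartAt 𝓘(𝕜, E) x₀).left_inv (by simpa using hx)]
  simp [chartDerivSymm_apply hx]

end Tensor

section Pencil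

universe u

variable {𝕜 : Type u} [RCLike 𝕜] {E : Type u} [NormedAddCommGroup E] [NormedSpace 𝕜 E]
  {N : Type*} [TopologicalSpace N] [ChartedSpace E N] [IsManifold 𝓘(𝕜, E) ∞ N]
  {x₀ : N} {H : ∀ x : N, TangentSpace 𝓘(𝕜, E) x →L[𝕜] TangentSpace 𝓘(𝕜, E) x}
  {G : ∀ x : N, Submodule 𝕜 (TangentSpace 𝓘(𝕜, E) x)} {m r : ℕ}
  {T : Set E} {L : E →L[𝕜] (Fin m → 𝕜)} {X : E → (Fin m → 𝕜) →L[𝕜] E}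

/-- The frame of `H G` that is the image of the frame `X` of `G`. -/
def imageFrame (x₀ : N) (H : ∀ x : N, TangentSpace 𝓘(𝕜, E) x →L[𝕜] TangentSpace 𝓘(𝕜, E) x)
    (X : E → (Fin m → 𝕜) →L[𝕜] E) (q : E) : (Fin m → 𝕜) →L[𝕜] E :=
  (chartTensor x₀ H q).comp (X q)

lemma apply_frameField {x : N} (hx : x ∈ (chartAt E x₀).source) (u : Fin m → 𝕜) :
    H x (frameField x₀ X u x) = frameField x₀ (imageFrame x₀ H X) u x := by
  rw [← chartDerivSymm_apply hx (H x (frameField x₀ X u x)), chartDeriv_apply_tensor hx,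
    chartDeriv_frameField hx]
  rfl

namespace IsFrameInChart

lemma contDiffOn_imageFrame (h : IsFrameInChart x₀ G T (chartTensor x₀ H) L X)
    (hH : SmoothTensor11 𝓘(𝕜, E) H) : ContDiffOn 𝕜 ∞ (imageFrame x₀ H X) T :=
  ((contDiffOn_chartTensor x₀ hH).mono h.subset).clm_comp h.contDiffOn

lemma left_inv_imageFrame (h : IsFrameInChart x₀ G T (chartTensor x₀ H) L X) {q : E} (hq : q ∈ T)
    (u : Fin m → 𝕜) : L (imageFrame x₀ H X q u) = u :=
  h.left_inv q hq u

variable [FiniteDimensional 𝕜 E]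

lemma exists_bracket_eq (h : IsFrameInChart x₀ G T (chartTensor x₀ H) L X)
    (hG : IsFoliation 𝓘(𝕜, E) r G) {q : E} (hq : q ∈ T) (u v : Fin m → 𝕜) :
    ∃ w, fderiv 𝕜 X q (X q u) v - fderiv 𝕜 X q (X q v) u = X q w := by
  have hcomplete := FiniteDimensional.complete 𝕜 E
  obtain ⟨w, hw⟩ := h.exists_lieBracket_eq hG hq u v
  rw [lieBracket_apply, h.fderiv_apply_const hq, h.fderiv_apply_const hq] at hw
  exact ⟨w, hw⟩

/-- The bracket of fields of the frame of `H G`, and the mixed brackets, in terms of the frames. -/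
lemma exists_bracket_imageFrame_eq (h : IsFrameInChart x₀ G T (chartTensor x₀ H) L X)
    (hG : IsFoliation 𝓘(𝕜, E) r G) (hm : m + r = Module.finrank 𝕜 E)
    (hH : SmoothTensor11 𝓘(𝕜, E) H) (hclosed : ClosedAlong 𝓘(𝕜, E) H G)
    (hnij : NijenhuisVanishesOn 𝓘(𝕜, E) H G) {q : E} (hq : q ∈ T) (u v : Fin m → 𝕜) :
    ∃ w, (fderiv 𝕜 (imageFrame x₀ H X) q (X q u) v - fderiv 𝕜 (imageFrame x₀ H X) q (X q v) u)
          + (fderiv 𝕜 X q (imageFrame x₀ H X q u) v - fderiv 𝕜 X q (imageFrame x₀ H X q v) u)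
          - chartTensor x₀ H q (fderiv 𝕜 X q (X q u) v - fderiv 𝕜 X q (X q v) u) = X q w ∧
      fderiv 𝕜 (imageFrame x₀ H X) q (imageFrame x₀ H X q u) v
          - fderiv 𝕜 (imageFrame x₀ H X) q (imageFrame x₀ H X q v) u = imageFrame x₀ H X q w := by
  have hcomplete := FiniteDimensional.complete 𝕜 E
  set Y := imageFrame x₀ H X with hY
  set U := chartDomain 𝕜 x₀ T with hUdef
  set x := (extChartAt 𝓘(𝕜, E) x₀).symm q with hxdef
  have hx : x ∈ U := symm_mem_chartDomain h.subset hq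
  have hxs := chartDomain_subset hx
  have hxq : extChartAt 𝓘(𝕜, E) x₀ x = q := (extChartAt 𝓘(𝕜, E) x₀).right_inv (h.subset hq)
  have hU : IsOpen U := isOpen_chartDomain x₀ h.isOpen
  have hsm (u) := smooth_frameField (x₀ := x₀) h.isOpen h.contDiffOn u
  have hHsm (u) : SmoothVectorFieldOn 𝓘(𝕜, E) (fun p ↦ H p (frameField x₀ X u p)) U :=
    ContMDiffOn.clm_bundle_apply hH.contMDiffOn (hsm u)
  have hXev (u) : chartField x₀ (frameField x₀ X u) =ᶠ[𝓝 q] fun q ↦ X q u := by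
    filter_upwards [h.isOpen.mem_nhds hq] with q' hq'
    exact chartField_frameField (h.subset hq') X u
  have hYev (u) : chartField x₀ (fun p ↦ H p (frameField x₀ X u p)) =ᶠ[𝓝 q] fun q ↦ Y q u := by
    filter_upwards [h.isOpen.mem_nhds hq] with q' hq'
    rw [chartTensor_chartField (h.subset hq'), chartField_frameField (h.subset hq') X u]
    rfl
  have hXd (u) : fderiv 𝕜 (fun q ↦ X q u) q = (fderiv 𝕜 X q).flip u := by
    ext v
    exact fderiv_clm_apply_const
      ((h.contDiffOn.contDiffAt (h.isOpen.mem_nhds hq)).differentiableAt (by simp)) u v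
  have hYd (u) : fderiv 𝕜 (fun q ↦ Y q u) q = (fderiv 𝕜 Y q).flip u := by
    ext v
    exact fderiv_clm_apply_const (((h.contDiffOn_imageFrame hH).contDiffAt
      (h.isOpen.mem_nhds hq)).differentiableAt (by simp)) u v
  have hHc (v : TangentSpace 𝓘(𝕜, E) x) :
      chartDeriv 𝕜 x₀ x (H x v) = chartTensor x₀ H q (chartDeriv 𝕜 x₀ x v) := by
    rw [chartDeriv_apply_tensor hxs, hxq]
  have hmem := hclosed.bracket_mem hG hm hH hU (hsm u) (hsm v) (h.frameField_mem u)
    (h.frameField_mem v) hx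
  have hn := hnij U hU _ _ (hsm u) (hsm v) (h.frameField_mem u) (h.frameField_mem v) x hx
  rw [h.mem_iff_chartDeriv hx] at hmem
  obtain ⟨w, hw⟩ := hmem
  replace hn := congrArg (chartDeriv 𝕜 x₀ x) hn
  rw [nijenhuis] at hn
  simp only [map_add, map_sub, map_zero, hHc,
    chartDeriv_mlieBracket hxs hU hx (hsm _) (hsm _),
    chartDeriv_mlieBracket hxs hU hx (hHsm _) (hsm _),
    chartDeriv_mlieBracket hxs hU hx (hsm _) (hHsm _),
    chartDeriv_mlieBracket hxs hU hx (hHsm _) (hHsm _), hxq,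
    (hXev _).lieBracket_vectorField_eq (hXev _), (hXev _).lieBracket_vectorField_eq (hYev _),
    (hYev _).lieBracket_vectorField_eq (hXev _), (hYev _).lieBracket_vectorField_eq (hYev _),
    lieBracket_apply, hXd, hYd, ContinuousLinearMap.flip_apply] at hn hw
  refine ⟨w, ?_, ?_⟩
  · rw [← hw, map_sub]
    abel
  · have h1 : Y q w = chartTensor x₀ H q (X q w) := rfl
    rw [h1, ← hw, ← sub_eq_zero, ← hn]
    simp only [map_add, map_sub]
    abel

/-- The Lie algebroid structure of `G`. -/
lemma isPreAlgebroid (h : IsFrameInChart x₀ G T (chartTensor x₀ H) L X)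
    (hG : IsFoliation 𝓘(𝕜, E) r G) (hH : SmoothTensor11 𝓘(𝕜, E) H) :
    IsPreAlgebroid T X (structureMap (fun q ↦ L.comp (chartTensor x₀ H q)) X) := by
  have hcomplete := FiniteDimensional.complete 𝕜 E
  exact isPreAlgebroid_structureMap h.isOpen (contDiffOn_const.clm_comp
    ((contDiffOn_chartTensor x₀ hH).mono h.subset)) h.contDiffOn h.left_inv
    fun q hq u v ↦ h.exists_bracket_eq hG hq u v

/-- The Lie algebroid structure of `H G`. -/
lemma isPreAlgebroid_imageFrame (h : IsFrameInChart x₀ G T (chartTensor x₀ H) L X)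
    (hG : IsFoliation 𝓘(𝕜, E) r G) (hm : m + r = Module.finrank 𝕜 E)
    (hH : SmoothTensor11 𝓘(𝕜, E) H) (hclosed : ClosedAlong 𝓘(𝕜, E) H G)
    (hnij : NijenhuisVanishesOn 𝓘(𝕜, E) H G) :
    IsPreAlgebroid T (imageFrame x₀ H X) (structureMap (fun _ ↦ L) (imageFrame x₀ H X)) := by
  have hcomplete := FiniteDimensional.complete 𝕜 E
  refine isPreAlgebroid_structureMap h.isOpen contDiffOn_const (h.contDiffOn_imageFrame hH)
    h.left_inv fun q hq u v ↦ ?_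
  obtain ⟨w, -, hw⟩ := h.exists_bracket_imageFrame_eq hG hm hH hclosed hnij hq u v
  exact ⟨w, hw⟩

lemma injective_imageFrame (h : IsFrameInChart x₀ G T (chartTensor x₀ H) L X) {q : E}
    (hq : q ∈ T) : Function.Injective (imageFrame x₀ H X q) :=
  Function.LeftInverse.injective (h.left_inv q hq)

lemma injective (h : IsFrameInChart x₀ G T (chartTensor x₀ H) L X) {q : E}
    (hq : q ∈ T) : Function.Injective (X q) :=
  Function.Injective.of_comp (f := chartTensor x₀ H q) (h.injective_imageFrame hq)

/-- The Lie algebroids of `G` and of `H G`, both with the underlying bundle `G`, form a pencil. -/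
theorem isLieAlgebroid_add (h : IsFrameInChart x₀ G T (chartTensor x₀ H) L X)
    (hG : IsFoliation 𝓘(𝕜, E) r G) (hm : m + r = Module.finrank 𝕜 E)
    (hH : SmoothTensor11 𝓘(𝕜, E) H) (hclosed : ClosedAlong 𝓘(𝕜, E) H G)
    (hnij : NijenhuisVanishesOn 𝓘(𝕜, E) H G) :
    IsLieAlgebroid T (fun q ↦ imageFrame x₀ H X q + X q)
      (fun q ↦ structureMap (fun _ ↦ L) (imageFrame x₀ H X) q
        + structureMap (fun q ↦ L.comp (chartTensor x₀ H q)) X q) := by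
  have hcomplete := FiniteDimensional.complete 𝕜 E
  refine IsLieAlgebroid.add (K := chartTensor x₀ H)
    (h.isPreAlgebroid_imageFrame hG hm hH hclosed hnij) (h.isPreAlgebroid hG hH)
    (fun q hq u ↦ rfl) (fun q hq ↦ h.injective_imageFrame hq)
    (fun q hq ↦ h.injective hq) fun q hq u v ↦ ?_
  obtain ⟨w, hw, hw'⟩ := h.exists_bracket_imageFrame_eq hG hm hH hclosed hnij hq u v
  obtain ⟨w₁, hw₁⟩ := h.exists_bracket_eq hG hq u v
  have hL : structureMap (fun _ ↦ L) (imageFrame x₀ H X) q u v = w := by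
    rw [structureMap_apply, hw', h.left_inv_imageFrame hq]
  have hL₁ : structureMap (fun q ↦ L.comp (chartTensor x₀ H q)) X q u v = w₁ := by
    rw [structureMap_apply, hw₁]
    exact h.left_inv q hq w₁
  rw [hL, hL₁, ← hw, hw₁]
  change _ = chartTensor x₀ H q (X q w₁) + _
  abel

end IsFrameInChart
end Pencil

/-! ### Poisson operators on vector spaces -/

section OperatorBracket

variable {𝕜 : Type*} [RCLike 𝕜] {V : Type*} [NormedAddCommGroup V] [NormedSpace 𝕜 V]

/-- The bracket of functions on `V` defined by the field `P` of linear maps from covectors to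
vectors. -/
def operatorBracket (P : V → (V →L[𝕜] 𝕜) →L[𝕜] V) (f g : V → 𝕜) (z : V) : 𝕜 :=
  fderiv 𝕜 f z (P z (fderiv 𝕜 g z))

lemma ContDiffOn.operatorBracket {P : V → (V →L[𝕜] 𝕜) →L[𝕜] V} {f g : V → 𝕜} {O : Set V}
    (hO : IsOpen O) (hP : ContDiffOn 𝕜 ∞ P O) (hf : ContDiffOn 𝕜 ∞ f O)
    (hg : ContDiffOn 𝕜 ∞ g O) : ContDiffOn 𝕜 ∞ (operatorBracket P f g) O :=
  (hf.fderiv_of_isOpen hO (by simp)).clm_apply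
    (hP.clm_apply (hg.fderiv_of_isOpen hO (by simp)))

lemma fderiv_operatorBracket {P : V → (V →L[𝕜] 𝕜) →L[𝕜] V} {f g : V → 𝕜} {z : V}
    (hP : DifferentiableAt 𝕜 P z) (hf : ContDiffAt 𝕜 ∞ f z) (hg : ContDiffAt 𝕜 ∞ g z) (v : V) :
    fderiv 𝕜 (operatorBracket P f g) z v =
      fderiv 𝕜 (fderiv 𝕜 f) z v (P z (fderiv 𝕜 g z))
        + fderiv 𝕜 f z (fderiv 𝕜 P z v (fderiv 𝕜 g z))
        + fderiv 𝕜 f z (P z (fderiv 𝕜 (fderiv 𝕜 g) z v)) := by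
  have h1 {f : V → 𝕜} (hf : ContDiffAt 𝕜 ∞ f z) :
      HasFDerivAt (fderiv 𝕜 f) (fderiv 𝕜 (fderiv 𝕜 f) z) z :=
    ((hf.fderiv_right (m := ∞) (by simp)).differentiableAt (by simp)).hasFDerivAt
  have h2 := (h1 hf).clm_apply (hP.hasFDerivAt.clm_apply (h1 hg))
  unfold operatorBracket
  rw [h2.fderiv]
  simp only [add_apply, ContinuousLinearMap.comp_apply, ContinuousLinearMap.flip_apply, map_add]
  ring

/-- The bracket of a skew-symmetric field of operators satisfies the Jacobi identity as soon as it
does so on linear functions. -/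
theorem operatorBracket_jacobi {P : V → (V →L[𝕜] 𝕜) →L[𝕜] V} {f g h : V → 𝕜} {z : V}
    (hP : DifferentiableAt 𝕜 P z) (hskew : ∀ a b : V →L[𝕜] 𝕜, a (P z b) = - b (P z a))
    (hcyc : ∀ a b c : V →L[𝕜] 𝕜, a (fderiv 𝕜 P z (P z c) b) + b (fderiv 𝕜 P z (P z a) c)
      + c (fderiv 𝕜 P z (P z b) a) = 0)
    (hf : ContDiffAt 𝕜 ∞ f z) (hg : ContDiffAt 𝕜 ∞ g z) (hh : ContDiffAt 𝕜 ∞ h z) :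
    operatorBracket P f (operatorBracket P g h) z + operatorBracket P g (operatorBracket P h f) z
      + operatorBracket P h (operatorBracket P f g) z = 0 := by
  have h1 (f g : V → 𝕜) : operatorBracket P f g z = - fderiv 𝕜 g z (P z (fderiv 𝕜 f z)) :=
    hskew _ _
  have hsymm {f : V → 𝕜} (hf : ContDiffAt 𝕜 ∞ f z) : IsSymmSndFDerivAt 𝕜 f z :=
    hf.isSymmSndFDerivAt (by
      rw [minSmoothness_of_isRCLikeNormedField]
      exact two_le_infty)
  rw [h1 f, h1 g, h1 h, fderiv_operatorBracket hP hg hh, fderiv_operatorBracket hP hh hf,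
    fderiv_operatorBracket hP hf hg, hskew (fderiv 𝕜 f z) (fderiv 𝕜 (fderiv 𝕜 g) z _),
    hskew (fderiv 𝕜 g z) (fderiv 𝕜 (fderiv 𝕜 h) z _),
    hskew (fderiv 𝕜 h z) (fderiv 𝕜 (fderiv 𝕜 f) z _),
    (hsymm hf).eq (P z (fderiv 𝕜 g z)), (hsymm hg).eq (P z (fderiv 𝕜 h z)),
    (hsymm hh).eq (P z (fderiv 𝕜 f z))]
  linear_combination - hcyc (fderiv 𝕜 f z) (fderiv 𝕜 g z) (fderiv 𝕜 h z)

end OperatorBracket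

/-! ### The linear Poisson structure on the dual of a Lie algebroid -/

section LinearPoisson

variable {𝕜 : Type*} [RCLike 𝕜] {E : Type*} [NormedAddCommGroup E] [NormedSpace 𝕜 E]
  [FiniteDimensional 𝕜 E] {m : ℕ}

/-- The component along `W = 𝕜ᵐ`, i.e. along the bidual of `W`, of a covector on `E × W'`. -/
def fiberPart (a : (E × ((Fin m → 𝕜) →L[𝕜] 𝕜)) →L[𝕜] 𝕜) : Fin m → 𝕜 :=
  fun i ↦ a (0, ContinuousLinearMap.proj i)

/-- The component along the dual of `E` of a covector on `E × W'`. -/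
def basePart (a : (E × ((Fin m → 𝕜) →L[𝕜] 𝕜)) →L[𝕜] 𝕜) : E →L[𝕜] 𝕜 :=
  a.comp (ContinuousLinearMap.inl 𝕜 E ((Fin m → 𝕜) →L[𝕜] 𝕜))

lemma covector_eq (a : (E × ((Fin m → 𝕜) →L[𝕜] 𝕜)) →L[𝕜] 𝕜)
    (z : E × ((Fin m → 𝕜) →L[𝕜] 𝕜)) : a z = basePart a z.1 + z.2 (fiberPart a) := by
  have h1 : z.2 = ∑ i, z.2 (Pi.single i 1) • ContinuousLinearMap.proj (R := 𝕜) i := by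
    ext u
    conv_lhs => rw [pi_eq_sum_univ' u]
    simp only [map_sum, map_smul, smul_eq_mul, FunLike.coe_sum, Finset.sum_apply,
      smul_apply, ContinuousLinearMap.proj_apply, mul_comm]
  have h2 : z = (z.1, 0) + ∑ i, z.2 (Pi.single i 1) •
      ((0, ContinuousLinearMap.proj i) : E × ((Fin m → 𝕜) →L[𝕜] 𝕜)) := by
    ext1
    · simp [Prod.fst_sum]
    · simpa [Prod.snd_sum] using h1
  have h3 : z.2 (fiberPart a) = ∑ i, z.2 (Pi.single i 1) • fiberPart a i := by
    nth_rw 1 [h1]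
    simp
  rw [h3]
  nth_rw 1 [h2]
  simp only [map_add, map_sum, map_smul]
  rfl

/-- The linear Poisson structure on the dual bundle of the Lie algebroid with anchor `ρ` and
structure functions `C`, as an operator from covectors to vectors. -/
def linearPoisson (ρ : E → (Fin m → 𝕜) →L[𝕜] E)
    (C : E → (Fin m → 𝕜) →L[𝕜] (Fin m → 𝕜) →L[𝕜] (Fin m → 𝕜))
    (z : E × ((Fin m → 𝕜) →L[𝕜] 𝕜)) :
    ((E × ((Fin m → 𝕜) →L[𝕜] 𝕜)) →L[𝕜] 𝕜) →L[𝕜] E × ((Fin m → 𝕜) →L[𝕜] 𝕜) :=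
  LinearMap.toContinuousLinearMap
    { toFun := fun b ↦ (- ρ z.1 (fiberPart b),
        (basePart b).comp (ρ z.1) + z.2.comp ((C z.1).flip (fiberPart b)))
      map_add' := fun a b ↦ by
        have h1 : fiberPart (a + b) = fiberPart a + fiberPart b := rfl
        have h2 : basePart (a + b) = basePart a + basePart b := rfl
        rw [h1, h2]
        ext1
        · simp [add_comm]
        · ext u
          simp
          ring
      map_smul' := fun c a ↦ by
        have h1 : fiberPart (c • a) = c • fiberPart a := rfl
        have h2 : basePart (c • a) = c • basePart a := rfl
        rw [h1, h2]
        ext1 <;> simp }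

variable {ρ : E → (Fin m → 𝕜) →L[𝕜] E}
  {C : E → (Fin m → 𝕜) →L[𝕜] (Fin m → 𝕜) →L[𝕜] (Fin m → 𝕜)}

lemma linearPoisson_apply (z : E × ((Fin m → 𝕜) →L[𝕜] 𝕜))
    (b : (E × ((Fin m → 𝕜) →L[𝕜] 𝕜)) →L[𝕜] 𝕜) :
    linearPoisson ρ C z b = (- ρ z.1 (fiberPart b),
      (basePart b).comp (ρ z.1) + z.2.comp ((C z.1).flip (fiberPart b))) := rfl

lemma apply_linearPoisson (z : E × ((Fin m → 𝕜) →L[𝕜] 𝕜))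
    (a b : (E × ((Fin m → 𝕜) →L[𝕜] 𝕜)) →L[𝕜] 𝕜) :
    a (linearPoisson ρ C z b) = basePart b (ρ z.1 (fiberPart a))
      - basePart a (ρ z.1 (fiberPart b)) + z.2 (C z.1 (fiberPart a) (fiberPart b)) := by
  rw [covector_eq a, linearPoisson_apply]
  simp
  ring

variable {T : Set E}

lemma IsPreAlgebroid.contDiffOn_linearPoisson (h : IsPreAlgebroid T ρ C) :
    ContDiffOn 𝕜 ∞ (linearPoisson ρ C) (Prod.fst ⁻¹' T) := by
  have hρ (u) : ContDiffOn 𝕜 ∞ (fun z : E × ((Fin m → 𝕜) →L[𝕜] 𝕜) ↦ ρ z.1 u) (Prod.fst ⁻¹' T) :=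
    (h.contDiffOn_anchor.comp contDiffOn_fst fun _ hz ↦ hz).clm_apply contDiffOn_const
  have hC (u v) : ContDiffOn 𝕜 ∞ (fun z : E × ((Fin m → 𝕜) →L[𝕜] 𝕜) ↦ C z.1 u v)
      (Prod.fst ⁻¹' T) :=
    ((h.contDiffOn_bracket.comp contDiffOn_fst fun _ hz ↦ hz).clm_apply
      contDiffOn_const).clm_apply contDiffOn_const
  refine contDiffOn_clm_apply.2 fun b ↦ (hρ _).neg.prodMk (contDiffOn_clm_apply.2 fun u ↦ ?_)
  exact ((contDiffOn_const (c := basePart b)).clm_apply (hρ u)).add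
    (contDiffOn_snd.clm_apply (hC u (fiberPart b)))

lemma IsPreAlgebroid.linearPoisson_skew (h : IsPreAlgebroid T ρ C)
    {z : E × ((Fin m → 𝕜) →L[𝕜] 𝕜)} (hz : z.1 ∈ T)
    (a b : (E × ((Fin m → 𝕜) →L[𝕜] 𝕜)) →L[𝕜] 𝕜) :
    a (linearPoisson ρ C z b) = - b (linearPoisson ρ C z a) := by
  rw [apply_linearPoisson, apply_linearPoisson, h.skew _ hz (fiberPart b), map_neg]
  ring

lemma IsPreAlgebroid.apply_fderiv_linearPoisson (h : IsPreAlgebroid T ρ C)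
    {z : E × ((Fin m → 𝕜) →L[𝕜] 𝕜)} (hz : z.1 ∈ T)
    (a b : (E × ((Fin m → 𝕜) →L[𝕜] 𝕜)) →L[𝕜] 𝕜) (v : E × ((Fin m → 𝕜) →L[𝕜] 𝕜)) :
    a (fderiv 𝕜 (linearPoisson ρ C) z v b) = basePart b (fderiv 𝕜 ρ z.1 v.1 (fiberPart a))
      - basePart a (fderiv 𝕜 ρ z.1 v.1 (fiberPart b)) + v.2 (C z.1 (fiberPart a) (fiberPart b))
      + z.2 (fderiv 𝕜 C z.1 v.1 (fiberPart a) (fiberPart b)) := by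
  have hcomplete := FiniteDimensional.complete 𝕜 E
  have hP := ((h.contDiffOn_linearPoisson.contDiffAt
    ((h.isOpen.preimage continuous_fst).mem_nhds hz)).differentiableAt (by simp)).hasFDerivAt
  have h1 := a.hasFDerivAt.comp z (hP.clm_apply (hasFDerivAt_const b z))
  have hρ (u) : HasFDerivAt (fun z : E × ((Fin m → 𝕜) →L[𝕜] 𝕜) ↦ ρ z.1 u) _ z :=
    ((h.differentiableAt_anchor hz).hasFDerivAt.comp z hasFDerivAt_fst).clm_apply
      (hasFDerivAt_const u z)
  have hC (u v) : HasFDerivAt (fun z : E × ((Fin m → 𝕜) →L[𝕜] 𝕜) ↦ C z.1 u v) _ z :=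
    (((h.differentiableAt_bracket hz).hasFDerivAt.comp z hasFDerivAt_fst).clm_apply
      (hasFDerivAt_const u z)).clm_apply (hasFDerivAt_const v z)
  have h2 := (((basePart b).hasFDerivAt.comp z (hρ (fiberPart a))).sub
    ((basePart a).hasFDerivAt.comp z (hρ (fiberPart b)))).add
    (hasFDerivAt_snd.clm_apply (hC (fiberPart a) (fiberPart b)))
  have h3 := h1.unique (h2.congr_of_eventuallyEq
    (Filter.Eventually.of_forall fun z ↦ apply_linearPoisson z a b))
  have h4 := congrArg (fun A ↦ A v) h3
  simp only [ContinuousLinearMap.comp_apply, add_apply, sub_apply, ContinuousLinearMap.flip_apply,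
    zero_apply, map_zero, zero_add, ContinuousLinearMap.coe_fst',
    ContinuousLinearMap.coe_snd'] at h4
  rw [h4]
  ring

/-- The Jacobi identity of the linear Poisson structure on linear functions: the fibre-linear part
is the Jacobi identity of the algebroid, the rest says that the anchor preserves brackets. -/
theorem IsLieAlgebroid.linearPoisson_cyclic (h : IsLieAlgebroid T ρ C)
    {z : E × ((Fin m → 𝕜) →L[𝕜] 𝕜)} (hz : z.1 ∈ T)
    (a b c : (E × ((Fin m → 𝕜) →L[𝕜] 𝕜)) →L[𝕜] 𝕜) :
    a (fderiv 𝕜 (linearPoisson ρ C) z (linearPoisson ρ C z c) b)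
      + b (fderiv 𝕜 (linearPoisson ρ C) z (linearPoisson ρ C z a) c)
      + c (fderiv 𝕜 (linearPoisson ρ C) z (linearPoisson ρ C z b) a) = 0 := by
  have hJ := congrArg z.2 (h.jacobi z.1 hz (fiberPart a) (fiberPart b) (fiberPart c))
  have h1 (a : (E × ((Fin m → 𝕜) →L[𝕜] 𝕜)) →L[𝕜] 𝕜) (u v) :=
    congrArg (basePart a) (h.anchor z.1 hz u v)
  have ha := h1 a (fiberPart b) (fiberPart c)
  have hb := h1 b (fiberPart c) (fiberPart a)
  have hc := h1 c (fiberPart a) (fiberPart b)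
  simp only [h.toIsPreAlgebroid.apply_fderiv_linearPoisson hz, linearPoisson_apply, add_apply,
    ContinuousLinearMap.comp_apply, ContinuousLinearMap.flip_apply, map_neg, neg_apply]
  simp only [jacobiator, map_add, map_sub, map_zero] at hJ ha hb hc
  rw [h.skew z.1 hz (C z.1 (fiberPart a) (fiberPart b)), map_neg,
    h.skew z.1 hz (C z.1 (fiberPart b) (fiberPart c)), map_neg,
    h.skew z.1 hz (C z.1 (fiberPart c) (fiberPart a)), map_neg]
  linear_combination - hJ - ha - hb - hc

end LinearPoisson

/-! ### Poisson structures given in local coordinates -/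

/-- The differential of a map to a vector space `V`, with values in `V`. -/
def coordDeriv {𝕜 : Type*} [RCLike 𝕜] {F : Type*} [NormedAddCommGroup F] [NormedSpace 𝕜 F]
    {K : Type*} [TopologicalSpace K] (I : ModelWithCorners 𝕜 F K)
    {P : Type*} [TopologicalSpace P] [ChartedSpace K P]
    {V : Type*} [NormedAddCommGroup V] [NormedSpace 𝕜 V] (f : P → V) (x : P) :
    TangentSpace I x →L[𝕜] V :=
  mfderiv I 𝓘(𝕜, V) f x

section Coordinates

variable {𝕜 : Type*} [RCLike 𝕜] {E : Type*} [NormedAddCommGroup E] [NormedSpace 𝕜 E]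
  {Q : Type*} [TopologicalSpace Q] [ChartedSpace E Q]
  {V : Type*} [NormedAddCommGroup V] [NormedSpace 𝕜 V]

/-- `ψ : O → Ω` and `θ : Ω → O` are mutually inverse diffeomorphisms between an open subset of the
manifold and an open subset of the vector space `V`, which need not be the model of `Q`. -/
structure IsCoordinates (O : Set Q) (Ω : Set V) (ψ : Q → V) (θ : V → Q) : Prop where
  isOpen_source : IsOpen O
  isOpen_target : IsOpen Ω
  mapsTo : ∀ x ∈ O, ψ x ∈ Ω
  mapsTo_symm : ∀ z ∈ Ω, θ z ∈ O
  left_inv : ∀ x ∈ O, θ (ψ x) = x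
  right_inv : ∀ z ∈ Ω, ψ (θ z) = z
  contMDiffOn : ContMDiffOn 𝓘(𝕜, E) 𝓘(𝕜, V) ∞ ψ O
  contMDiffOn_symm : ContMDiffOn 𝓘(𝕜, V) 𝓘(𝕜, E) ∞ θ Ω

namespace IsCoordinates

variable {O : Set Q} {Ω : Set V} {ψ : Q → V} {θ : V → Q}

lemma mdifferentiableAt (h : IsCoordinates (𝕜 := 𝕜) (E := E) O Ω ψ θ) {x : Q} (hx : x ∈ O) :
    MDifferentiableAt 𝓘(𝕜, E) 𝓘(𝕜, V) ψ x :=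
  (h.contMDiffOn.contMDiffAt (h.isOpen_source.mem_nhds hx)).mdifferentiableAt (by simp)

lemma mdifferentiableAt_symm (h : IsCoordinates (𝕜 := 𝕜) (E := E) O Ω ψ θ) {z : V} (hz : z ∈ Ω) :
    MDifferentiableAt 𝓘(𝕜, V) 𝓘(𝕜, E) θ z :=
  (h.contMDiffOn_symm.contMDiffAt (h.isOpen_target.mem_nhds hz)).mdifferentiableAt (by simp)

/-- Every covector on `Q` is pulled back from a covector on the space of the coordinates. -/
lemma exists_comp_coordDeriv (h : IsCoordinates (𝕜 := 𝕜) (E := E) O Ω ψ θ) {x : Q} (hx : x ∈ O)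
    (a : TangentSpace 𝓘(𝕜, E) x →L[𝕜] 𝕜) : ∃ b : V →L[𝕜] 𝕜, a = b.comp (coordDeriv 𝓘(𝕜, E) ψ x) := by
  let B : V →L[𝕜] E := mfderiv 𝓘(𝕜, V) 𝓘(𝕜, E) θ (ψ x)
  refine ⟨(show E →L[𝕜] 𝕜 from a).comp B, ?_⟩
  have h1 : θ ∘ ψ =ᶠ[𝓝 x] id := by
    filter_upwards [h.isOpen_source.mem_nhds hx] with y hy
    exact h.left_inv y hy
  ext v
  have h2 := mfderiv_comp_apply x (h.mdifferentiableAt_symm (h.mapsTo x hx))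
    (h.mdifferentiableAt hx) v
  rw [h1.mfderiv_eq] at h2
  have h3 : B (coordDeriv 𝓘(𝕜, E) ψ x v) = v := by
    refine h2.symm.trans ?_
    rw [mfderiv_id]
    rfl
  change a v = (show E →L[𝕜] 𝕜 from a) (B (coordDeriv 𝓘(𝕜, E) ψ x v))
  rw [h3]
  rfl

lemma mfderiv_eq (h : IsCoordinates (𝕜 := 𝕜) (E := E) O Ω ψ θ) {x : Q} (hx : x ∈ O) {f : Q → 𝕜}
    (hf : MDifferentiableAt 𝓘(𝕜, E) 𝓘(𝕜, 𝕜) f x) :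
    (mfderiv 𝓘(𝕜, E) 𝓘(𝕜, 𝕜) f x : TangentSpace 𝓘(𝕜, E) x →L[𝕜] 𝕜) =
      (fderiv 𝕜 (f ∘ θ) (ψ x)).comp (coordDeriv 𝓘(𝕜, E) ψ x) := by
  have h1 : f =ᶠ[𝓝 x] (f ∘ θ) ∘ ψ := by
    filter_upwards [h.isOpen_source.mem_nhds hx] with y hy
    simp [h.left_inv y hy]
  have h2 : MDifferentiableAt 𝓘(𝕜, V) 𝓘(𝕜, 𝕜) (f ∘ θ) (ψ x) := by
    refine MDifferentiableAt.comp _ ?_ (h.mdifferentiableAt_symm (h.mapsTo x hx))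
    rwa [h.left_inv x hx]
  ext v
  have h3 := mfderiv_comp_apply x h2 (h.mdifferentiableAt hx) v
  rw [← h1.mfderiv_eq] at h3
  refine (show _ = _ from h3).trans ?_
  rw [mfderiv_eq_fderiv]
  rfl

/-- The bracket of functions in coordinates. -/
lemma poissonBracket_eq (h : IsCoordinates (𝕜 := 𝕜) (E := E) O Ω ψ θ)
    {Λ : BivectorField 𝓘(𝕜, E) (P := Q)} {P : V → (V →L[𝕜] 𝕜) →L[𝕜] V} {x : Q} (hx : x ∈ O)
    (hΛ : ∀ a b : V →L[𝕜] 𝕜, Λ x (a.comp (coordDeriv 𝓘(𝕜, E) ψ x)) (b.comp (coordDeriv 𝓘(𝕜, E) ψ x)) =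
      a (P (ψ x) b)) {f g : Q → 𝕜} (hf : MDifferentiableAt 𝓘(𝕜, E) 𝓘(𝕜, 𝕜) f x)
    (hg : MDifferentiableAt 𝓘(𝕜, E) 𝓘(𝕜, 𝕜) g x) :
    poissonBracket 𝓘(𝕜, E) Λ f g x = operatorBracket P (f ∘ θ) (g ∘ θ) (ψ x) := by
  have h1 := hΛ (fderiv 𝕜 (f ∘ θ) (ψ x)) (fderiv 𝕜 (g ∘ θ) (ψ x))
  rw [← h.mfderiv_eq hx hf, ← h.mfderiv_eq hx hg] at h1
  exact h1

end IsCoordinates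

/-- A bivector field that in suitable local coordinates is given by Poisson operators is a Poisson
structure. -/
theorem isPoisson_of_isCoordinates {Λ : BivectorField 𝓘(𝕜, E) (P := Q)}
    (hΛ : ∀ x₀ : Q, ∃ (O : Set Q) (Ω : Set V) (ψ : Q → V) (θ : V → Q)
      (P : V → (V →L[𝕜] 𝕜) →L[𝕜] V), IsCoordinates (𝕜 := 𝕜) (E := E) O Ω ψ θ ∧ x₀ ∈ O ∧
        ContDiffOn 𝕜 ∞ P Ω ∧ (∀ z ∈ Ω, ∀ a b : V →L[𝕜] 𝕜, a (P z b) = - b (P z a)) ∧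
        (∀ z ∈ Ω, ∀ a b c : V →L[𝕜] 𝕜, a (fderiv 𝕜 P z (P z c) b)
          + b (fderiv 𝕜 P z (P z a) c) + c (fderiv 𝕜 P z (P z b) a) = 0) ∧
        ∀ x ∈ O, ∀ a b : V →L[𝕜] 𝕜,
          Λ x (a.comp (coordDeriv 𝓘(𝕜, E) ψ x)) (b.comp (coordDeriv 𝓘(𝕜, E) ψ x)) = a (P (ψ x) b)) :
    IsPoisson 𝓘(𝕜, E) Λ := by
  have hcomp {O : Set Q} {Ω : Set V} {ψ : Q → V} {θ : V → Q}
      (h : IsCoordinates (𝕜 := 𝕜) (E := E) O Ω ψ θ) {U : Set Q} (hU : IsOpen U) {f : Q → 𝕜}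
      (hf : ContMDiffOn 𝓘(𝕜, E) 𝓘(𝕜, 𝕜) ∞ f U) : ContDiffOn 𝕜 ∞ (f ∘ θ) (Ω ∩ θ ⁻¹' U) :=
    (hf.comp (h.contMDiffOn_symm.mono Set.inter_subset_left) fun _ hz ↦ hz.2).contDiffOn
  have hopen {O : Set Q} {Ω : Set V} {ψ : Q → V} {θ : V → Q}
      (h : IsCoordinates (𝕜 := 𝕜) (E := E) O Ω ψ θ) {U : Set Q} (hU : IsOpen U) :
      IsOpen (Ω ∩ θ ⁻¹' U) :=
    h.contMDiffOn_symm.continuousOn.isOpen_inter_preimage h.isOpen_target hU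
  have hmd {U : Set Q} (hU : IsOpen U) {f : Q → 𝕜} (hf : ContMDiffOn 𝓘(𝕜, E) 𝓘(𝕜, 𝕜) ∞ f U)
      {x : Q} (hx : x ∈ U) : MDifferentiableAt 𝓘(𝕜, E) 𝓘(𝕜, 𝕜) f x :=
    (hf.contMDiffAt (hU.mem_nhds hx)).mdifferentiableAt (by simp)
  have hsmooth (U : Set Q) (hU : IsOpen U) (f g : Q → 𝕜)
      (hf : ContMDiffOn 𝓘(𝕜, E) 𝓘(𝕜, 𝕜) ∞ f U) (hg : ContMDiffOn 𝓘(𝕜, E) 𝓘(𝕜, 𝕜) ∞ g U) :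
      ContMDiffOn 𝓘(𝕜, E) 𝓘(𝕜, 𝕜) ∞ (poissonBracket 𝓘(𝕜, E) Λ f g) U := by
    intro x hx
    obtain ⟨O, Ω, ψ, θ, P, h, hxO, hP, -, -, hΛP⟩ := hΛ x
    refine ContMDiffAt.contMDiffWithinAt ?_
    have h1 : ContDiffOn 𝕜 ∞ (operatorBracket P (f ∘ θ) (g ∘ θ)) (Ω ∩ θ ⁻¹' U) :=
      (hP.mono Set.inter_subset_left).operatorBracket (hopen h hU) (hcomp h hU hf) (hcomp h hU hg)
    have h2 : ψ x ∈ Ω ∩ θ ⁻¹' U :=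
      ⟨h.mapsTo x hxO, by rwa [Set.mem_preimage, h.left_inv x hxO]⟩
    have h3 := ((h1.contDiffAt ((hopen h hU).mem_nhds h2)).contMDiffAt).comp x
      (h.contMDiffOn.contMDiffAt (h.isOpen_source.mem_nhds hxO))
    refine h3.congr_of_eventuallyEq ?_
    filter_upwards [(h.isOpen_source.inter hU).mem_nhds ⟨hxO, hx⟩] with y hy
    exact h.poissonBracket_eq hy.1 (hΛP y hy.1) (hmd hU hf hy.2) (hmd hU hg hy.2)
  refine ⟨fun x a ↦ ?_, hsmooth, fun U hU f g k hf hg hk x hx ↦ ?_⟩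
  · obtain ⟨O, Ω, ψ, θ, P, h, hxO, -, hskew, -, hΛP⟩ := hΛ x
    obtain ⟨b, rfl⟩ := h.exists_comp_coordDeriv hxO a
    rw [hΛP x hxO]
    exact self_eq_neg.1 (hskew _ (h.mapsTo x hxO) b b)
  · obtain ⟨O, Ω, ψ, θ, P, h, hxO, hP, hskew, hcyc, hΛP⟩ := hΛ x
    have h2 : ψ x ∈ Ω ∩ θ ⁻¹' U :=
      ⟨h.mapsTo x hxO, by rwa [Set.mem_preimage, h.left_inv x hxO]⟩
    have hc {f : Q → 𝕜} (hf : ContMDiffOn 𝓘(𝕜, E) 𝓘(𝕜, 𝕜) ∞ f U) :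
        ContDiffAt 𝕜 ∞ (f ∘ θ) (ψ x) :=
      (hcomp h hU hf).contDiffAt ((hopen h hU).mem_nhds h2)
    have hb {f g k : Q → 𝕜} (hf : ContMDiffOn 𝓘(𝕜, E) 𝓘(𝕜, 𝕜) ∞ f U)
        (hg : ContMDiffOn 𝓘(𝕜, E) 𝓘(𝕜, 𝕜) ∞ g U) (hk : ContMDiffOn 𝓘(𝕜, E) 𝓘(𝕜, 𝕜) ∞ k U) :
        poissonBracket 𝓘(𝕜, E) Λ f (poissonBracket 𝓘(𝕜, E) Λ g k) x =
          operatorBracket P (f ∘ θ) (operatorBracket P (g ∘ θ) (k ∘ θ)) (ψ x) := by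
      rw [h.poissonBracket_eq hxO (hΛP x hxO) (hmd hU hf hx)
        (hmd hU (hsmooth U hU g k hg hk) hx)]
      have h3 : poissonBracket 𝓘(𝕜, E) Λ g k ∘ θ =ᶠ[𝓝 (ψ x)]
          operatorBracket P (g ∘ θ) (k ∘ θ) := by
        filter_upwards [(hopen h hU).mem_nhds h2] with z hz
        rw [Function.comp_apply, h.poissonBracket_eq (h.mapsTo_symm z hz.1)
          (hΛP _ (h.mapsTo_symm z hz.1)) (hmd hU hg hz.2) (hmd hU hk hz.2), h.right_inv z hz.1]
      rw [operatorBracket, h3.fderiv_eq]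
      rfl
    rw [hb hf hg hk, hb hg hk hf, hb hk hf hg]
    exact operatorBracket_jacobi ((hP.contDiffAt (h.isOpen_target.mem_nhds
      (h.mapsTo x hxO))).differentiableAt (by simp)) (hskew _ (h.mapsTo x hxO))
      (hcyc _ (h.mapsTo x hxO)) (hc hf) (hc hg) (hc hk)

end Coordinates

/-! ### Coordinates on the cotangent bundle -/

section CotangentCoordinates

variable {𝕜 : Type*} [RCLike 𝕜] {E : Type*} [NormedAddCommGroup E] [NormedSpace 𝕜 E]
  {N : Type*} [TopologicalSpace N] [ChartedSpace E N] [IsManifold 𝓘(𝕜, E) ∞ N]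

/-- The coordinates `(q, p)` of a covector that are induced by the preferred chart at `x₀`. -/
def cotangentCoord (x₀ : N) (μ : CotangentBundle 𝕜 E N) : E × (E →L[𝕜] 𝕜) :=
  (extChartAt 𝓘(𝕜, E) x₀ μ.proj,
    (μ.snd : TangentSpace 𝓘(𝕜, E) μ.proj →L[𝕜] 𝕜).comp (chartDerivSymm 𝕜 x₀ μ.proj))

/-- The covector with given coordinates with respect to the preferred chart at `x₀`. -/
def cotangentSymm (x₀ : N) (z : E × (E →L[𝕜] 𝕜)) : CotangentBundle 𝕜 E N :=
  ⟨(extChartAt 𝓘(𝕜, E) x₀).symm z.1,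
    z.2.comp (chartDeriv 𝕜 x₀ ((extChartAt 𝓘(𝕜, E) x₀).symm z.1))⟩

/-- Extensionality for covectors, with bases that are only propositionally equal. -/
lemma cotangent_ext {x : N} {a b : TangentSpace 𝓘(𝕜, E) x →L[𝕜] 𝕜} (h : ∀ v, a v = b v) :
    (⟨x, a⟩ : CotangentBundle 𝕜 E N) = ⟨x, b⟩ := by
  have : a = b := ContinuousLinearMap.ext h
  rw [this]

lemma cotangentSymm_cotangentCoord {x₀ : N} {μ : CotangentBundle 𝕜 E N}
    (hμ : μ.proj ∈ (chartAt E x₀).source) : cotangentSymm x₀ (cotangentCoord x₀ μ) = μ := by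
  obtain ⟨x, ξ⟩ := μ
  have hx : (extChartAt 𝓘(𝕜, E) x₀).symm (extChartAt 𝓘(𝕜, E) x₀ x) = x :=
    (extChartAt 𝓘(𝕜, E) x₀).left_inv (by simpa using hμ)
  simp only [cotangentSymm, cotangentCoord]
  rw [hx]
  refine cotangent_ext fun v ↦ ?_
  exact congrArg ξ (chartDerivSymm_apply hμ v)

lemma cotangentCoord_cotangentSymm {x₀ : N} {z : E × (E →L[𝕜] 𝕜)}
    (hz : z.1 ∈ (extChartAt 𝓘(𝕜, E) x₀).target) : cotangentCoord x₀ (cotangentSymm x₀ z) = z := by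
  ext1
  · exact (extChartAt 𝓘(𝕜, E) x₀).right_inv hz
  · ext v
    have h1 := chartDeriv_symm (𝕜 := 𝕜) (symm_mem_source hz) v
    exact congrArg z.2 h1

lemma extChartAt_cotangent (ν : CotangentBundle 𝕜 E N) {μ : CotangentBundle 𝕜 E N}
    (hμ : μ.proj ∈ (chartAt E ν.proj).source) :
    extChartAt (cotangentModel 𝕜 E) ν μ = cotangentCoord ν.proj μ := by
  have h1 := hom_chart (𝕜 := 𝕜) (HB := E) (F₁ := E) (E₁ := (TangentSpace 𝓘(𝕜, E) : N → Type _))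
      (F₂ := 𝕜) (E₂ := Bundle.Trivial N 𝕜) ν μ
  have h2 := cotangent_inCoordinates hμ μ.snd
  rw [cotangentCoord, ← h2]
  exact h1

lemma extChartAt_cotangent_source (ν : CotangentBundle 𝕜 E N) :
    (extChartAt (cotangentModel 𝕜 E) ν).source =
      Bundle.TotalSpace.proj ⁻¹' (chartAt E ν.proj).source := by
  rw [FiberBundle.extChartAt]
  ext μ
  simp only [PartialEquiv.trans_source, PartialEquiv.prod_source, Set.mem_inter_iff,
    Set.mem_preimage, Set.mem_prod, PartialEquiv.refl_source, Set.mem_univ, and_true,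
    extChartAt_source]
  constructor
  · rintro ⟨h1, h2⟩
    rwa [← (trivializationAt (E →L[𝕜] 𝕜)
      (fun x : N ↦ TangentSpace 𝓘(𝕜, E) x →L[𝕜] Bundle.Trivial N 𝕜 x) ν.proj).coe_fst h1]
  · intro h
    have h1 : μ ∈ (trivializationAt (E →L[𝕜] 𝕜)
        (fun x : N ↦ TangentSpace 𝓘(𝕜, E) x →L[𝕜] Bundle.Trivial N 𝕜 x) ν.proj).source := by
      rw [Bundle.Trivialization.mem_source, hom_trivializationAt_baseSet]
      simpa using h
    refine ⟨h1, ?_⟩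
    have h2 := (trivializationAt (E →L[𝕜] 𝕜)
      (fun x : N ↦ TangentSpace 𝓘(𝕜, E) x →L[𝕜] Bundle.Trivial N 𝕜 x) ν.proj).coe_fst h1
    exact h2 ▸ h

lemma extChartAt_cotangent_target (ν : CotangentBundle 𝕜 E N) :
    (extChartAt (cotangentModel 𝕜 E) ν).target =
      (extChartAt 𝓘(𝕜, E) ν.proj).target ×ˢ Set.univ := by
  rw [FiberBundle.extChartAt_target]
  congr 1
  ext q
  simp only [Set.mem_inter_iff, Set.mem_preimage, and_iff_left_iff_imp]
  intro hq
  simpa [hom_trivializationAt_baseSet] using symm_mem_source hq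

lemma extChartAt_cotangent_symm (ν : CotangentBundle 𝕜 E N) {z : E × (E →L[𝕜] 𝕜)}
    (hz : z.1 ∈ (extChartAt 𝓘(𝕜, E) ν.proj).target) :
    (extChartAt (cotangentModel 𝕜 E) ν).symm z = cotangentSymm ν.proj z := by
  have h1 : (cotangentSymm ν.proj z).proj ∈ (chartAt E ν.proj).source := symm_mem_source hz
  have h2 := extChartAt_cotangent ν h1
  rw [cotangentCoord_cotangentSymm hz] at h2
  have h3 := (extChartAt (cotangentModel 𝕜 E) ν).left_inv
    (by rw [extChartAt_cotangent_source]; exact h1)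
  rwa [h2] at h3

lemma isOpen_proj_preimage {U : Set N} (hU : IsOpen U) :
    IsOpen (Bundle.TotalSpace.proj ⁻¹' U : Set (CotangentBundle 𝕜 E N)) :=
  hU.preimage (FiberBundle.continuous_proj _ _)

lemma contMDiffOn_cotangentCoord (x₀ : N) :
    ContMDiffOn (cotangentModel 𝕜 E) 𝓘(𝕜, E × (E →L[𝕜] 𝕜)) ∞
      (cotangentCoord x₀ : CotangentBundle 𝕜 E N → _)
      (Bundle.TotalSpace.proj ⁻¹' (chartAt E x₀).source) := by
  have h1 := contMDiffOn_extChartAt (I := cotangentModel 𝕜 E) (n := ∞)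
    (x := (⟨x₀, 0⟩ : CotangentBundle 𝕜 E N))
  have h2 := extChartAt_cotangent_source (⟨x₀, 0⟩ : CotangentBundle 𝕜 E N)
  rw [extChartAt_source] at h2
  rw [h2] at h1
  exact h1.congr fun μ hμ ↦ (extChartAt_cotangent (⟨x₀, 0⟩ : CotangentBundle 𝕜 E N) hμ).symm

lemma contMDiffOn_cotangentSymm (x₀ : N) :
    ContMDiffOn 𝓘(𝕜, E × (E →L[𝕜] 𝕜)) (cotangentModel 𝕜 E) ∞
      (cotangentSymm x₀ : _ → CotangentBundle 𝕜 E N)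
      ((extChartAt 𝓘(𝕜, E) x₀).target ×ˢ Set.univ) := by
  have h1 := contMDiffOn_extChartAt_symm (I := cotangentModel 𝕜 E) (n := ∞)
    (⟨x₀, 0⟩ : CotangentBundle 𝕜 E N)
  rw [extChartAt_cotangent_target] at h1
  exact h1.congr fun z hz ↦
    (extChartAt_cotangent_symm (⟨x₀, 0⟩ : CotangentBundle 𝕜 E N) hz.1).symm

end CotangentCoordinates

/-! ### The Liouville form in coordinates -/

section Liouville

variable {𝕜 : Type*} [RCLike 𝕜] {E : Type*} [NormedAddCommGroup E] [NormedSpace 𝕜 E]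
  {N : Type*} [TopologicalSpace N] [ChartedSpace E N] [IsManifold 𝓘(𝕜, E) ∞ N]

lemma chartDeriv_self (x : N) (v : TangentSpace 𝓘(𝕜, E) x) : chartDeriv 𝕜 x x v = v := by
  have h := mfderiv_extChartAt_self (I := 𝓘(𝕜, E)) (x := x)
  exact congrArg (fun A ↦ A v) h

lemma chartDerivSymm_self (x : N) (v : E) : chartDerivSymm 𝕜 x x v = v := by
  have h := chartDeriv_symm (𝕜 := 𝕜) (mem_chart_source E x) v
  rwa [chartDeriv_self] at h

lemma cotangentCoord_self (ν : CotangentBundle 𝕜 E N) :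
    cotangentCoord ν.proj ν = (extChartAt 𝓘(𝕜, E) ν.proj ν.proj, ν.snd) := by
  ext1
  · rfl
  · exact ContinuousLinearMap.ext fun v ↦ congrArg ν.snd (chartDerivSymm_self ν.proj v)

lemma cotangentCoord_fst_mem {x₀ : N} {ν : CotangentBundle 𝕜 E N}
    (hν : ν.proj ∈ (chartAt E x₀).source) :
    (cotangentCoord x₀ ν).1 ∈ (extChartAt 𝓘(𝕜, E) x₀).target :=
  (extChartAt 𝓘(𝕜, E) x₀).map_source (by simpa using hν)

lemma eventually_cotangentSymm {x₀ : N} {ν : CotangentBundle 𝕜 E N}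
    (hν : ν.proj ∈ (chartAt E x₀).source) :
    ∀ᶠ z in 𝓝 (cotangentCoord x₀ ν), z.1 ∈ (extChartAt 𝓘(𝕜, E) x₀).target :=
  ((isOpen_extChartAt_target x₀).preimage continuous_fst).mem_nhds (cotangentCoord_fst_mem hν)

variable {V : Type*} [NormedAddCommGroup V] [NormedSpace 𝕜 V]

/-- Maps on the cotangent bundle are smooth if they are so in coordinates. -/
lemma contMDiffAt_of_comp_cotangentSymm {K : Type*} [TopologicalSpace K] {F : Type*}
    [NormedAddCommGroup F] [NormedSpace 𝕜 F] {I : ModelWithCorners 𝕜 F K}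
    {P : Type*} [TopologicalSpace P] [ChartedSpace K P] {f : CotangentBundle 𝕜 E N → P} {x₀ : N}
    {ν : CotangentBundle 𝕜 E N} (hν : ν.proj ∈ (chartAt E x₀).source)
    (hf : ContMDiffAt 𝓘(𝕜, E × (E →L[𝕜] 𝕜)) I ∞ (f ∘ cotangentSymm x₀) (cotangentCoord x₀ ν)) :
    ContMDiffAt (cotangentModel 𝕜 E) I ∞ f ν := by
  have hopen := isOpen_proj_preimage (𝕜 := 𝕜) (E := E) (chartAt E x₀).open_source
  have h1 := hf.comp ν ((contMDiffOn_cotangentCoord x₀).contMDiffAt (hopen.mem_nhds hν))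
  refine h1.congr_of_eventuallyEq ?_
  filter_upwards [hopen.mem_nhds hν] with μ hμ
  simp [cotangentSymm_cotangentCoord hμ]

/-- The differential of a map on the cotangent bundle, in coordinates. -/
lemma coordDeriv_cotangent {f : CotangentBundle 𝕜 E N → V} {ν : CotangentBundle 𝕜 E N}
    (hf : MDifferentiableAt (cotangentModel 𝕜 E) 𝓘(𝕜, V) f ν) (v : E × (E →L[𝕜] 𝕜)) :
    coordDeriv (cotangentModel 𝕜 E) f ν v =
      fderiv 𝕜 (f ∘ cotangentSymm ν.proj) (cotangentCoord ν.proj ν) v := by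
  have hν := mem_chart_source E ν.proj
  have h1 : writtenInExtChartAt (cotangentModel 𝕜 E) 𝓘(𝕜, V) ν f
      =ᶠ[𝓝 (cotangentCoord ν.proj ν)] f ∘ cotangentSymm ν.proj := by
    filter_upwards [eventually_cotangentSymm hν] with z hz
    change f ((extChartAt (cotangentModel 𝕜 E) ν).symm z) = _
    rw [extChartAt_cotangent_symm ν hz]
    rfl
  have h2 : fderivWithin 𝕜 (writtenInExtChartAt (cotangentModel 𝕜 E) 𝓘(𝕜, V) ν f)
      (Set.range (cotangentModel 𝕜 E)) (extChartAt (cotangentModel 𝕜 E) ν ν) =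
      fderiv 𝕜 (f ∘ cotangentSymm ν.proj) (cotangentCoord ν.proj ν) := by
    rw [ModelWithCorners.range_eq_univ, fderivWithin_univ, extChartAt_cotangent ν hν, h1.fderiv_eq]
  exact congrArg (fun A ↦ A v) (hf.mfderiv.trans h2)

lemma cotangentProjDeriv_apply (ν : CotangentBundle 𝕜 E N) (v : E × (E →L[𝕜] 𝕜)) :
    cotangentProjDeriv ν v = v.1 := by
  have hν := mem_chart_source E ν.proj
  have hf : MDifferentiableAt (cotangentModel 𝕜 E) 𝓘(𝕜, E)
    (Bundle.TotalSpace.proj : CotangentBundle 𝕜 E N → N) ν :=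
    (Bundle.contMDiffAt_proj (n := 1) _).mdifferentiableAt (by simp)
  have h1 : writtenInExtChartAt (cotangentModel 𝕜 E) 𝓘(𝕜, E) ν
      (Bundle.TotalSpace.proj : CotangentBundle 𝕜 E N → N)
      =ᶠ[𝓝 (cotangentCoord ν.proj ν)] Prod.fst := by
    filter_upwards [eventually_cotangentSymm hν] with z hz
    change extChartAt 𝓘(𝕜, E) ν.proj ((extChartAt (cotangentModel 𝕜 E) ν).symm z).proj = _
    rw [extChartAt_cotangent_symm ν hz]
    exact (extChartAt 𝓘(𝕜, E) ν.proj).right_inv hz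
  have h2 : fderivWithin 𝕜 (writtenInExtChartAt (cotangentModel 𝕜 E) 𝓘(𝕜, E) ν
      (Bundle.TotalSpace.proj : CotangentBundle 𝕜 E N → N))
      (Set.range (cotangentModel 𝕜 E)) (extChartAt (cotangentModel 𝕜 E) ν ν) =
      ContinuousLinearMap.fst 𝕜 E (E →L[𝕜] 𝕜) := by
    rw [ModelWithCorners.range_eq_univ, fderivWithin_univ, extChartAt_cotangent ν hν, h1.fderiv_eq,
      fderiv_fst]
  exact congrArg (fun A ↦ A v) (hf.mfderiv.trans h2)

lemma oneFormInChart_liouville (ν : CotangentBundle 𝕜 E N) {z : E × (E →L[𝕜] 𝕜)}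
    (hz : z.1 ∈ (extChartAt 𝓘(𝕜, E) ν.proj).target) :
    oneFormInChart (cotangentModel 𝕜 E) liouvilleOneForm ν z =
      z.2.comp (ContinuousLinearMap.fst 𝕜 E (E →L[𝕜] 𝕜)) := by
  set κ := extChartAt (cotangentModel 𝕜 E) ν with hκ
  have hzt : z ∈ κ.target := by
    rw [extChartAt_cotangent_target]
    exact ⟨hz, trivial⟩
  have h1 : MDifferentiableAt 𝓘(𝕜, E × (E →L[𝕜] 𝕜)) (cotangentModel 𝕜 E) κ.symm z :=
    ((contMDiffOn_extChartAt_symm (n := ∞) ν).contMDiffAt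
      ((isOpen_extChartAt_target ν).mem_nhds hzt)).mdifferentiableAt (by simp)
  have h2 : MDifferentiableAt (cotangentModel 𝕜 E) 𝓘(𝕜, E)
      (Bundle.TotalSpace.proj : CotangentBundle 𝕜 E N → N) (κ.symm z) :=
    (Bundle.contMDiffAt_proj (n := 1) _).mdifferentiableAt (by simp)
  have h3 : MDifferentiableAt 𝓘(𝕜, E) 𝓘(𝕜, E) (extChartAt 𝓘(𝕜, E) ν.proj).symm z.1 :=
    ((contMDiffOn_extChartAt_symm (n := ∞) ν.proj).contMDiffAt
      ((isOpen_extChartAt_target ν.proj).mem_nhds hz)).mdifferentiableAt (by simp)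
  have h4 : (Bundle.TotalSpace.proj : CotangentBundle 𝕜 E N → N) ∘ κ.symm =ᶠ[𝓝 z]
      (extChartAt 𝓘(𝕜, E) ν.proj).symm ∘ Prod.fst := by
    filter_upwards [((isOpen_extChartAt_target ν.proj).preimage continuous_fst).mem_nhds hz]
      with w hw
    simp only [Function.comp_apply, hκ, extChartAt_cotangent_symm ν hw]
    rfl
  refine ContinuousLinearMap.ext fun v ↦ ?_
  have h5 := mfderiv_comp_apply z h2 h1 v
  have h6 := mfderiv_comp_apply (I := 𝓘(𝕜, E × (E →L[𝕜] 𝕜))) z h3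
    (mdifferentiableAt_iff_differentiableAt.2 differentiableAt_fst) v
  have h7 : (mfderiv 𝓘(𝕜, E × (E →L[𝕜] 𝕜)) 𝓘(𝕜, E) (Prod.fst : E × (E →L[𝕜] 𝕜) → E) z :
      (E × (E →L[𝕜] 𝕜)) →L[𝕜] E) = ContinuousLinearMap.fst 𝕜 E (E →L[𝕜] 𝕜) := by
    rw [mfderiv_eq_fderiv]
    exact fderiv_fst
  have h8 : ∀ μ : CotangentBundle 𝕜 E N, μ = cotangentSymm ν.proj z →
      ∀ w : TangentSpace 𝓘(𝕜, E) μ.proj,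
        (w : E) = mfderiv 𝓘(𝕜, E) 𝓘(𝕜, E) (extChartAt 𝓘(𝕜, E) ν.proj).symm z.1 v.1 →
        (μ.snd : TangentSpace 𝓘(𝕜, E) μ.proj →L[𝕜] 𝕜) w = z.2 v.1 := by
    rintro _ rfl w hw
    have h9 := chartDeriv_symm (𝕜 := 𝕜) (symm_mem_source hz) v.1
    rw [chartDerivSymm, (extChartAt 𝓘(𝕜, E) ν.proj).right_inv hz] at h9
    refine Eq.trans ?_ (congrArg z.2 h9)
    rw [hw]
    rfl
  refine h8 (κ.symm z) (extChartAt_cotangent_symm ν hz) _ ?_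
  have h10 := congrArg (fun A : (E × (E →L[𝕜] 𝕜)) →L[𝕜] E ↦ A v)
    (h4.mfderiv_eq (I := 𝓘(𝕜, E × (E →L[𝕜] 𝕜))) (I' := 𝓘(𝕜, E)))
  refine (h5.symm.trans h10).trans (h6.trans ?_)
  exact congrArg (fun A : (E × (E →L[𝕜] 𝕜)) →L[𝕜] E ↦
    mfderiv 𝓘(𝕜, E) 𝓘(𝕜, E) (extChartAt 𝓘(𝕜, E) ν.proj).symm z.1 (A v)) h7

/-- The Liouville form in the coordinates `(q, p)`: it is `dp ∧ dq`. -/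
theorem liouvilleForm_apply (ν : CotangentBundle 𝕜 E N) (v w : E × (E →L[𝕜] 𝕜)) :
    liouvilleForm ν v w = v.2 w.1 - w.2 v.1 := by
  have hν := mem_chart_source E ν.proj
  have h1 : oneFormInChart (cotangentModel 𝕜 E) liouvilleOneForm ν
      =ᶠ[𝓝 (cotangentCoord ν.proj ν)]
      fun z ↦ z.2.comp (ContinuousLinearMap.fst 𝕜 E (E →L[𝕜] 𝕜)) := by
    filter_upwards [eventually_cotangentSymm hν] with z hz
    exact oneFormInChart_liouville ν hz
  have h2 : HasFDerivAt (fun z : E × (E →L[𝕜] 𝕜) ↦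
      z.2.comp (ContinuousLinearMap.fst 𝕜 E (E →L[𝕜] 𝕜))) _ (cotangentCoord ν.proj ν) :=
    hasFDerivAt_snd.clm_comp (hasFDerivAt_const _ _)
  have h3 (v w : E × (E →L[𝕜] 𝕜)) : fderiv 𝕜
      (oneFormInChart (cotangentModel 𝕜 E) liouvilleOneForm ν)
      (extChartAt (cotangentModel 𝕜 E) ν ν) v w = v.2 w.1 := by
    rw [extChartAt_cotangent ν hν, h1.fderiv_eq, h2.fderiv]
    simp
  have h4 (v : E × (E →L[𝕜] 𝕜)) : (mfderiv (cotangentModel 𝕜 E) 𝓘(𝕜, E × (E →L[𝕜] 𝕜))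
      (extChartAt (cotangentModel 𝕜 E) ν) ν : (E × (E →L[𝕜] 𝕜)) →L[𝕜] E × (E →L[𝕜] 𝕜)) v = v :=
    congrArg (fun A : (E × (E →L[𝕜] 𝕜)) →L[𝕜] E × (E →L[𝕜] 𝕜) ↦ A v)
      (mfderiv_extChartAt_self (I := cotangentModel 𝕜 E) (x := ν))
  have h5 : liouvilleForm ν v w = fderiv 𝕜
      (oneFormInChart (cotangentModel 𝕜 E) liouvilleOneForm ν)
      (extChartAt (cotangentModel 𝕜 E) ν ν) v w - fderiv 𝕜
      (oneFormInChart (cotangentModel 𝕜 E) liouvilleOneForm ν)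
      (extChartAt (cotangentModel 𝕜 E) ν ν) w v := by
    nth_rw 2 [← h4 v, ← h4 w]
    nth_rw 3 [← h4 v, ← h4 w]
    rfl
  rw [h5, h3, h3]

/-- The function on the cotangent bundle that is defined by the vector field `Y`: the value of a
covector on `Y`. -/
def momentum (Y : ∀ x : N, TangentSpace 𝓘(𝕜, E) x) (ν : CotangentBundle 𝕜 E N) : 𝕜 :=
  (ν.snd : TangentSpace 𝓘(𝕜, E) ν.proj →L[𝕜] 𝕜) (Y ν.proj)

lemma momentum_cotangentSymm (Y : ∀ x : N, TangentSpace 𝓘(𝕜, E) x) (x₀ : N) :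
    momentum Y ∘ cotangentSymm x₀ = fun z ↦ z.2 (chartField x₀ Y z.1) := rfl

lemma contMDiffAt_momentum {Y : ∀ x : N, TangentSpace 𝓘(𝕜, E) x} {U : Set N} (hU : IsOpen U)
    (hY : SmoothVectorFieldOn 𝓘(𝕜, E) Y U) {ν : CotangentBundle 𝕜 E N} (hν : ν.proj ∈ U) :
    ContMDiffAt (cotangentModel 𝕜 E) 𝓘(𝕜, 𝕜) ∞ (momentum Y) ν := by
  have hx := mem_chart_source E ν.proj
  refine contMDiffAt_of_comp_cotangentSymm hx ?_
  rw [momentum_cotangentSymm]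
  have h1 : ContDiffAt 𝕜 ∞ (chartField ν.proj Y) (cotangentCoord ν.proj ν).1 :=
    contDiffAt_chartField hx hU hν hY
  exact (contDiffAt_snd.clm_apply (h1.comp _ contDiffAt_fst)).contMDiffAt

lemma coordDeriv_momentum {Y : ∀ x : N, TangentSpace 𝓘(𝕜, E) x} {U : Set N} (hU : IsOpen U)
    (hY : SmoothVectorFieldOn 𝓘(𝕜, E) Y U) {ν : CotangentBundle 𝕜 E N} (hν : ν.proj ∈ U)
    (v : E × (E →L[𝕜] 𝕜)) :
    coordDeriv (cotangentModel 𝕜 E) (momentum Y) ν v = v.2 (Y ν.proj)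
      + (show E →L[𝕜] 𝕜 from ν.snd)
        (fderiv 𝕜 (chartField ν.proj Y) (extChartAt 𝓘(𝕜, E) ν.proj ν.proj) v.1) := by
  have hx := mem_chart_source E ν.proj
  have h1 : HasFDerivAt (chartField ν.proj Y)
      (fderiv 𝕜 (chartField ν.proj Y) (extChartAt 𝓘(𝕜, E) ν.proj ν.proj))
      (cotangentCoord ν.proj ν).1 :=
    ((contDiffAt_chartField hx hU hν hY).differentiableAt (by simp)).hasFDerivAt
  have h2 : HasFDerivAt (fun z : E × (E →L[𝕜] 𝕜) ↦ z.2 (chartField ν.proj Y z.1)) _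
      (cotangentCoord ν.proj ν) := hasFDerivAt_snd.clm_apply (h1.comp _ hasFDerivAt_fst)
  rw [coordDeriv_cotangent ((contMDiffAt_momentum hU hY hν).mdifferentiableAt (by simp)),
    momentum_cotangentSymm, h2.fderiv]
  have h3 : chartField ν.proj Y (cotangentCoord ν.proj ν).1 = Y ν.proj := by
    rw [cotangentCoord, chartField_extChartAt hx, chartDeriv_self]
  have h4 : (cotangentCoord ν.proj ν).2 = ν.snd := by rw [cotangentCoord_self]
  simp only [add_apply, h3, h4]
  exact add_comm _ _

end Liouville

section DualBivector

variable {𝕜 : Type*} [RCLike 𝕜] {F : Type*} [NormedAddCommGroup F] [NormedSpace 𝕜 F]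
  [FiniteDimensional 𝕜 F]
  {K : Type*} [TopologicalSpace K] (I : ModelWithCorners 𝕜 F K)
  {P : Type*} [TopologicalSpace P] [ChartedSpace K P]

lemma inverse_apply_of_injective (σ : F →L[𝕜] F →L[𝕜] 𝕜) (h : Function.Injective σ) (v : F) :
    σ.inverse (σ v) = v := by
  have h1 : Module.finrank 𝕜 F = Module.finrank 𝕜 (F →L[𝕜] 𝕜) := by
    rw [← LinearEquiv.finrank_eq (LinearMap.toContinuousLinearMap (𝕜 := 𝕜) (E := F) (F' := 𝕜))]
    exact (Subspace.dual_finrank_eq (K := 𝕜) (V := F)).symm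
  let e : F ≃L[𝕜] (F →L[𝕜] 𝕜) :=
    (LinearMap.linearEquivOfInjective σ.toLinearMap h h1).toContinuousLinearEquiv
  have h2 : (e : F →L[𝕜] F →L[𝕜] 𝕜) = σ := by
    ext v w
    rfl
  rw [← h2, ContinuousLinearMap.inverse_equiv]
  exact e.symm_apply_apply v

lemma dualBivector_apply {σ : ∀ p : P, TangentSpace I p →L[𝕜] TangentSpace I p →L[𝕜] 𝕜} {p : P}
    (h : Function.Injective (σ p)) (v w : TangentSpace I p) :
    dualBivector I σ p (σ p v) (σ p w) = σ p v w := by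
  have h1 := inverse_apply_of_injective (F := F) (σ p) h
  change σ p ((σ p).inverse (σ p v)) ((σ p).inverse (σ p w)) = σ p v w
  exact congrArg₂ (fun a b : F ↦ (show F →L[𝕜] F →L[𝕜] 𝕜 from σ p) a b) (h1 v) (h1 w)

end DualBivector

/-! ### The dual bivector fields of the Liouville form and of its pullback -/

section DualBivectors

variable {𝕜 : Type*} [RCLike 𝕜] {E : Type*} [NormedAddCommGroup E] [NormedSpace 𝕜 E]
  {N : Type*} [TopologicalSpace N] [ChartedSpace E N] [IsManifold 𝓘(𝕜, E) ∞ N]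

lemma liouvilleForm_swap (ν : CotangentBundle 𝕜 E N) (v w : TangentSpace (cotangentModel 𝕜 E) ν) :
    liouvilleForm ν v w = - liouvilleForm ν w v := by
  refine (liouvilleForm_apply ν v w).trans ?_
  rw [show liouvilleForm ν w v = _ from liouvilleForm_apply ν w v]
  ring

lemma injective_liouvilleForm (ν : CotangentBundle 𝕜 E N) :
    Function.Injective (liouvilleForm ν) := by
  rw [injective_iff_map_eq_zero]
  intro v hv
  have h1 (w : E × (E →L[𝕜] 𝕜)) :
      (show E × (E →L[𝕜] 𝕜) from v).2 w.1 - w.2 (show E × (E →L[𝕜] 𝕜) from v).1 = 0 := by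
    rw [← liouvilleForm_apply ν]
    exact congrArg (fun A ↦ A w) hv
  have h2 : (show E × (E →L[𝕜] 𝕜) from v).1 = 0 := by
    by_contra hne
    obtain ⟨g, -, hg⟩ := exists_dual_vector 𝕜 _ (norm_ne_zero_iff.2 hne)
    have h3 := h1 (0, g)
    simp only [map_zero, zero_sub, neg_eq_zero] at h3
    rw [h3] at hg
    exact hne (by simpa using hg.symm)
  have h3 : (show E × (E →L[𝕜] 𝕜) from v).2 = 0 := by
    ext w
    simpa using h1 (w, 0)
  exact Prod.ext h2 h3

/-- The covector at `ν` that is the sum of the pullback of a covector on the base and of the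
differential of a momentum function. -/
def basicAddMomentum (ν : CotangentBundle 𝕜 E N) (ξ : TangentSpace 𝓘(𝕜, E) ν.proj →L[𝕜] 𝕜)
    (Y : ∀ x : N, TangentSpace 𝓘(𝕜, E) x) : TangentSpace (cotangentModel 𝕜 E) ν →L[𝕜] 𝕜 :=
  ξ.comp (cotangentProjDeriv ν) + coordDeriv (cotangentModel 𝕜 E) (momentum Y) ν

/-- The vector that corresponds to `basicAddMomentum` under the Liouville form. -/
def hamiltonianVector (ν : CotangentBundle 𝕜 E N) (ξ : TangentSpace 𝓘(𝕜, E) ν.proj →L[𝕜] 𝕜)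
    (Y : ∀ x : N, TangentSpace 𝓘(𝕜, E) x) : TangentSpace (cotangentModel 𝕜 E) ν :=
  show E × (E →L[𝕜] 𝕜) from
    (- Y ν.proj, (show E →L[𝕜] 𝕜 from ξ) + (show E →L[𝕜] 𝕜 from ν.snd).comp
      (fderiv 𝕜 (chartField ν.proj Y) (extChartAt 𝓘(𝕜, E) ν.proj ν.proj)))

lemma liouvilleForm_hamiltonianVector_apply {ν : CotangentBundle 𝕜 E N}
    (ξ : TangentSpace 𝓘(𝕜, E) ν.proj →L[𝕜] 𝕜) (Y : ∀ x : N, TangentSpace 𝓘(𝕜, E) x)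
    (v : E × (E →L[𝕜] 𝕜)) : liouvilleForm ν (hamiltonianVector ν ξ Y) v =
      (show E →L[𝕜] 𝕜 from ξ) v.1 + v.2 (Y ν.proj) + (show E →L[𝕜] 𝕜 from ν.snd)
        (fderiv 𝕜 (chartField ν.proj Y) (extChartAt 𝓘(𝕜, E) ν.proj ν.proj) v.1) := by
  refine (liouvilleForm_apply ν _ _).trans ?_
  have h1 : v.2 (- Y ν.proj) = - v.2 (Y ν.proj) := map_neg v.2 _
  have h2 (a b c d : 𝕜) (h : d = - c) : (a + b) - d = a + c + b := by
    rw [h]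
    ring
  exact h2 _ ((show E →L[𝕜] 𝕜 from ν.snd)
    (fderiv 𝕜 (chartField ν.proj Y) (extChartAt 𝓘(𝕜, E) ν.proj ν.proj) v.1)) _ _ h1

lemma liouvilleForm_hamiltonianVector {ν : CotangentBundle 𝕜 E N}
    (ξ : TangentSpace 𝓘(𝕜, E) ν.proj →L[𝕜] 𝕜) {Y : ∀ x : N, TangentSpace 𝓘(𝕜, E) x}
    {U : Set N} (hU : IsOpen U) (hY : SmoothVectorFieldOn 𝓘(𝕜, E) Y U) (hν : ν.proj ∈ U) :
    liouvilleForm ν (hamiltonianVector ν ξ Y) = basicAddMomentum ν ξ Y := by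
  refine ContinuousLinearMap.ext fun v ↦ ?_
  refine (liouvilleForm_hamiltonianVector_apply ξ Y v).trans ?_
  rw [add_assoc]
  exact (congrArg₂ (· + ·) (congrArg ξ (cotangentProjDeriv_apply ν v))
    (coordDeriv_momentum hU hY hν v)).symm

/-- The bracket of functions on the cotangent bundle that are affine on the fibers. -/
theorem dualBivector_liouvilleForm [FiniteDimensional 𝕜 E] {ν : CotangentBundle 𝕜 E N}
    (ξ η : TangentSpace 𝓘(𝕜, E) ν.proj →L[𝕜] 𝕜) {Y Z : ∀ x : N, TangentSpace 𝓘(𝕜, E) x}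
    {U : Set N} (hU : IsOpen U) (hY : SmoothVectorFieldOn 𝓘(𝕜, E) Y U)
    (hZ : SmoothVectorFieldOn 𝓘(𝕜, E) Z U) (hν : ν.proj ∈ U) :
    dualBivector (cotangentModel 𝕜 E) liouvilleForm ν (basicAddMomentum ν ξ Y)
      (basicAddMomentum ν η Z) = η (Y ν.proj) - ξ (Z ν.proj)
        + momentum (VectorField.mlieBracket 𝓘(𝕜, E) Y Z) ν := by
  have hcomplete := FiniteDimensional.complete 𝕜 E
  have hx := mem_chart_source E ν.proj
  have h1 : VectorField.mlieBracket 𝓘(𝕜, E) Y Z ν.proj = VectorField.lieBracket 𝕜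
      (chartField ν.proj Y) (chartField ν.proj Z) (extChartAt 𝓘(𝕜, E) ν.proj ν.proj) := by
    have h2 := chartDeriv_mlieBracket hx hU hν hY hZ
    rwa [chartDeriv_self] at h2
  have hc (Y : ∀ x : N, TangentSpace 𝓘(𝕜, E) x) :
      chartField ν.proj Y (extChartAt 𝓘(𝕜, E) ν.proj ν.proj) = Y ν.proj := by
    rw [chartField_extChartAt hx, chartDeriv_self]
  set p : E →L[𝕜] 𝕜 := ν.snd with hp
  have h2 : momentum (VectorField.mlieBracket 𝓘(𝕜, E) Y Z) ν =
      p (fderiv 𝕜 (chartField ν.proj Z) (extChartAt 𝓘(𝕜, E) ν.proj ν.proj) (Y ν.proj)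
        - fderiv 𝕜 (chartField ν.proj Y) (extChartAt 𝓘(𝕜, E) ν.proj ν.proj) (Z ν.proj)) := by
    rw [momentum, h1, lieBracket_apply, hc, hc]
    rfl
  rw [← liouvilleForm_hamiltonianVector ξ hU hY hν, ← liouvilleForm_hamiltonianVector η hU hZ hν,
    dualBivector_apply (F := E × (E →L[𝕜] 𝕜)) (cotangentModel 𝕜 E) (injective_liouvilleForm ν),
    h2, map_sub]
  refine (liouvilleForm_apply ν _ _).trans ?_
  have h3 (A : E →L[𝕜] 𝕜) (Y : ∀ x : N, TangentSpace 𝓘(𝕜, E) x) :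
      A (- Y ν.proj) = - A (Y ν.proj) := map_neg A _
  have h4 (a b c d s t : 𝕜) (hs : s = - (a + b)) (ht : t = - (c + d)) :
      s - t = c - a + (d - b) := by
    rw [hs, ht]
    ring
  exact h4 _ (p (fderiv 𝕜 (chartField ν.proj Y) (extChartAt 𝓘(𝕜, E) ν.proj ν.proj) (Z ν.proj))) _
    (p (fderiv 𝕜 (chartField ν.proj Z) (extChartAt 𝓘(𝕜, E) ν.proj ν.proj) (Y ν.proj))) _ _
    (h3 _ Z) (h3 _ Y)

variable {H : ∀ x : N, TangentSpace 𝓘(𝕜, E) x →L[𝕜] TangentSpace 𝓘(𝕜, E) x}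

lemma cotangentMap_cotangentSymm {x₀ : N} {z : E × (E →L[𝕜] 𝕜)}
    (hz : z.1 ∈ (extChartAt 𝓘(𝕜, E) x₀).target) :
    cotangentMap H (cotangentSymm x₀ z) =
      cotangentSymm x₀ (z.1, z.2.comp (chartTensor x₀ H z.1)) := by
  refine cotangent_ext fun v ↦ ?_
  have h1 := chartDeriv_apply_tensor (H := H) (symm_mem_source hz) v
  rw [(extChartAt 𝓘(𝕜, E) x₀).right_inv hz] at h1
  exact congrArg z.2 h1

lemma contMDiff_cotangentMap (hH : SmoothTensor11 𝓘(𝕜, E) H) :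
    ContMDiff (cotangentModel 𝕜 E) (cotangentModel 𝕜 E) ∞ (cotangentMap H) := by
  intro ν
  have hx := mem_chart_source E ν.proj
  refine contMDiffAt_of_comp_cotangentSymm hx ?_
  have h1 : ContDiffAt 𝕜 ∞ (chartTensor ν.proj H) (cotangentCoord ν.proj ν).1 :=
    contDiffAt_chartTensor hx hH
  have h2 : ContDiffAt 𝕜 ∞ (fun z : E × (E →L[𝕜] 𝕜) ↦
      ((z.1, z.2.comp (chartTensor ν.proj H z.1)) : E × (E →L[𝕜] 𝕜))) (cotangentCoord ν.proj ν) :=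
    contDiffAt_fst.prodMk (contDiffAt_snd.clm_comp (h1.comp _ contDiffAt_fst))
  have h3 := ((contMDiffOn_cotangentSymm ν.proj).contMDiffAt
    (((isOpen_extChartAt_target ν.proj).prod isOpen_univ).mem_nhds
    ⟨cotangentCoord_fst_mem hx, trivial⟩ : _ ∈ 𝓝 (((cotangentCoord ν.proj ν).1,
      (cotangentCoord ν.proj ν).2.comp (chartTensor ν.proj H (cotangentCoord ν.proj ν).1)) :
        E × (E →L[𝕜] 𝕜)))).comp (cotangentCoord ν.proj ν) h2.contMDiffAt
  refine h3.congr_of_eventuallyEq ?_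
  filter_upwards [eventually_cotangentSymm hx] with z hz
  exact cotangentMap_cotangentSymm hz

/-- The differential of `cotangentMap H`. -/
def cotangentMapDeriv (H : ∀ x : N, TangentSpace 𝓘(𝕜, E) x →L[𝕜] TangentSpace 𝓘(𝕜, E) x)
    (ν : CotangentBundle 𝕜 E N) : TangentSpace (cotangentModel 𝕜 E) ν →L[𝕜]
      TangentSpace (cotangentModel 𝕜 E) (cotangentMap H ν) :=
  mfderiv (cotangentModel 𝕜 E) (cotangentModel 𝕜 E) (cotangentMap H) ν

lemma basicAddMomentum_cotangentMapDeriv (hH : SmoothTensor11 𝓘(𝕜, E) H)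
    {ν : CotangentBundle 𝕜 E N} (ξ : TangentSpace 𝓘(𝕜, E) ν.proj →L[𝕜] 𝕜)
    {Y : ∀ x : N, TangentSpace 𝓘(𝕜, E) x} {U : Set N} (hU : IsOpen U)
    (hY : SmoothVectorFieldOn 𝓘(𝕜, E) Y U) (hν : ν.proj ∈ U)
    (v : TangentSpace (cotangentModel 𝕜 E) ν) :
    basicAddMomentum (cotangentMap H ν) ξ Y (cotangentMapDeriv H ν v) =
      basicAddMomentum ν ξ (fun x ↦ H x (Y x)) v := by
  have hφ := (contMDiff_cotangentMap hH).mdifferentiableAt (x := ν) (by simp)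
  have h1 : MDifferentiableAt (cotangentModel 𝕜 E) 𝓘(𝕜, E)
      (Bundle.TotalSpace.proj : CotangentBundle 𝕜 E N → N) (cotangentMap H ν) :=
    (Bundle.contMDiffAt_proj (n := 1) _).mdifferentiableAt (by simp)
  have h2 : MDifferentiableAt (cotangentModel 𝕜 E) 𝓘(𝕜, 𝕜) (momentum Y) (cotangentMap H ν) :=
    (contMDiffAt_momentum (ν := cotangentMap H ν) hU hY hν).mdifferentiableAt (by simp)
  have h3 := mfderiv_comp_apply ν h1 hφ v
  have h4 := mfderiv_comp_apply ν h2 hφ v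
  have h5 : cotangentProjDeriv (cotangentMap H ν) (cotangentMapDeriv H ν v) =
    cotangentProjDeriv ν v := h3.symm
  have h6 : coordDeriv (cotangentModel 𝕜 E) (momentum Y) (cotangentMap H ν)
      (cotangentMapDeriv H ν v) =
    coordDeriv (cotangentModel 𝕜 E) (momentum fun x ↦ H x (Y x)) ν v := h4.symm
  exact congrArg₂ (· + ·) (congrArg ξ h5) h6

lemma injective_cotangentMapDeriv (hH : SmoothTensor11 𝓘(𝕜, E) H)
    (hHs : ∀ x, Function.Surjective (H x)) (ν : CotangentBundle 𝕜 E N) :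
    Function.Injective (cotangentMapDeriv H ν) := by
  rw [injective_iff_map_eq_zero]
  intro v hv
  set U := chartDomain 𝕜 ν.proj (extChartAt 𝓘(𝕜, E) ν.proj).target with hUdef
  have hU : IsOpen U := isOpen_chartDomain _ (isOpen_extChartAt_target _)
  have hν : ν.proj ∈ U := ⟨mem_extChartAt_source _, mem_extChartAt_target _⟩
  let Y (u : E) : ∀ x : N, TangentSpace 𝓘(𝕜, E) x :=
    frameField ν.proj (fun _ ↦ ContinuousLinearMap.id 𝕜 E) u
  have hY (u : E) : SmoothVectorFieldOn 𝓘(𝕜, E) (Y u) U :=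
    smooth_frameField (isOpen_extChartAt_target _) contDiffOn_const u
  have hHY (u : E) : SmoothVectorFieldOn 𝓘(𝕜, E) (fun x ↦ H x (Y u x)) U :=
    ContMDiffOn.clm_bundle_apply hH.contMDiffOn (hY u)
  have h1 (ξ : TangentSpace 𝓘(𝕜, E) ν.proj →L[𝕜] 𝕜) (u : E) :
      basicAddMomentum ν ξ (fun x ↦ H x (Y u x)) v = 0 := by
    rw [← basicAddMomentum_cotangentMapDeriv hH ξ hU (hY u) hν v, hv]
    exact map_zero _
  have h2 (ξ : TangentSpace 𝓘(𝕜, E) ν.proj →L[𝕜] 𝕜) (u : E) : liouvilleForm ν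
      (hamiltonianVector ν ξ (fun x ↦ H x (Y u x))) v = 0 := by
    rw [liouvilleForm_hamiltonianVector ξ hU (hHY u) hν, h1]
  apply injective_liouvilleForm ν
  rw [map_zero]
  refine ContinuousLinearMap.ext fun w ↦ ?_
  -- every tangent vector is of the form `hamiltonianVector`
  have h3 : ∃ ξ u, w = hamiltonianVector ν ξ (fun x ↦ H x (Y u x)) := by
    let w' : E × (E →L[𝕜] 𝕜) := w
    obtain ⟨u, hu⟩ : ∃ u : E, H ν.proj u = - w'.1 := hHs ν.proj _
    have hYu : Y u ν.proj = u := chartDerivSymm_self ν.proj u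
    let p : E →L[𝕜] 𝕜 := ν.snd
    let ξ : E →L[𝕜] 𝕜 := w'.2 - p.comp
      (fderiv 𝕜 (chartField ν.proj (fun x ↦ H x (Y u x))) (extChartAt 𝓘(𝕜, E) ν.proj ν.proj))
    refine ⟨ξ, u, ?_⟩
    refine Prod.ext ?_ (sub_add_cancel w'.2 _).symm
    change w'.1 = - (H ν.proj (Y u ν.proj) : E)
    rw [hYu, hu]
    exact (neg_neg w'.1).symm
  obtain ⟨ξ, u, hw⟩ := h3
  have h4 := h2 ξ u
  rw [liouvilleForm_swap, show w = _ from hw, h4]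
  simp

/-- The analogue of `dualBivector_liouvilleForm` for the pullback of the Liouville form. -/
theorem dualBivector_liouvilleForm₁ [FiniteDimensional 𝕜 E] (hH : SmoothTensor11 𝓘(𝕜, E) H)
    (hHs : ∀ x, Function.Surjective (H x)) {ν : CotangentBundle 𝕜 E N}
    (ξ η : TangentSpace 𝓘(𝕜, E) ν.proj →L[𝕜] 𝕜) {Y Z : ∀ x : N, TangentSpace 𝓘(𝕜, E) x}
    {U : Set N} (hU : IsOpen U) (hY : SmoothVectorFieldOn 𝓘(𝕜, E) Y U)
    (hZ : SmoothVectorFieldOn 𝓘(𝕜, E) Z U) (hν : ν.proj ∈ U) :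
    dualBivector (cotangentModel 𝕜 E) (liouvilleForm₁ H) ν
        (basicAddMomentum ν ξ (fun x ↦ H x (Y x))) (basicAddMomentum ν η (fun x ↦ H x (Z x))) =
      η (Y ν.proj) - ξ (Z ν.proj)
        + momentum (fun x ↦ H x (VectorField.mlieBracket 𝓘(𝕜, E) Y Z x)) ν := by
  have hinj := injective_cotangentMapDeriv hH hHs ν
  have hsurj : Function.Surjective (cotangentMapDeriv H ν) :=
    LinearMap.surjective_of_injective (V := E × (E →L[𝕜] 𝕜)) (f := (show (E × (E →L[𝕜] 𝕜)) →L[𝕜]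
      (E × (E →L[𝕜] 𝕜)) from cotangentMapDeriv H ν).toLinearMap) hinj
  have happ (v w : TangentSpace (cotangentModel 𝕜 E) ν) : liouvilleForm₁ H ν v w =
    liouvilleForm (cotangentMap H ν) (cotangentMapDeriv H ν v) (cotangentMapDeriv H ν w) := rfl
  have hinj₁ : Function.Injective (liouvilleForm₁ H ν) := by
    rw [injective_iff_map_eq_zero]
    intro v hv
    apply hinj
    rw [map_zero]
    apply injective_liouvilleForm (cotangentMap H ν)
    rw [map_zero]
    refine ContinuousLinearMap.ext fun w ↦ ?_
    obtain ⟨w, rfl⟩ := hsurj w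
    exact congrArg (fun A ↦ A w) hv
  have hform (ξ : TangentSpace 𝓘(𝕜, E) ν.proj →L[𝕜] 𝕜) {Y : ∀ x : N, TangentSpace 𝓘(𝕜, E) x}
      (hY : SmoothVectorFieldOn 𝓘(𝕜, E) Y U) : ∃ v, cotangentMapDeriv H ν v =
        hamiltonianVector (cotangentMap H ν) ξ Y ∧
        liouvilleForm₁ H ν v = basicAddMomentum ν ξ (fun x ↦ H x (Y x)) := by
    obtain ⟨v, hv⟩ := hsurj (hamiltonianVector (cotangentMap H ν) ξ Y)
    refine ⟨v, hv, ContinuousLinearMap.ext fun w ↦ ?_⟩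
    refine (happ v w).trans ?_
    rw [hv, liouvilleForm_hamiltonianVector (ν := cotangentMap H ν) ξ hU hY hν]
    exact basicAddMomentum_cotangentMapDeriv hH ξ hU hY hν w
  obtain ⟨v, hv, hv'⟩ := hform ξ hY
  obtain ⟨w, hw, hw'⟩ := hform η hZ
  have h1 := dualBivector_liouvilleForm (ν := cotangentMap H ν) ξ η hU hY hZ hν
  rw [← liouvilleForm_hamiltonianVector (ν := cotangentMap H ν) ξ hU hY hν,
    ← liouvilleForm_hamiltonianVector (ν := cotangentMap H ν) η hU hZ hν,
    dualBivector_apply (F := E × (E →L[𝕜] 𝕜)) (cotangentModel 𝕜 E)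
      (injective_liouvilleForm (cotangentMap H ν))] at h1
  rw [← hv', ← hw', dualBivector_apply (F := E × (E →L[𝕜] 𝕜)) (cotangentModel 𝕜 E) hinj₁]
  refine (happ v w).trans ?_
  rw [hv, hw]
  exact h1

end DualBivectors

/-! ### Coordinates that separate the leaves of the orthogonal foliation -/

section QuotientCoordinates

universe u

variable {𝕜 : Type u} [RCLike 𝕜] {E : Type u} [NormedAddCommGroup E] [NormedSpace 𝕜 E]
  {N : Type*} [TopologicalSpace N] [ChartedSpace E N] [IsManifold 𝓘(𝕜, E) ∞ N]
  {H : ∀ x : N, TangentSpace 𝓘(𝕜, E) x →L[𝕜] TangentSpace 𝓘(𝕜, E) x}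
  {G : ∀ x : N, Submodule 𝕜 (TangentSpace 𝓘(𝕜, E) x)} {m r : ℕ} {x₀ : N}
  {T : Set E} {L : E →L[𝕜] (Fin m → 𝕜)} {X : E → (Fin m → 𝕜) →L[𝕜] E}

/-- Two covectors at the same point that agree on `H G`. -/
def AgreeOnImage (H : ∀ x : N, TangentSpace 𝓘(𝕜, E) x →L[𝕜] TangentSpace 𝓘(𝕜, E) x)
    (G : ∀ x : N, Submodule 𝕜 (TangentSpace 𝓘(𝕜, E) x)) (ν ν' : CotangentBundle 𝕜 E N) : Prop :=
  ∃ (x : N) (a b : TangentSpace 𝓘(𝕜, E) x →L[𝕜] 𝕜), ν = ⟨x, a⟩ ∧ ν' = ⟨x, b⟩ ∧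
    ∀ v ∈ G x, a (H x v) = b (H x v)

lemma AgreeOnImage.refl (ν : CotangentBundle 𝕜 E N) : AgreeOnImage H G ν ν :=
  ⟨ν.proj, ν.snd, ν.snd, rfl, rfl, fun _ _ ↦ rfl⟩

lemma AgreeOnImage.symm {ν ν' : CotangentBundle 𝕜 E N} (h : AgreeOnImage H G ν ν') :
    AgreeOnImage H G ν' ν := by
  obtain ⟨x, a, b, ha, hb, hab⟩ := h
  exact ⟨x, b, a, hb, ha, fun v hv ↦ (hab v hv).symm⟩

lemma AgreeOnImage.trans {ν ν' ν'' : CotangentBundle 𝕜 E N} (h : AgreeOnImage H G ν ν')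
    (h' : AgreeOnImage H G ν' ν'') : AgreeOnImage H G ν ν'' := by
  obtain ⟨x, a, b, rfl, rfl, hab⟩ := h
  obtain ⟨y, c, d, hc, rfl, hcd⟩ := h'
  obtain rfl : x = y := congrArg Bundle.TotalSpace.proj hc
  obtain rfl : b = c := eq_of_heq (Bundle.TotalSpace.mk.inj hc).2
  exact ⟨x, a, d, rfl, rfl, fun v hv ↦ (hab v hv).trans (hcd v hv)⟩

lemma AgreeOnImage.proj_eq {ν ν' : CotangentBundle 𝕜 E N} (h : AgreeOnImage H G ν ν') :
    ν.proj = ν'.proj := by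
  obtain ⟨x, a, b, rfl, rfl, -⟩ := h
  rfl

/-- The base point of a covector, in the chart, and its values on the frame `Y`. -/
def quotientCoord (x₀ : N) (Y : E → (Fin m → 𝕜) →L[𝕜] E) (ν : CotangentBundle 𝕜 E N) :
    E × ((Fin m → 𝕜) →L[𝕜] 𝕜) :=
  ((cotangentCoord x₀ ν).1, (cotangentCoord x₀ ν).2.comp (Y (cotangentCoord x₀ ν).1))

/-- A section of `quotientCoord`, for frames `Y` with `L ∘ Y = id`. -/
def quotientSection (x₀ : N) (L : E →L[𝕜] (Fin m → 𝕜)) (z : E × ((Fin m → 𝕜) →L[𝕜] 𝕜)) :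
    CotangentBundle 𝕜 E N :=
  cotangentSymm x₀ (z.1, z.2.comp L)

lemma quotientCoord_snd_apply (Y : E → (Fin m → 𝕜) →L[𝕜] E) (ν : CotangentBundle 𝕜 E N)
    (u : Fin m → 𝕜) : (quotientCoord x₀ Y ν).2 u = momentum (frameField x₀ Y u) ν := rfl

variable (𝕜) in
/-- The covectors with base point in the domain of a frame. -/
def cotangentDomain (x₀ : N) (T : Set E) : Set (CotangentBundle 𝕜 E N) :=
  Bundle.TotalSpace.proj ⁻¹' chartDomain 𝕜 x₀ T

namespace IsFrameInChart

lemma isOpen_cotangentDomain (h : IsFrameInChart x₀ G T (chartTensor x₀ H) L X) :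
    IsOpen (cotangentDomain 𝕜 x₀ T) :=
  isOpen_proj_preimage (isOpen_chartDomain x₀ h.isOpen)

lemma contMDiffOn_quotientCoord (h : IsFrameInChart x₀ G T (chartTensor x₀ H) L X)
    (hH : SmoothTensor11 𝓘(𝕜, E) H) :
    ContMDiffOn (cotangentModel 𝕜 E) 𝓘(𝕜, E × ((Fin m → 𝕜) →L[𝕜] 𝕜)) ∞
      (quotientCoord x₀ (imageFrame x₀ H X)) (cotangentDomain 𝕜 x₀ T) := by
  have h1 : ContDiffOn 𝕜 ∞ (fun z : E × (E →L[𝕜] 𝕜) ↦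
      ((z.1, z.2.comp (imageFrame x₀ H X z.1)) : E × ((Fin m → 𝕜) →L[𝕜] 𝕜))) (Prod.fst ⁻¹' T) :=
    contDiffOn_fst.prodMk (contDiffOn_snd.clm_comp
      ((h.contDiffOn_imageFrame hH).comp contDiffOn_fst fun _ hz ↦ hz))
  exact h1.contMDiffOn.comp ((contMDiffOn_cotangentCoord x₀).mono
    fun ν hν ↦ chartDomain_subset hν) fun ν hν ↦ hν.2

lemma contMDiffOn_quotientSection (h : IsFrameInChart x₀ G T (chartTensor x₀ H) L X) :
    ContMDiffOn 𝓘(𝕜, E × ((Fin m → 𝕜) →L[𝕜] 𝕜)) (cotangentModel 𝕜 E) ∞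
      (quotientSection x₀ L) (Prod.fst ⁻¹' T) := by
  have h1 : ContDiffOn 𝕜 ∞ (fun z : E × ((Fin m → 𝕜) →L[𝕜] 𝕜) ↦
      ((z.1, z.2.comp L) : E × (E →L[𝕜] 𝕜))) (Prod.fst ⁻¹' T) :=
    contDiffOn_fst.prodMk (contDiffOn_snd.clm_comp contDiffOn_const)
  exact (contMDiffOn_cotangentSymm x₀).comp h1.contMDiffOn fun z hz ↦ ⟨h.subset hz, trivial⟩

lemma quotientSection_mem (h : IsFrameInChart x₀ G T (chartTensor x₀ H) L X)
    {z : E × ((Fin m → 𝕜) →L[𝕜] 𝕜)} (hz : z.1 ∈ T) :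
    quotientSection x₀ L z ∈ cotangentDomain 𝕜 x₀ T :=
  symm_mem_chartDomain h.subset hz

lemma quotientCoord_quotientSection (h : IsFrameInChart x₀ G T (chartTensor x₀ H) L X)
    {z : E × ((Fin m → 𝕜) →L[𝕜] 𝕜)} (hz : z.1 ∈ T) :
    quotientCoord x₀ (imageFrame x₀ H X) (quotientSection x₀ L z : CotangentBundle 𝕜 E N) = z := by
  have h1 : cotangentCoord x₀ (quotientSection x₀ L z : CotangentBundle 𝕜 E N) = _ :=
    cotangentCoord_cotangentSymm (h.subset hz)
  rw [quotientCoord, h1]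
  ext1
  · rfl
  · refine ContinuousLinearMap.ext fun u ↦ ?_
    exact congrArg z.2 (h.left_inv_imageFrame hz u)

lemma quotientCoord_eq_iff (h : IsFrameInChart x₀ G T (chartTensor x₀ H) L X)
    {ν ν' : CotangentBundle 𝕜 E N} (hν : ν ∈ cotangentDomain 𝕜 x₀ T)
    (hν' : ν' ∈ cotangentDomain 𝕜 x₀ T) :
    quotientCoord x₀ (imageFrame x₀ H X) ν = quotientCoord x₀ (imageFrame x₀ H X) ν' ↔
      AgreeOnImage H G ν ν' := by
  constructor
  · intro heq
    obtain ⟨x, a⟩ := ν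
    obtain ⟨y, b⟩ := ν'
    obtain rfl : x = y := (extChartAt 𝓘(𝕜, E) x₀).injOn hν.1 hν'.1 (congrArg Prod.fst heq)
    refine ⟨x, a, b, rfl, rfl, fun v hv ↦ ?_⟩
    obtain ⟨u, rfl⟩ := (h.mem_iff_of_mem_chartDomain hν v).1 hv
    have h1 := congrArg (fun z ↦ z.2 u) heq
    simp only [quotientCoord_snd_apply, momentum] at h1
    rwa [apply_frameField (chartDomain_subset hν) u]
  · rintro ⟨x, a, b, rfl, rfl, hab⟩
    refine Prod.ext rfl (ContinuousLinearMap.ext fun u ↦ ?_)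
    have h1 := hab _ (h.frameField_mem u x hν)
    rw [apply_frameField (chartDomain_subset hν) u] at h1
    exact h1

/-- The differential of `quotientCoord`: the covectors that it pulls back. -/
lemma comp_coordDeriv_quotientCoord [FiniteDimensional 𝕜 E]
    (h : IsFrameInChart x₀ G T (chartTensor x₀ H) L X)
    (hH : SmoothTensor11 𝓘(𝕜, E) H) {ν : CotangentBundle 𝕜 E N}
    (hν : ν ∈ cotangentDomain 𝕜 x₀ T) (a : (E × ((Fin m → 𝕜) →L[𝕜] 𝕜)) →L[𝕜] 𝕜) :
    a.comp (coordDeriv (cotangentModel 𝕜 E) (quotientCoord x₀ (imageFrame x₀ H X)) ν) =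
      basicAddMomentum ν ((basePart a).comp (chartDeriv 𝕜 x₀ ν.proj))
        (frameField x₀ (imageFrame x₀ H X) (fiberPart a)) := by
  set Y := imageFrame x₀ H X with hY
  have hΨ : MDifferentiableAt (cotangentModel 𝕜 E) 𝓘(𝕜, E × ((Fin m → 𝕜) →L[𝕜] 𝕜))
      (quotientCoord x₀ Y) ν :=
    ((h.contMDiffOn_quotientCoord hH).contMDiffAt
      (h.isOpen_cotangentDomain.mem_nhds hν)).mdifferentiableAt (by simp)
  have hφ : MDifferentiableAt 𝓘(𝕜, E) 𝓘(𝕜, E) (extChartAt 𝓘(𝕜, E) x₀) ν.proj :=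
    mdifferentiableAt_extChartAt (chartDomain_subset hν)
  have hπ : MDifferentiableAt (cotangentModel 𝕜 E) 𝓘(𝕜, E)
      (Bundle.TotalSpace.proj : CotangentBundle 𝕜 E N → N) ν :=
    (Bundle.contMDiffAt_proj (n := 1) _).mdifferentiableAt (by simp)
  have ha (a : (E × ((Fin m → 𝕜) →L[𝕜] 𝕜)) →L[𝕜] 𝕜) (z) :
      MDifferentiableAt 𝓘(𝕜, E × ((Fin m → 𝕜) →L[𝕜] 𝕜)) 𝓘(𝕜, 𝕜) a z :=
    a.differentiableAt.mdifferentiableAt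
  have hb (b : E →L[𝕜] 𝕜) (z) : MDifferentiableAt 𝓘(𝕜, E) 𝓘(𝕜, 𝕜) b z :=
    b.differentiableAt.mdifferentiableAt
  have hℓ : MDifferentiableAt (cotangentModel 𝕜 E) 𝓘(𝕜, 𝕜)
      (momentum (frameField x₀ Y (fiberPart a))) ν :=
    (contMDiffAt_momentum (isOpen_chartDomain x₀ h.isOpen)
      (smooth_frameField h.isOpen (h.contDiffOn_imageFrame hH) _) hν).mdifferentiableAt (by simp)
  have hsum : a ∘ quotientCoord x₀ Y =
      basePart a ∘ extChartAt 𝓘(𝕜, E) x₀ ∘ (Bundle.TotalSpace.proj : CotangentBundle 𝕜 E N → N)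
        + momentum (frameField x₀ Y (fiberPart a)) := by
    funext ν'
    exact covector_eq a (quotientCoord x₀ Y ν')
  have h1 := mfderiv_comp ν (ha a _) hΨ
  have h2 := mfderiv_comp ν (hb (basePart a) _) (hφ.comp ν hπ)
  have h3 := mfderiv_comp ν hφ hπ
  have h4 := mfderiv_add ((hb (basePart a) _).comp ν (hφ.comp ν hπ)) hℓ
  rw [← hsum, h1, h2, h3] at h4
  have h5 (a : (E × ((Fin m → 𝕜) →L[𝕜] 𝕜)) →L[𝕜] 𝕜) (z) :
      (mfderiv 𝓘(𝕜, E × ((Fin m → 𝕜) →L[𝕜] 𝕜)) 𝓘(𝕜, 𝕜) a z :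
        (E × ((Fin m → 𝕜) →L[𝕜] 𝕜)) →L[𝕜] 𝕜) = a := by
    rw [mfderiv_eq_fderiv]
    exact a.fderiv
  have h6 (b : E →L[𝕜] 𝕜) (z) : (mfderiv 𝓘(𝕜, E) 𝓘(𝕜, 𝕜) b z : E →L[𝕜] 𝕜) = b := by
    rw [mfderiv_eq_fderiv]
    exact b.fderiv
  refine ContinuousLinearMap.ext fun v ↦ ?_
  have h7 := congrArg (fun A : TangentSpace (cotangentModel 𝕜 E) ν →L[𝕜] 𝕜 ↦ A v) h4
  refine Eq.trans ?_ (h7.trans ?_)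
  · exact congrArg (fun A : (E × ((Fin m → 𝕜) →L[𝕜] 𝕜)) →L[𝕜] 𝕜 ↦
      A (coordDeriv (cotangentModel 𝕜 E) (quotientCoord x₀ Y) ν v)) (h5 a _).symm
  · exact congrArg (fun A : E →L[𝕜] 𝕜 ↦
      A (chartDeriv 𝕜 x₀ ν.proj (cotangentProjDeriv ν v)) +
        coordDeriv (cotangentModel 𝕜 E) (momentum (frameField x₀ Y (fiberPart a))) ν v)
        (h6 (basePart a) _)

end IsFrameInChart
end QuotientCoordinates

/-! ### The leaves of the orthogonal foliation -/

section Leaves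

universe u

variable {𝕜 : Type u} [RCLike 𝕜] {E : Type u} [NormedAddCommGroup E] [NormedSpace 𝕜 E]
  {N : Type*} [TopologicalSpace N] [ChartedSpace E N] [IsManifold 𝓘(𝕜, E) ∞ N]
  {H : ∀ x : N, TangentSpace 𝓘(𝕜, E) x →L[𝕜] TangentSpace 𝓘(𝕜, E) x}
  {G : ∀ x : N, Submodule 𝕜 (TangentSpace 𝓘(𝕜, E) x)} {m r : ℕ} {x₀ : N}
  {T : Set E} {L : E →L[𝕜] (Fin m → 𝕜)} {X : E → (Fin m → 𝕜) →L[𝕜] E}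

/-- The coordinates are constant along the orthogonal foliation. -/
lemma IsFrameInChart.coordDeriv_quotientCoord_eq_zero [FiniteDimensional 𝕜 E]
    (h : IsFrameInChart x₀ G T (chartTensor x₀ H) L X)
    (hH : SmoothTensor11 𝓘(𝕜, E) H) {ν : CotangentBundle 𝕜 E N}
    (hν : ν ∈ cotangentDomain 𝕜 x₀ T) {v : TangentSpace (cotangentModel 𝕜 E) ν}
    (hv : v ∈ orthogonalFoliation H G ν) :
    coordDeriv (cotangentModel 𝕜 E) (quotientCoord x₀ (imageFrame x₀ H X)) ν v = 0 := by
  refine SeparatingDual.eq_zero_of_forall_dual_eq_zero (R := 𝕜) fun a ↦ ?_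
  have h1 := congrArg (fun A ↦ A v) (h.comp_coordDeriv_quotientCoord hH hν a)
  refine (show a _ = _ from h1).trans ?_
  have hY := smooth_frameField (x₀ := x₀) h.isOpen (h.contDiffOn_imageFrame hH) (fiberPart a)
  set ξ : TangentSpace 𝓘(𝕜, E) ν.proj →L[𝕜] 𝕜 := (basePart a).comp (chartDeriv 𝕜 x₀ ν.proj)
  have h2 := liouvilleForm_hamiltonianVector ξ (isOpen_chartDomain x₀ h.isOpen) hY hν
  rw [← h2, liouvilleForm_swap, neg_eq_zero]
  refine hv _ ?_
  have h3 : cotangentProjDeriv ν (hamiltonianVector ν ξ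
      (frameField x₀ (imageFrame x₀ H X) (fiberPart a))) =
      - H ν.proj (frameField x₀ X (fiberPart a) ν.proj) := by
    rw [apply_frameField (chartDomain_subset hν)]
    exact cotangentProjDeriv_apply ν _
  rw [h3]
  exact Submodule.neg_mem _ ⟨_, h.frameField_mem _ _ hν, rfl⟩

/-- There is a section of the coordinates through every covector. -/
lemma IsFrameInChart.exists_section (h : IsFrameInChart x₀ G T (chartTensor x₀ H) L X)
    (hH : SmoothTensor11 𝓘(𝕜, E) H) {ν : CotangentBundle 𝕜 E N}
    (hν : ν ∈ cotangentDomain 𝕜 x₀ T) : ∃ s : E × ((Fin m → 𝕜) →L[𝕜] 𝕜) → CotangentBundle 𝕜 E N,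
      ContMDiffOn 𝓘(𝕜, E × ((Fin m → 𝕜) →L[𝕜] 𝕜)) (cotangentModel 𝕜 E) ∞ s (Prod.fst ⁻¹' T) ∧
      (∀ z : E × ((Fin m → 𝕜) →L[𝕜] 𝕜), z.1 ∈ T → s z ∈ cotangentDomain 𝕜 x₀ T) ∧
      (∀ z : E × ((Fin m → 𝕜) →L[𝕜] 𝕜), z.1 ∈ T → quotientCoord x₀ (imageFrame x₀ H X) (s z) = z) ∧
      s (quotientCoord x₀ (imageFrame x₀ H X) ν) = ν := by
  set Y := imageFrame x₀ H X with hY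
  set p := (cotangentCoord x₀ ν).2 with hp
  let f : E × ((Fin m → 𝕜) →L[𝕜] 𝕜) → E × (E →L[𝕜] 𝕜) :=
    fun z ↦ (z.1, p + (z.2 - p.comp (Y z.1)).comp L)
  have hf : ContDiffOn 𝕜 ∞ f (Prod.fst ⁻¹' T) :=
    contDiffOn_fst.prodMk (contDiffOn_const.add ((contDiffOn_snd.sub
      (contDiffOn_const.clm_comp ((h.contDiffOn_imageFrame hH).comp contDiffOn_fst
        fun _ hz ↦ hz))).clm_comp contDiffOn_const))
  refine ⟨cotangentSymm x₀ ∘ f, (contMDiffOn_cotangentSymm x₀).comp hf.contMDiffOn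
    fun z hz ↦ ⟨h.subset hz, trivial⟩,
    fun z hz ↦ symm_mem_chartDomain h.subset hz, fun z hz ↦ ?_, ?_⟩
  · have h1 : cotangentCoord x₀ (cotangentSymm x₀ (f z) : CotangentBundle 𝕜 E N) = f z :=
      cotangentCoord_cotangentSymm (h.subset hz)
    rw [Function.comp_apply, quotientCoord, h1]
    refine Prod.ext rfl (ContinuousLinearMap.ext fun u ↦ ?_)
    have h2 : p (Y z.1 u) + (z.2 (L (Y z.1 u)) - p (Y z.1 (L (Y z.1 u)))) = z.2 u := by
      rw [h.left_inv_imageFrame hz]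
      ring
    exact h2
  · have h1 : f (quotientCoord x₀ Y ν) = cotangentCoord x₀ ν := by
      refine Prod.ext rfl ?_
      change p + (p.comp (Y (cotangentCoord x₀ ν).1) - p.comp (Y (cotangentCoord x₀ ν).1)).comp L = p
      rw [sub_self, ContinuousLinearMap.zero_comp, add_zero]
    rw [Function.comp_apply, h1, cotangentSymm_cotangentCoord (chartDomain_subset hν)]

/-- Along a curve that is tangent to the orthogonal foliation, the base point and the restriction
to `H G` do not change. -/
lemma agreeOnImage_of_joinedByTangentCurve [FiniteDimensional 𝕜 E]
    (hframe : ∀ x₀ : N, ∃ (T : Set E) (L : E →L[𝕜] (Fin m → 𝕜)) (X : E → (Fin m → 𝕜) →L[𝕜] E),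
      IsFrameInChart x₀ G T (chartTensor x₀ H) L X)
    (hH : SmoothTensor11 𝓘(𝕜, E) H) {ν ν' : CotangentBundle 𝕜 E N}
    (hj : JoinedByTangentCurve (cotangentModel 𝕜 E) (orthogonalFoliation H G) ν ν') :
    AgreeOnImage H G ν ν' := by
  obtain ⟨U, γ, hU, hconn, hγ, htan, a, ha, b, hb, rfl, rfl⟩ := hj
  refine hconn.induction₂ (fun s t ↦ AgreeOnImage H G (γ s) (γ t)) (fun t ht ↦ ?_)
    (fun _ _ _ _ _ _ h h' ↦ h.trans h') (fun _ _ _ _ h ↦ h.symm) ha hb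
  obtain ⟨T, L, X, h⟩ := hframe (γ t).proj
  set Y := imageFrame (γ t).proj H X with hY
  set D := cotangentDomain 𝕜 (γ t).proj T with hD
  have htD : γ t ∈ D := h.mem_chartDomain
  have hO : IsOpen (U ∩ γ ⁻¹' D) :=
    hγ.continuousOn.isOpen_inter_preimage hU h.isOpen_cotangentDomain
  have hΨ : ContMDiffOn 𝓘(𝕜, 𝕜) 𝓘(𝕜, E × ((Fin m → 𝕜) →L[𝕜] 𝕜)) ∞
      (quotientCoord (γ t).proj Y ∘ γ) (U ∩ γ ⁻¹' D) :=
    (h.contMDiffOn_quotientCoord hH).comp (hγ.mono Set.inter_subset_left) fun _ hs ↦ hs.2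
  have hd : (U ∩ γ ⁻¹' D).EqOn (fderiv 𝕜 (quotientCoord (γ t).proj Y ∘ γ)) 0 := by
    intro s hs
    have h1 : MDifferentiableAt (cotangentModel 𝕜 E) 𝓘(𝕜, E × ((Fin m → 𝕜) →L[𝕜] 𝕜))
        (quotientCoord (γ t).proj Y) (γ s) :=
      ((h.contMDiffOn_quotientCoord hH).contMDiffAt
        (h.isOpen_cotangentDomain.mem_nhds hs.2)).mdifferentiableAt (by simp)
    have h2 : MDifferentiableAt 𝓘(𝕜, 𝕜) (cotangentModel 𝕜 E) γ s :=
      (hγ.contMDiffAt (hU.mem_nhds hs.1)).mdifferentiableAt (by simp)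
    have h3 := mfderiv_comp_apply s h1 h2 (1 : 𝕜)
    have h4 := h.coordDeriv_quotientCoord_eq_zero hH hs.2 (htan s hs.1)
    rw [mfderiv_eq_fderiv] at h3
    have h5 : fderiv 𝕜 (quotientCoord (γ t).proj Y ∘ γ) s 1 = 0 := h3.trans h4
    exact ContinuousLinearMap.ext_ring h5
  have h6 := hO.isOpen_inter_preimage_of_fderiv_eq_zero
    (hΨ.contDiffOn.differentiableOn (by simp)) hd {quotientCoord (γ t).proj Y (γ t)}
  refine mem_nhdsWithin_of_mem_nhds ?_
  filter_upwards [h6.mem_nhds ⟨⟨ht, htD⟩, rfl⟩] with s hs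
  exact (h.quotientCoord_eq_iff htD hs.1.2).1 hs.2.symm

/-- A vector that is vertical and annihilates the momenta of the vectors in `H G` is tangent to the
orthogonal foliation. -/
lemma mem_orthogonalFoliation {ν : CotangentBundle 𝕜 E N}
    {v : TangentSpace (cotangentModel 𝕜 E) ν} (h0 : cotangentProjDeriv ν v = 0)
    (h1 : ∀ w ∈ (G ν.proj).map (H ν.proj).toLinearMap, coordDeriv (cotangentModel 𝕜 E)
      (momentum (frameField ν.proj (fun _ ↦ ContinuousLinearMap.id 𝕜 E) w)) ν v = 0) :
    v ∈ orthogonalFoliation H G ν := by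
  intro w hw
  have h2 := h1 _ hw
  have hν : ν.proj ∈ chartDomain 𝕜 ν.proj (extChartAt 𝓘(𝕜, E) ν.proj).target :=
    ⟨mem_extChartAt_source _, mem_extChartAt_target _⟩
  let v' : E × (E →L[𝕜] 𝕜) := v
  let w' : E × (E →L[𝕜] 𝕜) := w
  have hv1 : v'.1 = 0 := (cotangentProjDeriv_apply ν v').symm.trans h0
  have hw1 : cotangentProjDeriv ν w = w'.1 := cotangentProjDeriv_apply ν w'
  have h3 := coordDeriv_momentum (isOpen_chartDomain ν.proj (isOpen_extChartAt_target _))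
    (smooth_frameField (isOpen_extChartAt_target ν.proj)
    (contDiffOn_const (c := ContinuousLinearMap.id 𝕜 E)) (cotangentProjDeriv ν w)) hν v'
  have h4 : frameField ν.proj (fun _ ↦ ContinuousLinearMap.id 𝕜 E) (cotangentProjDeriv ν w) ν.proj =
      w'.1 := (chartDerivSymm_self ν.proj _).trans hw1
  rw [hv1, map_zero] at h3
  have h5 : v'.2 w'.1 = 0 := by
    have h6 := h3.symm.trans h2
    rw [h4] at h6
    have h7 : (ν.snd : E →L[𝕜] 𝕜) 0 = 0 := map_zero (ν.snd : E →L[𝕜] 𝕜)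
    exact (add_zero _).symm.trans ((congrArg (v'.2 w'.1 + ·) h7).symm.trans h6)
  refine (liouvilleForm_apply ν v' w').trans ?_
  rw [h5, hv1, map_zero, sub_zero]

/-- Two covectors that agree on `H G` are joined by a line, which is tangent to the orthogonal
foliation. -/
lemma AgreeOnImage.joinedByTangentCurve {ν ν' : CotangentBundle 𝕜 E N}
    (h : AgreeOnImage H G ν ν') :
    JoinedByTangentCurve (cotangentModel 𝕜 E) (orthogonalFoliation H G) ν ν' := by
  obtain ⟨x, a, b, rfl, rfl, hab⟩ := h
  set p := (cotangentCoord x (⟨x, a⟩ : CotangentBundle 𝕜 E N)).2 with hp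
  set p' := (cotangentCoord x (⟨x, b⟩ : CotangentBundle 𝕜 E N)).2 with hp'
  set q := extChartAt 𝓘(𝕜, E) x x with hq
  have hqt : q ∈ (extChartAt 𝓘(𝕜, E) x).target := mem_extChartAt_target x
  let c : 𝕜 → E × (E →L[𝕜] 𝕜) := fun t ↦ (q, p + t • (p' - p))
  let γ : 𝕜 → CotangentBundle 𝕜 E N := fun t ↦ cotangentSymm x (c t)
  have hc : ContDiff 𝕜 ∞ c :=
    contDiff_const.prodMk (contDiff_const.add (contDiff_id.smul contDiff_const))
  have hγ : ContMDiff 𝓘(𝕜, 𝕜) (cotangentModel 𝕜 E) ∞ γ := by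
    rw [← contMDiffOn_univ]
    exact (contMDiffOn_cotangentSymm x).comp hc.contMDiff.contMDiffOn fun t _ ↦ ⟨hqt, trivial⟩
  have hagree : ∀ y : N, y = x → ∀ v ∈ G y, (p' - p) (chartDeriv 𝕜 x y (H y v)) = 0 := by
    intro y hy v hv
    subst hy
    have h1 (a : TangentSpace 𝓘(𝕜, E) y →L[𝕜] 𝕜) :
        (cotangentCoord y (⟨y, a⟩ : CotangentBundle 𝕜 E N)).2 (chartDeriv 𝕜 y y (H y v)) =
          a (H y v) := congrArg a (chartDerivSymm_apply (mem_chart_source E y) _)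
    rw [sub_apply, hp, hp', h1, h1, hab v hv, sub_self]
  refine ⟨Set.univ, γ, isOpen_univ, isPreconnected_univ, hγ.contMDiffOn, fun t _ ↦ ?_,
    0, trivial, 1, trivial, ?_, ?_⟩
  · have hγt : MDifferentiableAt 𝓘(𝕜, 𝕜) (cotangentModel 𝕜 E) γ t :=
      hγ.mdifferentiableAt (by simp)
    refine mem_orthogonalFoliation ?_ fun w hw ↦ ?_
    · have h1 : MDifferentiableAt (cotangentModel 𝕜 E) 𝓘(𝕜, E)
          (Bundle.TotalSpace.proj : CotangentBundle 𝕜 E N → N) (γ t) :=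
        (Bundle.contMDiffAt_proj (n := 1) _).mdifferentiableAt (by simp)
      have h2 := mfderiv_comp_apply t h1 hγt (1 : 𝕜)
      have h3 : (Bundle.TotalSpace.proj : CotangentBundle 𝕜 E N → N) ∘ γ =
        fun _ ↦ (extChartAt 𝓘(𝕜, E) x).symm q := rfl
      rw [h3, mfderiv_const] at h2
      exact h2.symm
    · set Z : ∀ y : N, TangentSpace 𝓘(𝕜, E) y :=
        frameField (W := E) (γ t).proj (fun _ ↦ ContinuousLinearMap.id 𝕜 E) w with hZ
      have hγν : (γ t).proj ∈ chartDomain 𝕜 (γ t).proj (extChartAt 𝓘(𝕜, E) (γ t).proj).target :=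
        ⟨mem_extChartAt_source _, mem_extChartAt_target _⟩
      have h1 : MDifferentiableAt (cotangentModel 𝕜 E) 𝓘(𝕜, 𝕜) (momentum Z) (γ t) :=
        (contMDiffAt_momentum (isOpen_chartDomain _ (isOpen_extChartAt_target _))
          (smooth_frameField (W := E) (isOpen_extChartAt_target (γ t).proj)
            (contDiffOn_const (c := ContinuousLinearMap.id 𝕜 E)) w)
          hγν).mdifferentiableAt (by simp)
      have h2 := mfderiv_comp_apply t h1 hγt (1 : 𝕜)
      set y := (extChartAt 𝓘(𝕜, E) x).symm q with hy
      have hZw : Z y = w := chartDerivSymm_self (𝕜 := 𝕜) (E := E) y w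
      have h3 : momentum Z ∘ γ = fun _ ↦ p (chartDeriv 𝕜 x y w) := by
        funext s
        have h4 : momentum Z (γ s) = (p + s • (p' - p)) (chartDeriv 𝕜 x y (Z y)) := rfl
        obtain ⟨g, hg, rfl⟩ := hw
        have h5 := hagree y (extChartAt_to_inv x) g hg
        rw [Function.comp_apply, h4, hZw, add_apply, smul_apply]
        change _ + s • (p' - p) (chartDeriv 𝕜 x y (H y g)) = _
        rw [h5, smul_zero, add_zero]
      rw [h3, mfderiv_const] at h2
      exact h2.symm
  · change cotangentSymm x (q, p + (0 : 𝕜) • (p' - p)) = _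
    rw [zero_smul, add_zero]
    exact cotangentSymm_cotangentCoord (μ := ⟨x, a⟩) (mem_chart_source E x)
  · change cotangentSymm x (q, p + (1 : 𝕜) • (p' - p)) = _
    rw [one_smul, add_sub_cancel]
    exact cotangentSymm_cotangentCoord (μ := ⟨x, b⟩) (mem_chart_source E x)

/-- The leaves of the orthogonal foliation are the sets of covectors at a point with a given
restriction to `H G`. -/
theorem leafSetoid_iff [FiniteDimensional 𝕜 E]
    (hframe : ∀ x₀ : N, ∃ (T : Set E) (L : E →L[𝕜] (Fin m → 𝕜)) (X : E → (Fin m → 𝕜) →L[𝕜] E),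
      IsFrameInChart x₀ G T (chartTensor x₀ H) L X)
    (hH : SmoothTensor11 𝓘(𝕜, E) H) (ν ν' : CotangentBundle 𝕜 E N) :
    leafSetoid (cotangentModel 𝕜 E) (orthogonalFoliation H G) ν ν' ↔ AgreeOnImage H G ν ν' := by
  constructor
  · intro h
    have h' : Relation.EqvGen (JoinedByTangentCurve _ (orthogonalFoliation H G)) ν ν' := h
    clear h
    induction h' with
    | rel _ _ h => exact agreeOnImage_of_joinedByTangentCurve hframe hH h
    | refl _ => exact AgreeOnImage.refl _
    | symm _ _ _ ih => exact ih.symm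
    | trans _ _ _ _ _ ih ih' => exact ih.trans ih'
  · exact fun h ↦ Relation.EqvGen.rel _ _ h.joinedByTangentCurve

end Leaves

/-! ### Quotients of manifolds with charts that separate the classes -/

section QuotientManifold

variable {𝕜 : Type*} [RCLike 𝕜] {F : Type*} [NormedAddCommGroup F] [NormedSpace 𝕜 F]
  {K : Type*} [TopologicalSpace K] {I : ModelWithCorners 𝕜 F K}
  {P : Type*} [TopologicalSpace P] [ChartedSpace K P] [IsManifold I ∞ P]
  {V : Type*} [NormedAddCommGroup V] [NormedSpace 𝕜 V]
  {E' : Type*} [NormedAddCommGroup E'] [NormedSpace 𝕜 E']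
  {s : Setoid P} {ι : Type*}

variable (I s) in
/-- On the open saturated set `D` the classes of `s` are the fibres of the smooth map `Ψ`, which
maps `D` onto the open subset `Ω` of `V` and has the smooth section `σ`. -/
structure IsQuotientCoordinates (D : Set P) (Ω : Set V) (Ψ : P → V) (σ : V → P) : Prop where
  isOpen_source : IsOpen D
  isOpen_target : IsOpen Ω
  saturated : ∀ p p', s p p' → p ∈ D → p' ∈ D
  mapsTo : ∀ p ∈ D, Ψ p ∈ Ω
  mapsTo_symm : ∀ z ∈ Ω, σ z ∈ D
  right_inv : ∀ z ∈ Ω, Ψ (σ z) = z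
  eq_iff : ∀ p ∈ D, ∀ p' ∈ D, Ψ p = Ψ p' ↔ s p p'
  contMDiffOn : ContMDiffOn I 𝓘(𝕜, V) ∞ Ψ D
  contMDiffOn_symm : ContMDiffOn 𝓘(𝕜, V) I ∞ σ Ω

namespace IsQuotientCoordinates

variable {D : Set P} {Ω : Set V} {Ψ : P → V} {σ : V → P}

lemma out_mem (h : IsQuotientCoordinates I s D Ω Ψ σ) {p : P} (hp : p ∈ D) :
    (Quotient.mk s p).out ∈ D :=
  h.saturated _ _ (Setoid.symm (Quotient.mk_out p)) hp

lemma out_mem_iff (h : IsQuotientCoordinates I s D Ω Ψ σ) {p : P} :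
    (Quotient.mk s p).out ∈ D ↔ p ∈ D :=
  ⟨h.saturated _ _ (Quotient.mk_out p), h.out_mem⟩

lemma apply_out (h : IsQuotientCoordinates I s D Ω Ψ σ) {p : P} (hp : p ∈ D) :
    Ψ (Quotient.mk s p).out = Ψ p :=
  (h.eq_iff _ (h.out_mem hp) _ hp).2 (Quotient.mk_out p)

lemma mk_symm_apply (h : IsQuotientCoordinates I s D Ω Ψ σ) {p : P} (hp : p ∈ D) :
    Quotient.mk s (σ (Ψ p)) = Quotient.mk s p :=
  Quotient.sound ((h.eq_iff _ (h.mapsTo_symm _ (h.mapsTo p hp)) _ hp).1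
    (h.right_inv _ (h.mapsTo p hp)))

/-- The chart of the quotient that is induced by `Ψ`. -/
def chart (h : IsQuotientCoordinates I s D Ω Ψ σ) : OpenPartialHomeomorph (Quotient s) V where
  toFun x := Ψ x.out
  invFun z := Quotient.mk s (σ z)
  source := {x | x.out ∈ D}
  target := Ω
  map_source' x hx := h.mapsTo _ hx
  map_target' z hz := h.out_mem (h.mapsTo_symm z hz)
  left_inv' x hx := (h.mk_symm_apply hx).trans x.out_eq
  right_inv' z hz := (h.apply_out (h.mapsTo_symm z hz)).trans (h.right_inv z hz)
  open_source := by
    refine isOpen_coinduced.2 ?_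
    convert h.isOpen_source using 1
    exact Set.ext fun p ↦ h.out_mem_iff
  open_target := h.isOpen_target
  continuousOn_toFun := by
    have h1 : Quotient.mk s ⁻¹' {x | x.out ∈ D} = D := Set.ext fun p ↦ h.out_mem_iff
    rw [isQuotientMap_quotient_mk'.continuousOn_isOpen_iff
      (isOpen_coinduced.2 (h1.symm ▸ h.isOpen_source))]
    change ContinuousOn _ (Quotient.mk s ⁻¹' _)
    rw [h1]
    exact h.contMDiffOn.continuousOn.congr fun p hp ↦ h.apply_out hp
  continuousOn_invFun := continuous_quotient_mk'.comp_continuousOn h.contMDiffOn_symm.continuousOn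

end IsQuotientCoordinates

/-- A quotient that is covered by coordinates separating the classes is a manifold, and these
coordinates are coordinates on it. -/
theorem exists_chartedSpace_quotient {D : ι → Set P} {Ω : ι → Set V} {Ψ : ι → P → V}
    {σ : ι → V → P} (h : ∀ i, IsQuotientCoordinates I s (D i) (Ω i) (Ψ i) (σ i))
    (hcover : ∀ p, ∃ i, p ∈ D i) (e : V ≃L[𝕜] E') :
    ∃ _ : ChartedSpace E' (Quotient s), IsManifold 𝓘(𝕜, E') ∞ (Quotient s) ∧
      ∀ i, IsCoordinates (𝕜 := 𝕜) (E := E') {x : Quotient s | x.out ∈ D i} (Ω i)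
        (fun x ↦ Ψ i x.out) (fun z ↦ Quotient.mk s (σ i z)) := by
  choose c hc using hcover
  let ch (i : ι) : OpenPartialHomeomorph (Quotient s) E' :=
    (h i).chart.transHomeomorph e.toHomeomorph
  let C : ChartedSpace E' (Quotient s) :=
    { atlas := Set.range ch
      chartAt := fun x ↦ ch (c x.out)
      mem_chart_source := fun x ↦ hc x.out
      chart_mem_atlas := fun x ↦ ⟨_, rfl⟩ }
  have hM : IsManifold 𝓘(𝕜, E') ∞ (Quotient s) := by
    refine isManifold_of_contDiffOn _ _ _ ?_
    rintro _ _ ⟨i, rfl⟩ ⟨j, rfl⟩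
    have h1 : ContDiffOn 𝕜 ∞ (Ψ j ∘ σ i) (Ω i ∩ σ i ⁻¹' D j) :=
      (((h j).contMDiffOn.comp ((h i).contMDiffOn_symm.mono Set.inter_subset_left)
        fun z hz ↦ hz.2)).contDiffOn
    have h2 : ContDiffOn 𝕜 ∞ (e ∘ (Ψ j ∘ σ i) ∘ e.symm) (e.symm ⁻¹' (Ω i ∩ σ i ⁻¹' D j)) :=
      e.contDiff.comp_contDiffOn (h1.comp e.symm.contDiff.contDiffOn fun z hz ↦ hz)
    have h3 : ∀ y ∈ ((ch i).symm.trans (ch j)).source,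
        e.symm y ∈ Ω i ∩ σ i ⁻¹' D j := fun y hy ↦ by
      have h4 : y ∈ (ch i).target ∧ (ch i).symm y ∈ (ch j).source := by
        rw [OpenPartialHomeomorph.trans_source] at hy
        exact hy
      exact ⟨h4.1, (h j).out_mem_iff.1 h4.2⟩
    refine (h2.mono fun y hy ↦ h3 y hy.1).congr fun y hy ↦ ?_
    exact congrArg e ((h j).apply_out (h3 y hy.1).2)
  refine ⟨C, hM, fun i ↦ ?_⟩
  have hi : ch i ∈ IsManifold.maximalAtlas 𝓘(𝕜, E') ∞ (Quotient s) :=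
    IsManifold.subset_maximalAtlas ⟨i, rfl⟩
  have h1 := contMDiffOn_of_mem_maximalAtlas hi
  have h2 := contMDiffOn_symm_of_mem_maximalAtlas hi
  refine ⟨(h i).chart.open_source, (h i).isOpen_target, (h i).chart.map_source',
    (h i).chart.map_target', (h i).chart.left_inv', (h i).chart.right_inv', ?_, ?_⟩
  · refine ((e.symm.contDiff.contMDiff.comp_contMDiffOn h1).congr fun x _ ↦ ?_)
    exact (e.symm_apply_apply _).symm
  · refine (h2.comp e.contDiff.contMDiff.contMDiffOn fun z (hz : z ∈ Ω i) ↦ ?_).congr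
      fun z _ ↦ ?_
    · change e.symm (e z) ∈ Ω i
      rwa [e.symm_apply_apply]
    · change _ = Quotient.mk s (σ i (e.symm (e z)))
      rw [e.symm_apply_apply]

/-- Classes over different points of a Hausdorff space `B` are separated there, and classes over the
same point lie in a common chart. -/
theorem t2Space_quotient {D : ι → Set P} {Ω : ι → Set V} {Ψ : ι → P → V}
    {σ : ι → V → P} (h : ∀ i, IsQuotientCoordinates I s (D i) (Ω i) (Ψ i) (σ i))
    {B : Type*} [TopologicalSpace B] [T2Space B] {b : P → B} (hb : Continuous b)
    (hbs : ∀ p p', s p p' → b p = b p')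
    (hcover : ∀ p p', b p = b p' → ∃ i, p ∈ D i ∧ p' ∈ D i) : T2Space (Quotient s) := by
  have hlift : Continuous (Quotient.lift b hbs) := hb.quotient_lift hbs
  refine ⟨fun x y hxy ↦ ?_⟩
  by_cases hxy' : Quotient.lift b hbs x = Quotient.lift b hbs y
  · have h0 : b x.out = b y.out := by
      rw [← x.out_eq, ← y.out_eq] at hxy'
      exact hxy'
    obtain ⟨i, hx, hy⟩ := hcover _ _ h0
    set f := (h i).chart
    have hne : f x ≠ f y := fun heq ↦ hxy (f.injOn hx hy heq)
    obtain ⟨u, v, hu, hv, hxu, hyv, huv⟩ := t2_separation hne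
    exact ⟨f.source ∩ f ⁻¹' u, f.source ∩ f ⁻¹' v, f.isOpen_inter_preimage hu,
      f.isOpen_inter_preimage hv, ⟨hx, hxu⟩, ⟨hy, hyv⟩,
      (huv.preimage f).mono Set.inter_subset_right Set.inter_subset_right⟩
  · obtain ⟨u, v, hu, hv, hxu, hyv, huv⟩ := t2_separation hxy'
    exact ⟨_, _, hu.preimage hlift, hv.preimage hlift, hxu, hyv, huv.preimage _⟩

theorem secondCountableTopology_quotient [SecondCountableTopology V] [Countable ι] {D : ι → Set P}
    {Ω : ι → Set V} {Ψ : ι → P → V} {σ : ι → V → P}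
    (h : ∀ i, IsQuotientCoordinates I s (D i) (Ω i) (Ψ i) (σ i)) (hcover : ∀ p, ∃ i, p ∈ D i) :
    SecondCountableTopology (Quotient s) := by
  have (i : ι) : SecondCountableTopology (h i).chart.source :=
    (h i).chart.secondCountableTopology_source
  refine TopologicalSpace.secondCountableTopology_of_countable_cover
    (U := fun i ↦ (h i).chart.source) (fun i ↦ (h i).chart.open_source) ?_
  exact Set.eq_univ_of_forall fun x ↦ Set.mem_iUnion.2 (hcover x.out)

section Projection

variable {D : Set P} {Ω : Set V} {Ψ : P → V} {σ : V → P} [ChartedSpace E' (Quotient s)]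

namespace IsQuotientCoordinates

lemma contMDiffOn_mk (h : IsQuotientCoordinates I s D Ω Ψ σ)
    (h' : IsCoordinates (𝕜 := 𝕜) (E := E') {x : Quotient s | x.out ∈ D} Ω
        (fun x ↦ Ψ x.out) (fun z ↦ Quotient.mk s (σ z))) :
    ContMDiffOn I 𝓘(𝕜, E') ∞ (Quotient.mk s) D :=
  (h'.contMDiffOn_symm.comp h.contMDiffOn h.mapsTo).congr fun _ hp ↦ (h.mk_symm_apply hp).symm

lemma mdifferentiableAt (h : IsQuotientCoordinates I s D Ω Ψ σ)
    (h' : IsCoordinates (𝕜 := 𝕜) (E := E') {x : Quotient s | x.out ∈ D} Ω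
        (fun x ↦ Ψ x.out) (fun z ↦ Quotient.mk s (σ z))) {p : P} (hp : p ∈ D) :
    MDifferentiableAt I 𝓘(𝕜, E') (Quotient.mk s) p :=
  ((h.contMDiffOn_mk h').contMDiffAt (h.isOpen_source.mem_nhds hp)).mdifferentiableAt (by simp)

/-- A section of `Ψ` through `p` makes the differential of the projection at `p` surjective. -/
lemma surjective_mfderiv_mk (h : IsQuotientCoordinates I s D Ω Ψ σ)
    (h' : IsCoordinates (𝕜 := 𝕜) (E := E') {x : Quotient s | x.out ∈ D} Ω
        (fun x ↦ Ψ x.out) (fun z ↦ Quotient.mk s (σ z))) {p : P} (hp : p ∈ D)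
    {τ : V → P} (hτ : ContMDiffOn 𝓘(𝕜, V) I ∞ τ Ω) (hτD : ∀ z ∈ Ω, τ z ∈ D)
    (hτΨ : ∀ z ∈ Ω, Ψ (τ z) = z) (hτp : τ (Ψ p) = p) :
    Function.Surjective (mfderiv I 𝓘(𝕜, E') (Quotient.mk s) p) := by
  set ψ : Quotient s → V := fun x ↦ Ψ x.out with hψ
  have hx : (Quotient.mk s p) ∈ {x : Quotient s | x.out ∈ D} := h.out_mem hp
  have hψp : ψ (Quotient.mk s p) = Ψ p := h.apply_out hp
  have h1 : Quotient.mk s ∘ τ ∘ ψ =ᶠ[𝓝 (Quotient.mk s p)] id := by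
    filter_upwards [h'.isOpen_source.mem_nhds hx] with x hx
    have hz : ψ x ∈ Ω := h.mapsTo _ hx
    exact (Quotient.sound ((h.eq_iff _ (hτD _ hz) _ hx).1 (hτΨ _ hz))).trans x.out_eq
  have h2 : MDifferentiableAt 𝓘(𝕜, V) I τ (ψ (Quotient.mk s p)) :=
    (hτ.contMDiffAt (h.isOpen_target.mem_nhds (hψp ▸ h.mapsTo p hp))).mdifferentiableAt (by simp)
  have h3 : MDifferentiableAt 𝓘(𝕜, E') I (τ ∘ ψ) (Quotient.mk s p) :=
    h2.comp _ (h'.mdifferentiableAt hx)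
  have h4 : (τ ∘ ψ) (Quotient.mk s p) = p := (congrArg τ hψp).trans hτp
  intro v
  have h5 : MDifferentiableAt I 𝓘(𝕜, E') (Quotient.mk s) ((τ ∘ ψ) (Quotient.mk s p)) := by
    rw [h4]
    exact h.mdifferentiableAt h' hp
  have h6 := mfderiv_comp_apply (Quotient.mk s p) h5 h3 (show E' from v)
  rw [h1.mfderiv_eq, h4] at h6
  refine ⟨mfderiv 𝓘(𝕜, E') I (τ ∘ ψ) (Quotient.mk s p) v, ?_⟩
  refine h6.symm.trans ?_
  rw [mfderiv_id]
  rfl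

/-- The chain rule for `Ψ`, which factors through the quotient. -/
lemma coordDeriv_eq (h : IsQuotientCoordinates I s D Ω Ψ σ)
    (h' : IsCoordinates (𝕜 := 𝕜) (E := E') {x : Quotient s | x.out ∈ D} Ω
        (fun x ↦ Ψ x.out) (fun z ↦ Quotient.mk s (σ z))) {p : P} (hp : p ∈ D) :
    coordDeriv I Ψ p = (coordDeriv 𝓘(𝕜, E') (fun x : Quotient s ↦ Ψ x.out) (Quotient.mk s p)).comp
      (mfderiv I 𝓘(𝕜, E') (Quotient.mk s) p) := by
  have h1 : Ψ =ᶠ[𝓝 p] (fun x : Quotient s ↦ Ψ x.out) ∘ Quotient.mk s := by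
    filter_upwards [h.isOpen_source.mem_nhds hp] with q hq
    exact (h.apply_out hq).symm
  have h2 := mfderiv_comp p (h'.mdifferentiableAt (x := Quotient.mk s p) (h.out_mem hp))
    (h.mdifferentiableAt h' hp)
  refine Eq.trans ?_ h2
  exact h1.mfderiv_eq

end IsQuotientCoordinates
end Projection

section Bivector

variable [ChartedSpace E' (Quotient s)]

variable (I E') in
/-- The bivector field on the quotient whose value at a class is the image of the value of `Λ` at
a representative of this class. -/
def quotientBivector (s : Setoid P) [ChartedSpace E' (Quotient s)] (Λ : BivectorField I (P := P)) :
    BivectorField 𝓘(𝕜, E') (P := Quotient s) := fun x ↦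
  let A : F →L[𝕜] E' := mfderiv I 𝓘(𝕜, E') (Quotient.mk s) x.out
  LinearMap.mk₂ 𝕜 (fun a b : E' →L[𝕜] 𝕜 ↦ Λ x.out (a.comp A) (b.comp A))
    (fun a a' b ↦ (congrArg (Λ x.out · (b.comp A)) (ContinuousLinearMap.add_comp a a' A)).trans
      (LinearMap.map_add₂ (Λ x.out) (a.comp A) (a'.comp A) (b.comp A)))
    (fun c a b ↦ (congrArg (Λ x.out · (b.comp A)) (ContinuousLinearMap.smul_comp c a A)).trans
      (LinearMap.map_smul₂ (Λ x.out) c (a.comp A) (b.comp A)))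
    (fun a b b' ↦ (congrArg (Λ x.out (a.comp A)) (ContinuousLinearMap.add_comp b b' A)).trans
      (map_add (Λ x.out (a.comp A)) (b.comp A) (b'.comp A)))
    (fun c a b ↦ (congrArg (Λ x.out (a.comp A)) (ContinuousLinearMap.smul_comp c b A)).trans
      (map_smul (Λ x.out (a.comp A)) c (b.comp A)))

/-- If the values of `Λ` on the differentials of the coordinates are functions of the coordinates,
then so are those of the bivector field on the quotient. -/
lemma quotientBivector_apply {Λ : BivectorField I (P := P)}
    {D : Set P} {Ω : Set V} {Ψ : P → V} {σ : V → P}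
    (h : IsQuotientCoordinates I s D Ω Ψ σ)
    (h' : IsCoordinates (𝕜 := 𝕜) (E := E') {x : Quotient s | x.out ∈ D} Ω
        (fun x ↦ Ψ x.out) (fun z ↦ Quotient.mk s (σ z)))
    {B : V → (V →L[𝕜] 𝕜) →L[𝕜] V}
    (hB : ∀ p ∈ D, ∀ a b : V →L[𝕜] 𝕜,
      Λ p (a.comp (coordDeriv I Ψ p)) (b.comp (coordDeriv I Ψ p)) = a (B (Ψ p) b))
    {x : Quotient s} (hx : x.out ∈ D) (a b : V →L[𝕜] 𝕜) :
    quotientBivector I E' s Λ x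
      (a.comp (coordDeriv 𝓘(𝕜, E') (fun x : Quotient s ↦ Ψ x.out) x))
      (b.comp (coordDeriv 𝓘(𝕜, E') (fun x : Quotient s ↦ Ψ x.out) x)) = a (B (Ψ x.out) b) := by
  rw [← hB _ hx, h.coordDeriv_eq h' hx]
  have h1 : ∀ y, y = x →
      (coordDeriv 𝓘(𝕜, E') (fun x : Quotient s ↦ Ψ x.out) y : E' →L[𝕜] V) =
      coordDeriv 𝓘(𝕜, E') (fun x : Quotient s ↦ Ψ x.out) x := by
    rintro _ rfl
    rfl
  have h2 := h1 _ x.out_eq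
  exact congrArg (fun C : E' →L[𝕜] V ↦
    Λ x.out (a.comp (C.comp (show F →L[𝕜] E' from mfderiv I 𝓘(𝕜, E') (Quotient.mk s) x.out)))
      (b.comp (C.comp (show F →L[𝕜] E' from mfderiv I 𝓘(𝕜, E') (Quotient.mk s) x.out)))) h2.symm

lemma projectsTo_quotientBivector {Λ : BivectorField I (P := P)}
    (hloc : ∀ p, ∃ (D : Set P) (Ω : Set V) (Ψ : P → V) (σ : V → P) (B : V → (V →L[𝕜] 𝕜) →L[𝕜] V),
      p ∈ D ∧ IsQuotientCoordinates I s D Ω Ψ σ ∧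
      IsCoordinates (𝕜 := 𝕜) (E := E') {x : Quotient s | x.out ∈ D} Ω
        (fun x ↦ Ψ x.out) (fun z ↦ Quotient.mk s (σ z)) ∧
      ∀ p ∈ D, ∀ a b : V →L[𝕜] 𝕜,
        Λ p (a.comp (coordDeriv I Ψ p)) (b.comp (coordDeriv I Ψ p)) = a (B (Ψ p) b)) :
    ProjectsTo I 𝓘(𝕜, E') (Quotient.mk s) Λ (quotientBivector I E' s Λ) := by
  intro p a b
  obtain ⟨D, Ω, Ψ, σ, B, hp, h, h', hB⟩ := hloc p
  have hx : (Quotient.mk s p).out ∈ D := h.out_mem hp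
  obtain ⟨a', rfl⟩ := h'.exists_comp_coordDeriv (x := Quotient.mk s p) hx a
  obtain ⟨b', rfl⟩ := h'.exists_comp_coordDeriv (x := Quotient.mk s p) hx b
  refine (quotientBivector_apply h h' hB hx a' b').trans ?_
  rw [h.apply_out hp, ← hB p hp, h.coordDeriv_eq h' hp]
  rfl

end Bivector
end QuotientManifold

/-! ### The two bivector fields in the separating coordinates -/

section BivectorCoordinates

universe u

variable {𝕜 : Type u} [RCLike 𝕜] {E : Type u} [NormedAddCommGroup E] [NormedSpace 𝕜 E]
  {N : Type*} [TopologicalSpace N] [ChartedSpace E N] [IsManifold 𝓘(𝕜, E) ∞ N]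
  {H : ∀ x : N, TangentSpace 𝓘(𝕜, E) x →L[𝕜] TangentSpace 𝓘(𝕜, E) x}
  {G : ∀ x : N, Submodule 𝕜 (TangentSpace 𝓘(𝕜, E) x)} {m r : ℕ} {x₀ : N}
  {T : Set E} {L : E →L[𝕜] (Fin m → 𝕜)} {X : E → (Fin m → 𝕜) →L[𝕜] E}

lemma IsPreAlgebroid.mlieBracket_frameField [CompleteSpace E]
    {ρ : E → (Fin m → 𝕜) →L[𝕜] E} {C : E → (Fin m → 𝕜) →L[𝕜] (Fin m → 𝕜) →L[𝕜] (Fin m → 𝕜)}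
    (h : IsPreAlgebroid T ρ C) (hT : T ⊆ (extChartAt 𝓘(𝕜, E) x₀).target) {x : N}
    (hx : x ∈ chartDomain 𝕜 x₀ T) (u v : Fin m → 𝕜) :
    VectorField.mlieBracket 𝓘(𝕜, E) (frameField x₀ ρ u) (frameField x₀ ρ v) x =
      frameField x₀ ρ (C (extChartAt 𝓘(𝕜, E) x₀ x) u v) x := by
  have hxs := chartDomain_subset hx
  have h1 := chartDeriv_mlieBracket hxs (isOpen_chartDomain x₀ h.isOpen) hx
    (smooth_frameField h.isOpen h.contDiffOn_anchor u)
    (smooth_frameField h.isOpen h.contDiffOn_anchor v)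
  have h2 (w : Fin m → 𝕜) : chartField x₀ (frameField x₀ ρ w)
      =ᶠ[𝓝 (extChartAt 𝓘(𝕜, E) x₀ x)] fun q ↦ ρ q w := by
    filter_upwards [h.isOpen.mem_nhds hx.2] with q hq
    exact chartField_frameField (hT hq) ρ w
  rw [(h2 u).lieBracket_vectorField_eq (h2 v), h.lieBracket_anchor hx.2] at h1
  rw [← chartDerivSymm_apply hxs (VectorField.mlieBracket 𝓘(𝕜, E) (frameField x₀ ρ u)
    (frameField x₀ ρ v) x), h1]
  rfl

lemma basicAddMomentum_congr {ν : CotangentBundle 𝕜 E N}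
    (ξ : TangentSpace 𝓘(𝕜, E) ν.proj →L[𝕜] 𝕜) {Y Z : ∀ x : N, TangentSpace 𝓘(𝕜, E) x} {U : Set N}
    (hU : IsOpen U) (hν : ν.proj ∈ U) (hYZ : ∀ x ∈ U, Y x = Z x) :
    basicAddMomentum ν ξ Y = basicAddMomentum ν ξ Z := by
  have h1 : momentum Y =ᶠ[𝓝 ν] momentum Z := by
    filter_upwards [(isOpen_proj_preimage hU).mem_nhds hν] with ν' hν'
    exact congrArg (ν'.snd : TangentSpace 𝓘(𝕜, E) ν'.proj →L[𝕜] 𝕜) (hYZ _ hν')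
  have h2 : coordDeriv (cotangentModel 𝕜 E) (momentum Y) ν =
      coordDeriv (cotangentModel 𝕜 E) (momentum Z) ν := h1.mfderiv_eq
  rw [basicAddMomentum, h2]
  rfl

namespace IsFrameInChart

/-- In the separating coordinates, the dual bivector field of the Liouville form is the linear
Poisson structure of the Lie algebroid of `H G`. -/
theorem dualBivector_coordDeriv [FiniteDimensional 𝕜 E]
    (h : IsFrameInChart x₀ G T (chartTensor x₀ H) L X) (hH : SmoothTensor11 𝓘(𝕜, E) H)
    {C : E → (Fin m → 𝕜) →L[𝕜] (Fin m → 𝕜) →L[𝕜] (Fin m → 𝕜)}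
    (hC : IsPreAlgebroid T (imageFrame x₀ H X) C) {ν : CotangentBundle 𝕜 E N}
    (hν : ν ∈ cotangentDomain 𝕜 x₀ T) (a b : (E × ((Fin m → 𝕜) →L[𝕜] 𝕜)) →L[𝕜] 𝕜) :
    dualBivector (cotangentModel 𝕜 E) liouvilleForm ν
        (a.comp (coordDeriv (cotangentModel 𝕜 E) (quotientCoord x₀ (imageFrame x₀ H X)) ν))
        (b.comp (coordDeriv (cotangentModel 𝕜 E) (quotientCoord x₀ (imageFrame x₀ H X)) ν)) =
      a (linearPoisson (imageFrame x₀ H X) C (quotientCoord x₀ (imageFrame x₀ H X) ν) b) := by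
  have hcomplete := FiniteDimensional.complete 𝕜 E
  rw [h.comp_coordDeriv_quotientCoord hH hν, h.comp_coordDeriv_quotientCoord hH hν,
    dualBivector_liouvilleForm _ _ (isOpen_chartDomain x₀ h.isOpen)
      (smooth_frameField h.isOpen hC.contDiffOn_anchor _)
      (smooth_frameField h.isOpen hC.contDiffOn_anchor _) hν, apply_linearPoisson]
  have h1 := hC.mlieBracket_frameField h.subset hν (fiberPart a) (fiberPart b)
  have h2 := chartDeriv_frameField (chartDomain_subset hν) (imageFrame x₀ H X)
  refine congrArg₂ (· + ·) (congrArg₂ (· - ·) ?_ ?_) ?_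
  · exact congrArg (basePart b) (h2 _)
  · exact congrArg (basePart a) (h2 _)
  · exact congrArg (ν.snd : TangentSpace 𝓘(𝕜, E) ν.proj →L[𝕜] 𝕜) h1

/-- In the separating coordinates, the dual bivector field of the pulled back Liouville form is the
linear Poisson structure of the Lie algebroid of `G`. -/
theorem dualBivector_coordDeriv₁ [FiniteDimensional 𝕜 E]
    (h : IsFrameInChart x₀ G T (chartTensor x₀ H) L X) (hH : SmoothTensor11 𝓘(𝕜, E) H)
    (hHs : ∀ x, Function.Surjective (H x))
    {C : E → (Fin m → 𝕜) →L[𝕜] (Fin m → 𝕜) →L[𝕜] (Fin m → 𝕜)}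
    (hC : IsPreAlgebroid T X C) {ν : CotangentBundle 𝕜 E N}
    (hν : ν ∈ cotangentDomain 𝕜 x₀ T) (a b : (E × ((Fin m → 𝕜) →L[𝕜] 𝕜)) →L[𝕜] 𝕜) :
    dualBivector (cotangentModel 𝕜 E) (liouvilleForm₁ H) ν
        (a.comp (coordDeriv (cotangentModel 𝕜 E) (quotientCoord x₀ (imageFrame x₀ H X)) ν))
        (b.comp (coordDeriv (cotangentModel 𝕜 E) (quotientCoord x₀ (imageFrame x₀ H X)) ν)) =
      a (linearPoisson X C (quotientCoord x₀ (imageFrame x₀ H X) ν) b) := by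
  have hcomplete := FiniteDimensional.complete 𝕜 E
  have hU := isOpen_chartDomain (N := N) (𝕜 := 𝕜) x₀ h.isOpen
  have h0 (u : Fin m → 𝕜) (x : N) (hx : x ∈ chartDomain 𝕜 x₀ T) :
      frameField x₀ (imageFrame x₀ H X) u x = H x (frameField x₀ X u x) :=
    (apply_frameField (chartDomain_subset hx) u).symm
  rw [h.comp_coordDeriv_quotientCoord hH hν, h.comp_coordDeriv_quotientCoord hH hν,
    basicAddMomentum_congr _ hU hν (h0 (fiberPart a)),
    basicAddMomentum_congr _ hU hν (h0 (fiberPart b)),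
    dualBivector_liouvilleForm₁ hH hHs _ _ hU
      (smooth_frameField h.isOpen hC.contDiffOn_anchor _)
      (smooth_frameField h.isOpen hC.contDiffOn_anchor _) hν, apply_linearPoisson]
  have h1 := congrArg (H ν.proj)
    (hC.mlieBracket_frameField h.subset hν (fiberPart a) (fiberPart b))
  rw [← h0 _ _ hν] at h1
  have h2 := chartDeriv_frameField (chartDomain_subset hν) X
  refine congrArg₂ (· + ·) (congrArg₂ (· - ·) ?_ ?_) ?_
  · exact congrArg (basePart b) (h2 _)
  · exact congrArg (basePart a) (h2 _)
  · exact congrArg (ν.snd : TangentSpace 𝓘(𝕜, E) ν.proj →L[𝕜] 𝕜) h1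

/-- The separating coordinates are coordinates for the quotient by the orthogonal foliation. -/
theorem isQuotientCoordinates [FiniteDimensional 𝕜 E]
    (h : IsFrameInChart x₀ G T (chartTensor x₀ H) L X) (hH : SmoothTensor11 𝓘(𝕜, E) H)
    (hleaf : ∀ ν ν', leafSetoid (cotangentModel 𝕜 E) (orthogonalFoliation H G) ν ν' ↔
      AgreeOnImage H G ν ν') :
    IsQuotientCoordinates (cotangentModel 𝕜 E)
      (leafSetoid (cotangentModel 𝕜 E) (orthogonalFoliation H G)) (cotangentDomain 𝕜 x₀ T)
      (Prod.fst ⁻¹' T) (quotientCoord x₀ (imageFrame x₀ H X)) (quotientSection x₀ L) where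
  isOpen_source := h.isOpen_cotangentDomain
  isOpen_target := h.isOpen.preimage continuous_fst
  saturated ν ν' hs hν := by
    have h1 := ((hleaf ν ν').1 hs).proj_eq
    change ν'.proj ∈ chartDomain 𝕜 x₀ T
    rw [← h1]
    exact hν
  mapsTo _ hν := hν.2
  mapsTo_symm _ hz := h.quotientSection_mem hz
  right_inv _ hz := h.quotientCoord_quotientSection hz
  eq_iff _ hν _ hν' := (h.quotientCoord_eq_iff hν hν').trans (hleaf _ _).symm
  contMDiffOn := h.contMDiffOn_quotientCoord hH
  contMDiffOn_symm := h.contMDiffOn_quotientSection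

end IsFrameInChart

/-- Bivector fields on `Q` that in suitable coordinates are the linear Poisson structures of a
pencil of Lie algebroids form a bihamiltonian structure. -/
theorem isBihamiltonian_of_isCoordinates [FiniteDimensional 𝕜 E] {E' : Type*}
    [NormedAddCommGroup E'] [NormedSpace 𝕜 E'] {Q : Type*} [TopologicalSpace Q] [ChartedSpace E' Q]
    {Λ Λ₁ : BivectorField 𝓘(𝕜, E') (P := Q)}
    (hΛ : ∀ x₀ : Q, ∃ (O : Set Q) (T : Set E) (ψ : Q → E × ((Fin m → 𝕜) →L[𝕜] 𝕜))
      (θ : E × ((Fin m → 𝕜) →L[𝕜] 𝕜) → Q) (ρ ρ₁ : E → (Fin m → 𝕜) →L[𝕜] E)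
      (C C₁ : E → (Fin m → 𝕜) →L[𝕜] (Fin m → 𝕜) →L[𝕜] (Fin m → 𝕜)),
      IsCoordinates (𝕜 := 𝕜) (E := E') O (Prod.fst ⁻¹' T) ψ θ ∧ x₀ ∈ O ∧
      IsLieAlgebroid T ρ C ∧ IsLieAlgebroid T ρ₁ C₁ ∧
      IsLieAlgebroid T (fun q ↦ ρ q + ρ₁ q) (fun q ↦ C q + C₁ q) ∧
      (∀ x ∈ O, ∀ a b : (E × ((Fin m → 𝕜) →L[𝕜] 𝕜)) →L[𝕜] 𝕜,
        Λ x (a.comp (coordDeriv 𝓘(𝕜, E') ψ x)) (b.comp (coordDeriv 𝓘(𝕜, E') ψ x)) =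
          a (linearPoisson ρ C (ψ x) b)) ∧
      ∀ x ∈ O, ∀ a b : (E × ((Fin m → 𝕜) →L[𝕜] 𝕜)) →L[𝕜] 𝕜,
        Λ₁ x (a.comp (coordDeriv 𝓘(𝕜, E') ψ x)) (b.comp (coordDeriv 𝓘(𝕜, E') ψ x)) =
          a (linearPoisson ρ₁ C₁ (ψ x) b)) :
    IsBihamiltonian 𝓘(𝕜, E') Λ Λ₁ := by
  refine ⟨isPoisson_of_isCoordinates (V := E × ((Fin m → 𝕜) →L[𝕜] 𝕜)) fun x ↦ ?_,
    isPoisson_of_isCoordinates (V := E × ((Fin m → 𝕜) →L[𝕜] 𝕜)) fun x ↦ ?_,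
    isPoisson_of_isCoordinates (V := E × ((Fin m → 𝕜) →L[𝕜] 𝕜)) fun x ↦ ?_⟩ <;>
  obtain ⟨O, T, ψ, θ, ρ, ρ₁, C, C₁, hψ, hx, h, h', h'', hval, hval'⟩ := hΛ x
  · exact ⟨O, _, ψ, θ, _, hψ, hx, h.contDiffOn_linearPoisson,
      fun z hz a b ↦ h.linearPoisson_skew hz a b,
      fun z hz a b c ↦ h.linearPoisson_cyclic hz a b c, hval⟩
  · exact ⟨O, _, ψ, θ, _, hψ, hx, h'.contDiffOn_linearPoisson,
      fun z hz a b ↦ h'.linearPoisson_skew hz a b,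
      fun z hz a b c ↦ h'.linearPoisson_cyclic hz a b c, hval'⟩
  · refine ⟨O, _, ψ, θ, _, hψ, hx, h''.contDiffOn_linearPoisson,
      fun z hz a b ↦ h''.linearPoisson_skew hz a b,
      fun z hz a b c ↦ h''.linearPoisson_cyclic hz a b c, fun x hx a b ↦ ?_⟩
    refine (congrArg₂ (· + ·) (hval x hx a b) (hval' x hx a b)).trans ?_
    simp only [apply_linearPoisson, add_apply, map_add]
    ring

end BivectorCoordinates

/-! ### The quotient of the cotangent bundle -/

/-- The local frames `X` of `G` that are used throughout: `L` is a left inverse of the frame of `H G`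
that is the image of `X`. -/
lemma IsFoliation.exists_isFrameInChart_chartTensor {𝕜 E N : Type*} [RCLike 𝕜]
    [NormedAddCommGroup E] [NormedSpace 𝕜 E] [FiniteDimensional 𝕜 E]
    [TopologicalSpace N] [ChartedSpace E N] [IsManifold 𝓘(𝕜, E) ∞ N]
    {H : ∀ x : N, TangentSpace 𝓘(𝕜, E) x →L[𝕜] TangentSpace 𝓘(𝕜, E) x}
    {G : ∀ x : N, Submodule 𝕜 (TangentSpace 𝓘(𝕜, E) x)} {m r : ℕ}
    (hG : IsFoliation 𝓘(𝕜, E) r G) (hm : m + r = Module.finrank 𝕜 E)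
    (hH : SmoothTensor11 𝓘(𝕜, E) H) (hHinj : ∀ x, Function.Injective (H x)) (x₀ : N) :
    ∃ (T : Set E) (L : E →L[𝕜] (Fin m → 𝕜)) (X : E → (Fin m → 𝕜) →L[𝕜] E),
      IsFrameInChart x₀ G T (chartTensor x₀ H) L X := by
  refine exists_isFrameInChart hG hm x₀ (contDiffOn_chartTensor x₀ hH) fun v w hvw ↦ ?_
  set y := (extChartAt 𝓘(𝕜, E) x₀).symm (extChartAt 𝓘(𝕜, E) x₀ x₀) with hy
  have hx : y ∈ (chartAt E x₀).source := symm_mem_source (mem_extChartAt_target x₀)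
  have h0 := congrArg (chartDerivSymm 𝕜 x₀ y) hvw
  have h1 := hHinj y ((chartDerivSymm_apply hx _).symm.trans (h0.trans (chartDerivSymm_apply hx _)))
  have h2 := congrArg (chartDeriv 𝕜 x₀ y) h1
  exact (chartDeriv_symm hx v).symm.trans (h2.trans (chartDeriv_symm hx w))

section QuotientStructure

universe u

variable {𝕜 : Type u} [RCLike 𝕜] {E : Type u} [NormedAddCommGroup E] [NormedSpace 𝕜 E]
  [FiniteDimensional 𝕜 E] {N : Type*} [TopologicalSpace N] [T2Space N] [SecondCountableTopology N]
  [ChartedSpace E N] [IsManifold 𝓘(𝕜, E) ∞ N]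
  {H : ∀ x : N, TangentSpace 𝓘(𝕜, E) x →L[𝕜] TangentSpace 𝓘(𝕜, E) x}
  {G : ∀ x : N, Submodule 𝕜 (TangentSpace 𝓘(𝕜, E) x)} {m r : ℕ}

/-- The quotient of `T*N`, modelled on any space `E'` of dimension `dim E + m`, where `m` is the rank
of `G`. -/
theorem exists_isBihamiltonian_cotangentQuotient (hm : m + r = Module.finrank 𝕜 E)
    (hH : SmoothTensor11 𝓘(𝕜, E) H) (hHinv : ∀ x, Function.Bijective (H x))
    (hG : IsFoliation 𝓘(𝕜, E) r G) (hclosed : ClosedAlong 𝓘(𝕜, E) H G)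
    (hnij : NijenhuisVanishesOn 𝓘(𝕜, E) H G)
    {E' : Type*} [NormedAddCommGroup E'] [NormedSpace 𝕜 E']
    (e : (E × ((Fin m → 𝕜) →L[𝕜] 𝕜)) ≃L[𝕜] E') :
    T2Space (CotangentQuotient H G) ∧ SecondCountableTopology (CotangentQuotient H G) ∧
    ∃ _ : ChartedSpace E' (CotangentQuotient H G),
      IsManifold 𝓘(𝕜, E') ∞ (CotangentQuotient H G) ∧
      ContMDiff (cotangentModel 𝕜 E) 𝓘(𝕜, E') ∞ (toCotangentQuotient H G) ∧
      (∀ μ, Function.Surjective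
        (mfderiv (cotangentModel 𝕜 E) 𝓘(𝕜, E') (toCotangentQuotient H G) μ)) ∧
      ∃ Λ Λ₁ : BivectorField 𝓘(𝕜, E') (P := CotangentQuotient H G),
        ProjectsTo (cotangentModel 𝕜 E) 𝓘(𝕜, E') (toCotangentQuotient H G)
          (dualBivector (cotangentModel 𝕜 E) liouvilleForm) Λ ∧
        ProjectsTo (cotangentModel 𝕜 E) 𝓘(𝕜, E') (toCotangentQuotient H G)
          (dualBivector (cotangentModel 𝕜 E) (liouvilleForm₁ H)) Λ₁ ∧
        IsBihamiltonian 𝓘(𝕜, E') Λ Λ₁ := by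
  have hcomplete := FiniteDimensional.complete 𝕜 E
  have hframe := hG.exists_isFrameInChart_chartTensor hm hH fun x ↦ (hHinv x).1
  have hleaf := leafSetoid_iff (G := G) hframe hH
  choose T L X hF using hframe
  have hcoord (x : N) := (hF x).isQuotientCoordinates hH hleaf
  have hmem (μ : CotangentBundle 𝕜 E N) : μ ∈ cotangentDomain 𝕜 μ.proj (T μ.proj) :=
    (hF μ.proj).mem_chartDomain
  have hproper : ProperSpace (E × ((Fin m → 𝕜) →L[𝕜] 𝕜)) := FiniteDimensional.proper_rclike 𝕜 _
  have hproj : Continuous (Bundle.TotalSpace.proj : CotangentBundle 𝕜 E N → N) :=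
    FiberBundle.continuous_proj _ _
  refine ⟨t2Space_quotient hcoord hproj (fun μ μ' h ↦ ((hleaf μ μ').1 h).proj_eq)
    fun μ μ' h ↦ ⟨μ.proj, hmem μ, ?_⟩, ?_, ?_⟩
  · change μ'.proj ∈ chartDomain 𝕜 μ.proj (T μ.proj)
    rw [← h]
    exact hmem μ
  · obtain ⟨S, hS, hSN⟩ := TopologicalSpace.countable_cover_nhds
      (f := fun x : N ↦ chartDomain 𝕜 x (T x))
      fun x ↦ (isOpen_chartDomain x (hF x).isOpen).mem_nhds (hF x).mem_chartDomain
    have : Countable S := hS.to_subtype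
    refine secondCountableTopology_quotient (ι := S) (fun x ↦ hcoord x) fun μ ↦ ?_
    obtain ⟨x, hx, hμ⟩ := Set.mem_iUnion₂.1 (hSN.symm ▸ Set.mem_univ μ.proj)
    exact ⟨⟨x, hx⟩, hμ⟩
  obtain ⟨c, hc, hQ⟩ := exists_chartedSpace_quotient hcoord (fun μ ↦ ⟨μ.proj, hmem μ⟩) e
  have hpre (x : N) := (hF x).isPreAlgebroid_imageFrame hG hm hH hclosed hnij
  have hpre' (x : N) := (hF x).isPreAlgebroid hG hH
  have hΛ (x : N) : ∀ μ ∈ cotangentDomain 𝕜 x (T x), ∀ a b, _ :=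
    fun μ hμ a b ↦ (hF x).dualBivector_coordDeriv hH (hpre x) hμ a b
  have hΛ' (x : N) : ∀ μ ∈ cotangentDomain 𝕜 x (T x), ∀ a b, _ :=
    fun μ hμ a b ↦ (hF x).dualBivector_coordDeriv₁ hH (fun y ↦ (hHinv y).2) (hpre' x) hμ a b
  refine ⟨c, hc, fun μ ↦ ?_, fun μ ↦ ?_, quotientBivector _ E' _ _, quotientBivector _ E' _ _,
    projectsTo_quotientBivector fun μ ↦
      ⟨_, _, _, _, _, hmem μ, hcoord μ.proj, hQ μ.proj, hΛ μ.proj⟩,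
    projectsTo_quotientBivector fun μ ↦
      ⟨_, _, _, _, _, hmem μ, hcoord μ.proj, hQ μ.proj, hΛ' μ.proj⟩,
    isBihamiltonian_of_isCoordinates fun x ↦
      ⟨_, _, _, _, _, _, _, _, hQ x.out.proj, hmem x.out,
        ⟨hpre _, fun q hq a b c ↦ (hpre _).jacobiator_eq_zero hq
          ((hF _).injective_imageFrame hq) a b c⟩,
        ⟨hpre' _, fun q hq a b c ↦ (hpre' _).jacobiator_eq_zero hq
          ((hF _).injective hq) a b c⟩,
        (hF _).isLieAlgebroid_add hG hm hH hclosed hnij,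
        fun y hy a b ↦ quotientBivector_apply (hcoord _) (hQ _) (hΛ _) hy a b,
        fun y hy a b ↦ quotientBivector_apply (hcoord _) (hQ _) (hΛ' _) hy a b⟩⟩
  · exact ((hcoord μ.proj).contMDiffOn_mk (hQ μ.proj)).contMDiffAt
      ((hcoord μ.proj).isOpen_source.mem_nhds (hmem μ))
  · obtain ⟨s, hs, hsD, hsΨ, hsμ⟩ := (hF μ.proj).exists_section hH (hmem μ)
    exact (hcoord μ.proj).surjective_mfderiv_mk (hQ μ.proj) (hmem μ) hs hsD hsΨ hsμ

end QuotientStructure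

end

theorem proposition1p4 {𝕜 : Type*} [RCLike 𝕜] (n r : ℕ)
    {N : Type*} [TopologicalSpace N] [T2Space N] [SecondCountableTopology N]
    [ChartedSpace (EuclideanSpace 𝕜 (Fin n)) N]
    [IsManifold 𝓘(𝕜, EuclideanSpace 𝕜 (Fin n)) ∞ N]
    (H : ∀ x : N, TangentSpace 𝓘(𝕜, EuclideanSpace 𝕜 (Fin n)) x →L[𝕜]
      TangentSpace 𝓘(𝕜, EuclideanSpace 𝕜 (Fin n)) x)
    (hH : SmoothTensor11 𝓘(𝕜, EuclideanSpace 𝕜 (Fin n)) H)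
    (hHinv : ∀ x, Function.Bijective (H x))
    (G : ∀ x : N, Submodule 𝕜 (TangentSpace 𝓘(𝕜, EuclideanSpace 𝕜 (Fin n)) x))
    (hG : IsFoliation 𝓘(𝕜, EuclideanSpace 𝕜 (Fin n)) r G)
    (hclosed : ClosedAlong 𝓘(𝕜, EuclideanSpace 𝕜 (Fin n)) H G)
    (hnij : NijenhuisVanishesOn 𝓘(𝕜, EuclideanSpace 𝕜 (Fin n)) H G) :
    T2Space (CotangentQuotient H G) ∧ SecondCountableTopology (CotangentQuotient H G) ∧
    ∃ _ : ChartedSpace (EuclideanSpace 𝕜 (Fin (2 * n - r))) (CotangentQuotient H G),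
      IsManifold 𝓘(𝕜, EuclideanSpace 𝕜 (Fin (2 * n - r))) ∞ (CotangentQuotient H G) ∧
      ContMDiff (cotangentModel 𝕜 (EuclideanSpace 𝕜 (Fin n)))
        𝓘(𝕜, EuclideanSpace 𝕜 (Fin (2 * n - r))) ∞ (toCotangentQuotient H G) ∧
      (∀ μ, Function.Surjective (mfderiv (cotangentModel 𝕜 (EuclideanSpace 𝕜 (Fin n)))
        𝓘(𝕜, EuclideanSpace 𝕜 (Fin (2 * n - r))) (toCotangentQuotient H G) μ)) ∧
      ∃ Λ Λ₁ : BivectorField 𝓘(𝕜, EuclideanSpace 𝕜 (Fin (2 * n - r)))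
          (P := CotangentQuotient H G),
        ProjectsTo (cotangentModel 𝕜 (EuclideanSpace 𝕜 (Fin n)))
          𝓘(𝕜, EuclideanSpace 𝕜 (Fin (2 * n - r))) (toCotangentQuotient H G)
          (dualBivector (cotangentModel 𝕜 (EuclideanSpace 𝕜 (Fin n))) liouvilleForm) Λ ∧
        ProjectsTo (cotangentModel 𝕜 (EuclideanSpace 𝕜 (Fin n)))
          𝓘(𝕜, EuclideanSpace 𝕜 (Fin (2 * n - r))) (toCotangentQuotient H G)
          (dualBivector (cotangentModel 𝕜 (EuclideanSpace 𝕜 (Fin n))) (liouvilleForm₁ H)) Λ₁ ∧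
        IsBihamiltonian 𝓘(𝕜, EuclideanSpace 𝕜 (Fin (2 * n - r))) Λ Λ₁ := by
  have hn : Module.finrank 𝕜 (EuclideanSpace 𝕜 (Fin n)) = n := finrank_euclideanSpace_fin
  by_cases hr : r ≤ n
  · have hdim : Module.finrank 𝕜 (EuclideanSpace 𝕜 (Fin n) × ((Fin (n - r) → 𝕜) →L[𝕜] 𝕜)) =
        Module.finrank 𝕜 (EuclideanSpace 𝕜 (Fin (2 * n - r))) := by
      have h1 : Module.finrank 𝕜 ((Fin (n - r) → 𝕜) →L[𝕜] 𝕜) = n - r := by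
        rw [← LinearMap.toContinuousLinearMap.finrank_eq, Module.finrank_linearMap]
        simp
      rw [Module.finrank_prod, hn, finrank_euclideanSpace_fin, h1]
      omega
    exact exists_isBihamiltonian_cotangentQuotient (m := n - r) (by rw [hn]; omega) hH hHinv hG
      hclosed hnij (ContinuousLinearEquiv.ofFinrankEq hdim)
  · -- The codimension at a point is at most `n`, so that there are no points.
    have hN : IsEmpty N := by
      refine ⟨fun x ↦ hr ?_⟩
      let D : Submodule 𝕜 (EuclideanSpace 𝕜 (Fin n)) := G x
      have h1 := D.finrank_quotient_le
      exact (hG.codim x).symm.le.trans (h1.trans hn.le)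
    have hT : IsEmpty (CotangentBundle 𝕜 (EuclideanSpace 𝕜 (Fin n)) N) :=
      ⟨fun μ ↦ hN.false μ.proj⟩
    have hM : IsEmpty (CotangentQuotient H G) := ⟨fun x ↦ hT.false x.out⟩
    let _ := ChartedSpace.empty (EuclideanSpace 𝕜 (Fin (2 * n - r))) (CotangentQuotient H G)
    have hPoisson (Λ : BivectorField 𝓘(𝕜, EuclideanSpace 𝕜 (Fin (2 * n - r)))
        (P := CotangentQuotient H G)) : IsPoisson _ Λ :=
      ⟨fun x ↦ isEmptyElim x, fun _ _ _ _ _ _ x ↦ isEmptyElim x,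
        fun _ _ _ _ _ _ _ _ x ↦ isEmptyElim x⟩
    exact ⟨inferInstance, inferInstance, _, inferInstance, fun μ ↦ isEmptyElim μ,
      fun μ ↦ isEmptyElim μ, fun x ↦ isEmptyElim x, fun x ↦ isEmptyElim x,
      fun μ ↦ isEmptyElim μ, fun μ ↦ isEmptyElim μ, hPoisson _, hPoisson _, hPoisson _⟩
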